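/- \textbf{Conventions.} A (small) $C^*$-category $\mathbf V$ is a $*$-category, not required to have identity morphisms, whose morphism spaces are complex Banach spaces, with bilinear composition and conjugate-linear involution, such that $\|g\circ f\|\le\|g\|\,\|f\|$, $\|f^*\circ f\|=\|f\|^2$, and every $f^*\circ f$ is positive in the $C^*$-algebra of endomorphisms of the source of $f$. Its multiplier category $M\mathbf V$ is the unital $C^*$-category with the same objects and with morphisms $X\to Y$ the pairs $(L,R)$ of uniformly bounded families of linear maps $L(Z):\mathbf V(Z,X)\to\mathbf V(Z,Y)$, $R(Z):\mathbf V(Y,Z)\to\mathbf V(X,Z)$ with $L(h\circ g)=L(h)\circ g$, $R(f\circ h)=f\circ R(h)$ and $g\circ L(f)=R(g)\circ f$. A linear $*$-functor $\mathbf f:\mathbf V\to M\mathbf W$ is nondegenerate if for all $X,Y$ the closed linear spans of $\mathbf f(\mathbf V(Y,Y))\circ\mathbf W(\mathbf f X,\mathbf f Y)$ and of $\mathbf W(\mathbf f X,\mathbf f Y)\circ\mathbf f(\mathbf V(X,X))$ are all of $\mathbf W(\mathbf f X,\mathbf f Y)$; it then extends uniquely to a unital linear $*$-functor $M\mathbf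 V\to M\mathbf W$. A direct sum of a family $(V_j)_{j\in J}$ of objects of $\mathbf V$ is an object $S$ with multiplier morphisms $\iota_j:V_j\to S$ such that $\iota_j^*\iota_k=\delta_{jk}\,\mathrm{id}$ and $\sum_j\iota_j\iota_j^*=\mathrm{id}_S$ strictly. $\mathbf V$ is countably additive if all countable (including finite and empty) direct sums exist and every projection $p\in M\mathbf V(X,X)$ is of the form $p=\iota\iota^*$ with a multiplier morphism $\iota:U\to X$, $\iota^*\iota=\mathrm{id}_U$. In particular $\mathbf V$ has a zero object. $C^*\mathrm{Lin}$ is the $2$-category of small countably additive $C^*$-categories, with $1$-morphisms $\mathbf V\to\mathbf W$ the nondegenerate linear $*$-functors $\mathbf V\to M\mathbf W$ (composed by means of the unital extensions to multiplier categories), and $2$-morphisms the multiplier natural transformations, that is, the uniformly bounded natural families of multiplier morphisms. Each $C^*\mathrm{Lin}(\mathbf V,\mathbf W)$ is a unital $C^*$-category. For a set $I$ and $C^*$-categories $(\mathbf A_i)_{i\in I}$, the direct product $\prod_{i}\mathbf A_i$ has families $(X_i)_i$ of objects as objects and the families $(f_i)_i$ of morphisms with $(\|f_i\|)_i\in c_0(I)$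 as morphisms, with supremum norm and entrywise operations. For $(\mathbf V_i)_{i\in I}$ in $C^*\mathrm{Lin}$, the direct sum $\bigoplus_i\mathbf V_i$ is the full subcategory of $\prod_i\mathbf V_i$ on the families $(X_i)_i$ such that at most countably many $X_i$ are nonzero, and $\iota_j:\mathbf V_j\to\bigoplus_i\mathbf V_i$ is the linear $*$-functor that sends $X$ to the family with entry $X$ at $j$ and zero objects elsewhere. Finally, $[I,C^*\mathrm{Lin}]((\mathbf V_i)_i,\Delta(\mathbf W))$, with $I$ regarded as a discrete category and $\Delta(\mathbf W)$ the constant diagram, is the unital $C^*$-category whose objects (transformations) are the families $(\mathbf h_i)_{i\in I}$ of $1$-morphisms $\mathbf h_i:\mathbf V_i\to\mathbf W$, and whose morphisms (modifications) are the uniformly bounded families $(\sigma_i)_{i\in I}$ of $2$-morphisms $\sigma_i:\mathbf h_i\Rightarrow\mathbf k_i$. \textbf{Proposition.} Let $I$ be a set and $(\mathbf V_i)_{i\in I}$ a family in $C^*\mathrm{Lin}$. Then $\bigoplus_{i\in I}\mathbf V_i$ is again countably additive, and for every $\mathbf W\in C^*\mathrm{Lin}$ precomposition with the functors $\iota_i$,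 that is, $$\mathbf f\mapsto(\mathbf f\circ\iota_i)_{i\in I},\qquad \sigma\mapsto(\sigma*\iota_i)_{i\in I},$$ is a well-defined unital linear $*$-functor and an equivalence of unital $C^*$-categories $$C^*\mathrm{Lin}\Bigl(\bigoplus_{i\in I}\mathbf V_i,\mathbf W\Bigr)\;\simeq\; M\prod_{i\in I}C^*\mathrm{Lin}(\mathbf V_i,\mathbf W)\;=\;[I,C^*\mathrm{Lin}]\bigl((\mathbf V_i)_{i\in I},\Delta(\mathbf W)\bigr).$$ Here the second identification is the isomorphism of $C^*$-categories that is the identity on objects and lets a uniformly bounded family act entrywise as a multiplier; in particular $\bigoplus_{i}\mathbf V_i$ with the $\iota_i$ is a bicoproduct of the $\mathbf V_i$ in $C^*\mathrm{Lin}$. All this is pseudonatural in $\mathbf W$, in fact strictly $2$-natural: for every $1$-morphism $\mathbf k:\mathbf W\to\mathbf W'$ the precomposition functors and the above isomorphism commute with the functors given by postcomposition with $\mathbf k$, and for every $2$-morphism $\tau:\mathbf k\Rightarrow\mathbf k'$ and every $\mathbf f:\bigoplus_i\mathbf V_i\to\mathbf W$ the precomposition functors send $\tau*\mathbf f$ to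 $(\tau*(\mathbf f\circ\iota_i))_{i\in I}$. -/

import Mathlib

open scoped ENNReal Topology
open Filter

universe u

namespace CStarLin

/-! ## C*-categories (semicategories: identities are not required) -/

/-- A small `*`-category enriched in complex Banach spaces, with submultiplicative norm and the
C*-identity. `comp g f` is the composition `g ∘ f`. Positivity is added in `CStarCat`. -/
structure PreCStarCat where
  Obj : Type u
  Hom : Obj → Obj → Type u
  [normedAddCommGroup : ∀ X Y, NormedAddCommGroup (Hom X Y)]
  [normedSpace : ∀ X Y, NormedSpace ℂ (Hom X Y)]
  [completeSpace : ∀ X Y, CompleteSpace (Hom X Y)]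
  comp : ∀ {X Y Z : Obj}, Hom Y Z → Hom X Y → Hom X Z
  adj : ∀ {X Y : Obj}, Hom X Y → Hom Y X
  comp_assoc : ∀ {W X Y Z : Obj} (h : Hom Y Z) (g : Hom X Y) (f : Hom W X),
    comp (comp h g) f = comp h (comp g f)
  add_comp : ∀ {X Y Z : Obj} (g g' : Hom Y Z) (f : Hom X Y),
    comp (g + g') f = comp g f + comp g' f
  comp_add : ∀ {X Y Z : Obj} (g : Hom Y Z) (f f' : Hom X Y),
    comp g (f + f') = comp g f + comp g f'
  smul_comp : ∀ {X Y Z : Obj} (c : ℂ) (g : Hom Y Z) (f : Hom X Y),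
    comp (c • g) f = c • comp g f
  comp_smul : ∀ {X Y Z : Obj} (c : ℂ) (g : Hom Y Z) (f : Hom X Y),
    comp g (c • f) = c • comp g f
  adj_add : ∀ {X Y : Obj} (f f' : Hom X Y), adj (f + f') = adj f + adj f'
  adj_smul : ∀ {X Y : Obj} (c : ℂ) (f : Hom X Y), adj (c • f) = (starRingEnd ℂ c) • adj f
  adj_adj : ∀ {X Y : Obj} (f : Hom X Y), adj (adj f) = f
  adj_comp : ∀ {X Y Z : Obj} (g : Hom Y Z) (f : Hom X Y),
    adj (comp g f) = comp (adj f) (adj g)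
  norm_comp_le : ∀ {X Y Z : Obj} (g : Hom Y Z) (f : Hom X Y), ‖comp g f‖ ≤ ‖g‖ * ‖f‖
  norm_adj_comp_self : ∀ {X Y : Obj} (f : Hom X Y), ‖comp (adj f) f‖ = ‖f‖ ^ 2

attribute [instance] PreCStarCat.normedAddCommGroup PreCStarCat.normedSpace
  PreCStarCat.completeSpace

/-- A small C*-category: moreover every `f* ∘ f` is a positive element of the C*-algebra of
endomorphisms of the source of `f`, that is, of the form `g* ∘ g` with `g` an endomorphism. -/
structure CStarCat extends PreCStarCat.{u} where
  pos : ∀ {X Y : Obj} (f : Hom X Y), ∃ g : Hom X X, comp (adj f) f = comp (adj g) g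

/-- A small unital C*-category: a C*-category with identity morphisms. -/
structure UCStarCat extends CStarCat.{u} where
  one : ∀ X : Obj, Hom X X
  one_comp : ∀ {X Y : Obj} (f : Hom X Y), comp (one Y) f = f
  comp_one : ∀ {X Y : Obj} (f : Hom X Y), comp f (one X) = f

namespace PreCStarCat

variable (V : PreCStarCat.{u}) {X Y Z : V.Obj}

theorem zero_comp (f : V.Hom X Y) : V.comp (0 : V.Hom Y Z) f = 0 := by
  simpa using V.smul_comp 0 (0 : V.Hom Y Z) f

theorem comp_zero (g : V.Hom Y Z) : V.comp g (0 : V.Hom X Y) = 0 := by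
  simpa using V.comp_smul 0 g (0 : V.Hom X Y)

theorem neg_comp (g : V.Hom Y Z) (f : V.Hom X Y) : V.comp (-g) f = -V.comp g f := by
  simpa using V.smul_comp (-1) g f

theorem comp_neg (g : V.Hom Y Z) (f : V.Hom X Y) : V.comp g (-f) = -V.comp g f := by
  simpa using V.comp_smul (-1) g f

theorem sub_comp (g g' : V.Hom Y Z) (f : V.Hom X Y) :
    V.comp (g - g') f = V.comp g f - V.comp g' f := by
  rw [sub_eq_add_neg, add_comp, neg_comp, sub_eq_add_neg]

theorem comp_sub (g : V.Hom Y Z) (f f' : V.Hom X Y) :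
    V.comp g (f - f') = V.comp g f - V.comp g f' := by
  rw [sub_eq_add_neg, comp_add, comp_neg, sub_eq_add_neg]

theorem adj_zero : V.adj (0 : V.Hom X Y) = 0 := by
  simpa using V.adj_smul 0 (0 : V.Hom X Y)

theorem adj_sub (f f' : V.Hom X Y) : V.adj (f - f') = V.adj f - V.adj f' := by
  have h := V.adj_smul (-1) f'
  rw [map_neg, map_one, neg_smul, one_smul, neg_smul, one_smul] at h
  rw [sub_eq_add_neg, adj_add, h, sub_eq_add_neg]

theorem norm_le_norm_adj (f : V.Hom X Y) : ‖f‖ ≤ ‖V.adj f‖ := by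
  rcases eq_or_ne f 0 with rfl | hf
  · simp
  have h := V.norm_comp_le (V.adj f) f
  rw [norm_adj_comp_self, sq] at h
  exact le_of_mul_le_mul_right h (norm_pos_iff.2 hf)

theorem norm_adj (f : V.Hom X Y) : ‖V.adj f‖ = ‖f‖ := by
  refine le_antisymm ?_ (V.norm_le_norm_adj f)
  have h := V.norm_le_norm_adj (V.adj f)
  rwa [adj_adj] at h

theorem eq_zero_of_adj_comp_self {f : V.Hom X Y} (h : V.comp (V.adj f) f = 0) : f = 0 := by
  have h' := V.norm_adj_comp_self f
  rw [h, norm_zero] at h'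
  exact norm_eq_zero.1 (pow_eq_zero_iff two_ne_zero |>.1 h'.symm)

theorem norm_comp_adj_self (f : V.Hom X Y) : ‖V.comp f (V.adj f)‖ = ‖f‖ ^ 2 := by
  have h := V.norm_adj_comp_self (V.adj f)
  rwa [adj_adj, norm_adj] at h

/-- Postcomposition with `g` as a continuous linear map. -/
noncomputable def compL (W : V.Obj) (g : V.Hom Y Z) : V.Hom W Y →L[ℂ] V.Hom W Z :=
  LinearMap.mkContinuous
    { toFun := fun f => V.comp g f
      map_add' := fun _ _ => V.comp_add _ _ _
      map_smul' := fun _ _ => V.comp_smul _ _ _ } ‖g‖ (fun f => V.norm_comp_le g f)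

/-- Precomposition with `f` as a continuous linear map. -/
noncomputable def compR (W : V.Obj) (f : V.Hom X Y) : V.Hom Y W →L[ℂ] V.Hom X W :=
  LinearMap.mkContinuous
    { toFun := fun g => V.comp g f
      map_add' := fun _ _ => V.add_comp _ _ _
      map_smul' := fun _ _ => V.smul_comp _ _ _ } ‖f‖
    (fun g => (V.norm_comp_le g f).trans_eq (mul_comm _ _))

@[simp] theorem compL_apply (W : V.Obj) (g : V.Hom Y Z) (f : V.Hom W Y) :
    V.compL W g f = V.comp g f := rfl

@[simp] theorem compR_apply (W : V.Obj) (f : V.Hom X Y) (g : V.Hom Y W) :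
    V.compR W f g = V.comp g f := rfl

theorem norm_compL_le (W : V.Obj) (g : V.Hom Y Z) : ‖V.compL W g‖ ≤ ‖g‖ :=
  LinearMap.mkContinuous_norm_le _ (norm_nonneg _) _

theorem norm_compR_le (W : V.Obj) (f : V.Hom X Y) : ‖V.compR W f‖ ≤ ‖f‖ :=
  LinearMap.mkContinuous_norm_le _ (norm_nonneg _) _

/-- The adjoint as a continuous conjugate-linear map. -/
noncomputable def adjL (X Y : V.Obj) : V.Hom X Y →L⋆[ℂ] V.Hom Y X :=
  LinearMap.mkContinuous
    { toFun := fun f => V.adj f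
      map_add' := fun _ _ => V.adj_add _ _
      map_smul' := fun _ _ => V.adj_smul _ _ } 1 (fun f => by
        simpa using (V.norm_adj f).le)

@[simp] theorem adjL_apply (f : V.Hom X Y) : V.adjL X Y f = V.adj f := rfl

theorem continuous_adj : Continuous (fun f : V.Hom X Y => V.adj f) := (V.adjL X Y).continuous

/-- The endomorphisms of an object form a C*-algebra. -/
noncomputable abbrev endAlg (X : V.Obj) : NonUnitalCStarAlgebra (V.Hom X X) :=
  { V.normedAddCommGroup X X, V.normedSpace X X, V.completeSpace X X with
    mul := fun g f => V.comp g f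
    left_distrib := fun _ _ _ => V.comp_add _ _ _
    right_distrib := fun _ _ _ => V.add_comp _ _ _
    zero_mul := fun _ => V.zero_comp _
    mul_zero := fun _ => V.comp_zero _
    mul_assoc := fun _ _ _ => V.comp_assoc _ _ _
    norm_mul_le := fun _ _ => V.norm_comp_le _ _
    star := fun f => V.adj f
    star_involutive := fun _ => V.adj_adj _
    star_mul := fun _ _ => V.adj_comp _ _
    star_add := fun _ _ => V.adj_add _ _
    norm_mul_self_le := fun f => by
      have := V.norm_adj_comp_self f
      rw [← sq]
      exact this.ge
    smul_assoc := fun c f g => V.smul_comp c f g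
    smul_comm := fun c f g => (V.comp_smul c f g).symm
    star_smul := fun c f => V.adj_smul c f }

/-- Positivity of all `f* ∘ f` follows if `f* ∘ f = -(g* ∘ g)` is only possible for `g = 0`. -/
theorem pos_of (h : ∀ (X Y : V.Obj) (f : V.Hom X Y) (g : V.Hom X X),
      V.comp (V.adj f) f + V.comp (V.adj g) g = 0 → g = 0)
    (X Y : V.Obj) (f : V.Hom X Y) :
    ∃ g : V.Hom X X, V.comp (V.adj f) f = V.comp (V.adj g) g := by
  let _ := V.endAlg X
  let _ : PartialOrder (V.Hom X X) := CStarAlgebra.spectralOrder _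
  have _ : StarOrderedRing (V.Hom X X) := CStarAlgebra.spectralOrderedRing _
  set a : V.Hom X X := V.comp (V.adj f) f with ha
  have hsa : IsSelfAdjoint a := by
    change V.adj a = a
    rw [ha, adj_comp, adj_adj]
  have hneg : (0 : V.Hom X X) ≤ a⁻ := CFC.negPart_nonneg a
  have hnsa : V.adj (a⁻) = a⁻ := (IsSelfAdjoint.of_nonneg hneg).star_eq
  have hmul : a * a⁻ = -(a⁻ * a⁻) := by
    have h1 : (a⁺ - a⁻) * a⁻ = -(a⁻ * a⁻) := by
      rw [sub_mul, CFC.posPart_mul_negPart, zero_sub]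
    rwa [CFC.posPart_sub_negPart a hsa] at h1
  have hcube : (0 : V.Hom X X) ≤ a⁻ * a⁻ * a⁻ := by
    have := star_left_conjugate_nonneg hneg (a⁻)
    rwa [show star (a⁻) = a⁻ from hnsa] at this
  obtain ⟨g, hg⟩ := (CStarAlgebra.nonneg_iff_eq_star_mul_self).1 hcube
  have hg0 : g = 0 := by
    refine h X Y (V.comp f (a⁻)) g ?_
    rw [adj_comp, hnsa, comp_assoc, ← V.comp_assoc (V.adj f), ← ha]
    change a⁻ * (a * a⁻) + star g * g = 0
    rw [hmul, ← hg, mul_neg, mul_assoc, neg_add_cancel]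
  have hc0 : a⁻ * a⁻ * a⁻ = 0 := by rw [hg, hg0, mul_zero]
  have hs0 : a⁻ * a⁻ = 0 := by
    have : V.comp (V.adj (a⁻ * a⁻)) (a⁻ * a⁻) = 0 := by
      change star (a⁻ * a⁻) * (a⁻ * a⁻) = 0
      rw [star_mul, show star (a⁻) = a⁻ from hnsa, ← mul_assoc, hc0, zero_mul]
    exact V.eq_zero_of_adj_comp_self this
  have hn0 : a⁻ = 0 := by
    have : V.comp (V.adj (a⁻)) (a⁻) = 0 := by rw [hnsa]; exact hs0
    exact V.eq_zero_of_adj_comp_self this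
  have hpos : 0 ≤ a := by
    rw [← CFC.posPart_sub_negPart a hsa, hn0, sub_zero]
    exact CFC.posPart_nonneg a
  exact (CStarAlgebra.nonneg_iff_eq_star_mul_self).1 hpos

end PreCStarCat

namespace CStarCat

variable (V : CStarCat.{u})

theorem eq_zero_of_add {X Y Z : V.Obj} (f : V.Hom X Y) (g : V.Hom X Z)
    (h : V.comp (V.adj f) f + V.comp (V.adj g) g = 0) : g = 0 := by
  let _ := V.endAlg X
  let _ : PartialOrder (V.Hom X X) := CStarAlgebra.spectralOrder _
  have _ : StarOrderedRing (V.Hom X X) := CStarAlgebra.spectralOrderedRing _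
  obtain ⟨k, hk⟩ := V.pos f
  obtain ⟨m, hm⟩ := V.pos g
  have h1 : (0 : V.Hom X X) ≤ star k * k := star_mul_self_nonneg k
  have h2 : (0 : V.Hom X X) ≤ star m * m := star_mul_self_nonneg m
  have h3 : star k * k + star m * m = 0 := by
    rw [hk, hm] at h
    exact h
  have h4 : star m * m = 0 := ((add_eq_zero_iff_of_nonneg h1 h2).1 h3).2
  exact V.eq_zero_of_adj_comp_self (hm.trans h4)

/-- Every endomorphism C*-algebra has an approximate unit that also acts as one on morphism
spaces into the object. -/
theorem exists_approxUnit (X : V.Obj) : ∃ l : Filter (V.Hom X X), l.NeBot ∧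
    (∀ᶠ e in l, ‖e‖ ≤ 1) ∧
    (∀ (Z : V.Obj) (f : V.Hom Z X), Tendsto (fun e => V.comp e f) l (𝓝 f)) := by
  let _ := V.endAlg X
  let _ : PartialOrder (V.Hom X X) := CStarAlgebra.spectralOrder _
  have _ : StarOrderedRing (V.Hom X X) := CStarAlgebra.spectralOrderedRing _
  have H := CStarAlgebra.increasingApproximateUnit (V.Hom X X)
  refine ⟨CStarAlgebra.approximateUnit (V.Hom X X), H.neBot, H.eventually_norm, ?_⟩
  intro Z f
  set k : V.Hom X X := V.comp f (V.adj f) with hk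
  have h1 : Tendsto (fun e : V.Hom X X => V.comp e k) (CStarAlgebra.approximateUnit (V.Hom X X))
      (𝓝 k) := H.tendsto_mul_right k
  rw [tendsto_iff_norm_sub_tendsto_zero] at h1 ⊢
  have h2 : Tendsto (fun e : V.Hom X X => 2 * ‖V.comp e k - k‖)
      (CStarAlgebra.approximateUnit (V.Hom X X)) (𝓝 0) := by
    simpa using h1.const_mul 2
  have h3 : Tendsto (fun e : V.Hom X X => ‖V.comp e f - f‖ ^ 2)
      (CStarAlgebra.approximateUnit (V.Hom X X)) (𝓝 0) := by
    refine squeeze_zero' (Eventually.of_forall fun _ => by positivity) ?_ h2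
    filter_upwards [H.eventually_norm] with e he
    rw [← V.norm_comp_adj_self]
    have : V.comp (V.comp e f - f) (V.adj (V.comp e f - f))
        = V.comp (V.comp e k - k) (V.adj e) - (V.comp e k - k) := by
      simp only [V.adj_sub, V.adj_comp, V.sub_comp, V.comp_sub, V.comp_assoc, hk]
      abel
    rw [this]
    calc _ ≤ ‖V.comp (V.comp e k - k) (V.adj e)‖ + ‖V.comp e k - k‖ := norm_sub_le _ _
      _ ≤ ‖V.comp e k - k‖ * 1 + ‖V.comp e k - k‖ := by
        gcongr
        refine (V.norm_comp_le _ _).trans ?_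
        gcongr
        rw [V.norm_adj]
        exact he
      _ = _ := by ring
  have h4 := h3.sqrt
  simpa using h4

theorem eq_of_forall_comp_left {X Y : V.Obj} {f g : V.Hom X Y}
    (h : ∀ k : V.Hom Y X, V.comp k f = V.comp k g) : f = g := by
  rw [← sub_eq_zero]
  refine V.eq_zero_of_adj_comp_self ?_
  rw [V.comp_sub, h, sub_self]

theorem eq_of_forall_comp_right {X Y : V.Obj} {f g : V.Hom X Y}
    (h : ∀ k : V.Hom Y X, V.comp f k = V.comp g k) : f = g := by
  rw [← sub_eq_zero, ← norm_eq_zero, ← V.norm_adj, norm_eq_zero]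
  refine V.eq_zero_of_adj_comp_self ?_
  rw [V.adj_adj, V.sub_comp, h, sub_self]

end CStarCat

/-! ## Products and subcategories of C*-categories -/

namespace PreCStarCat

/-- Bounded families of morphisms, with the supremum norm. -/
noncomputable def bddProd {I : Type u} (A : I → PreCStarCat.{u}) : PreCStarCat.{u} where
  Obj := ∀ i, (A i).Obj
  Hom X Y := lp (fun i => (A i).Hom (X i) (Y i)) ∞
  comp g f := ⟨fun i => (A i).comp (g i) (f i), memℓp_infty ⟨‖g‖ * ‖f‖, by
    rintro _ ⟨i, rfl⟩
    refine ((A i).norm_comp_le _ _).trans ?_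
    gcongr <;> exact lp.norm_apply_le_norm ENNReal.top_ne_zero _ i⟩⟩
  adj f := ⟨fun i => (A i).adj (f i), memℓp_infty ⟨‖f‖, by
    rintro _ ⟨i, rfl⟩
    exact ((A i).norm_adj _).trans_le (lp.norm_apply_le_norm ENNReal.top_ne_zero _ i)⟩⟩
  comp_assoc _ _ _ := lp.ext (funext fun i => (A i).comp_assoc _ _ _)
  add_comp _ _ _ := lp.ext (funext fun i => (A i).add_comp _ _ _)
  comp_add _ _ _ := lp.ext (funext fun i => (A i).comp_add _ _ _)
  smul_comp _ _ _ := lp.ext (funext fun i => (A i).smul_comp _ _ _)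
  comp_smul _ _ _ := lp.ext (funext fun i => (A i).comp_smul _ _ _)
  adj_add _ _ := lp.ext (funext fun i => (A i).adj_add _ _)
  adj_smul _ _ := lp.ext (funext fun i => (A i).adj_smul _ _)
  adj_adj _ := lp.ext (funext fun i => (A i).adj_adj _)
  adj_comp _ _ := lp.ext (funext fun i => (A i).adj_comp _ _)
  norm_comp_le g f := by
    refine lp.norm_le_of_forall_le (by positivity) fun i => ?_
    refine ((A i).norm_comp_le _ _).trans ?_
    gcongr <;> exact lp.norm_apply_le_norm ENNReal.top_ne_zero _ i
  norm_adj_comp_self f := by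
    refine le_antisymm ?_ ?_
    · refine lp.norm_le_of_forall_le (by positivity) fun i => ?_
      refine ((A i).norm_adj_comp_self _).trans_le ?_
      gcongr
      exact lp.norm_apply_le_norm ENNReal.top_ne_zero _ i
    · rw [← Real.sqrt_le_sqrt_iff (norm_nonneg _), Real.sqrt_sq (norm_nonneg _)]
      refine lp.norm_le_of_forall_le (Real.sqrt_nonneg _) fun i => ?_
      refine Real.le_sqrt_of_sq_le ?_
      rw [← (A i).norm_adj_comp_self]
      exact lp.norm_apply_le_norm (E := fun i => (A i).Hom _ _) ENNReal.top_ne_zero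
        (⟨fun i => (A i).comp ((A i).adj (f i)) (f i), _⟩ :
          lp (fun i => (A i).Hom _ _) ∞) i

end PreCStarCat

namespace CStarCat

theorem lp_apply_add_eq_zero {I : Type u} {E : I → Type u} [∀ i, NormedAddCommGroup (E i)]
    {a b : lp E ∞} (h : a + b = 0) (i : I) : a i + b i = 0 := by
  have h' : (a + b : lp E ∞) i = (0 : lp E ∞) i := by rw [h]
  rwa [lp.coeFn_add, lp.coeFn_zero] at h'

/-- Bounded families of morphisms, with the supremum norm. -/
noncomputable def bddProd {I : Type u} (A : I → CStarCat.{u}) : CStarCat.{u} where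
  toPreCStarCat := PreCStarCat.bddProd fun i => (A i).toPreCStarCat
  pos {X Y} f := PreCStarCat.pos_of (PreCStarCat.bddProd fun i => (A i).toPreCStarCat)
    (fun (X Y : ∀ i, (A i).Obj) (f : lp (fun i => (A i).Hom (X i) (Y i)) ∞)
        (g : lp (fun i => (A i).Hom (X i) (X i)) ∞) h =>
      lp.ext (funext fun i =>
        (A i).eq_zero_of_add (f i) (g i)
          (lp_apply_add_eq_zero (E := fun i => (A i).Hom (X i) (X i)) h i))) X Y f

/-- The full subcategory of `V` on a family of objects of `V`. -/
noncomputable def full (V : CStarCat.{u}) {O : Type u} (o : O → V.Obj) : CStarCat.{u} where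
  Obj := O
  Hom X Y := V.Hom (o X) (o Y)
  comp := V.comp
  adj := V.adj
  comp_assoc := V.comp_assoc
  add_comp := V.add_comp
  comp_add := V.comp_add
  smul_comp := V.smul_comp
  comp_smul := V.comp_smul
  adj_add := V.adj_add
  adj_smul := V.adj_smul
  adj_adj := V.adj_adj
  adj_comp := V.adj_comp
  norm_comp_le := V.norm_comp_le
  norm_adj_comp_self := V.norm_adj_comp_self
  pos := V.pos

/-- Bounded families of morphisms whose norms vanish at infinity. -/
def c0 {I : Type u} (A : I → CStarCat.{u}) (X Y : ∀ i, (A i).Obj) :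
    Submodule ℂ (lp (fun i => (A i).Hom (X i) (Y i)) ∞) where
  carrier := {f | Tendsto (fun i => ‖f i‖) cofinite (𝓝 0)}
  add_mem' {f g} hf hg := by
    refine squeeze_zero (fun _ => norm_nonneg _) (fun i => norm_add_le (f i) (g i)) ?_
    simpa using Tendsto.add hf hg
  zero_mem' := by
    change Tendsto (fun i => ‖(0 : (A i).Hom (X i) (Y i))‖) cofinite (𝓝 0)
    simpa using tendsto_const_nhds
  smul_mem' c f hf := by
    change Tendsto (fun i => ‖c • f i‖) cofinite (𝓝 0)
    simp_rw [norm_smul]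
    simpa using Tendsto.const_mul ‖c‖ hf

theorem isClosed_c0 {I : Type u} (A : I → CStarCat.{u}) (X Y : ∀ i, (A i).Obj) :
    IsClosed (c0 A X Y : Set (lp (fun i => (A i).Hom (X i) (Y i)) ∞)) := by
  refine isClosed_of_closure_subset fun f hf => ?_
  change Tendsto (fun i => ‖f i‖) cofinite (𝓝 0)
  rw [Metric.tendsto_nhds]
  intro ε hε
  obtain ⟨g, hg, hfg⟩ := Metric.mem_closure_iff.1 hf (ε / 2) (half_pos hε)
  have hg' : Tendsto (fun i => ‖g i‖) cofinite (𝓝 0) := hg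
  filter_upwards [Metric.tendsto_nhds.1 hg' (ε / 2) (half_pos hε)] with i hi
  rw [dist_eq_norm] at hfg
  have h1 : ‖f i - g i‖ ≤ ‖f - g‖ :=
    lp.norm_apply_le_norm ENNReal.top_ne_zero (f - g) i
  have h2 : ‖f i‖ ≤ ‖f i - g i‖ + ‖g i‖ := by
    simpa using norm_add_le (f i - g i) (g i)
  simp only [dist_zero_right, norm_norm] at hi ⊢
  linarith

end CStarCat

/-- Morphisms in the direct product: `c₀`-families of morphisms, a Banach space. -/
def ProdHom {I : Type u} (A : I → CStarCat.{u}) (X Y : ∀ i, (A i).Obj) : Type u :=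
  CStarCat.c0 A X Y

namespace ProdHom

variable {I : Type u} {A : I → CStarCat.{u}} {X Y Z : ∀ i, (A i).Obj}

noncomputable instance : NormedAddCommGroup (ProdHom A X Y) :=
  Submodule.normedAddCommGroup (CStarCat.c0 A X Y)

noncomputable instance : NormedSpace ℂ (ProdHom A X Y) :=
  Submodule.normedSpace (CStarCat.c0 A X Y)

instance : CompleteSpace (ProdHom A X Y) :=
  (CStarCat.isClosed_c0 A X Y).completeSpace_coe

/-- The entry at `i`. -/
def app (f : ProdHom A X Y) (i : I) : (A i).Hom (X i) (Y i) := f.1 i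

theorem tendsto (f : ProdHom A X Y) : Tendsto (fun i => ‖f.app i‖) cofinite (𝓝 0) := f.2

@[ext] theorem ext {f g : ProdHom A X Y} (h : ∀ i, f.app i = g.app i) : f = g :=
  Subtype.ext (Subtype.ext (funext h))

theorem norm_app_le (f : ProdHom A X Y) (i : I) : ‖f.app i‖ ≤ ‖f‖ :=
  lp.norm_apply_le_norm ENNReal.top_ne_zero f.1 i

theorem norm_le_of {f : ProdHom A X Y} {C : ℝ} (hC : 0 ≤ C) (h : ∀ i, ‖f.app i‖ ≤ C) : ‖f‖ ≤ C :=
  lp.norm_le_of_forall_le hC h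

/-- A family of morphisms whose norms vanish at infinity. -/
def mk (f : ∀ i, (A i).Hom (X i) (Y i)) (h : Tendsto (fun i => ‖f i‖) cofinite (𝓝 0)) :
    ProdHom A X Y :=
  ⟨⟨f, memℓp_infty h.isBoundedUnder_le.bddAbove_range_of_cofinite⟩, h⟩

@[simp] theorem mk_app (f : ∀ i, (A i).Hom (X i) (Y i))
    (h : Tendsto (fun i => ‖f i‖) cofinite (𝓝 0)) (i : I) : (mk f h).app i = f i := rfl

@[simp] theorem add_app (f g : ProdHom A X Y) (i : I) : (f + g).app i = f.app i + g.app i := rfl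

@[simp] theorem sub_app (f g : ProdHom A X Y) (i : I) : (f - g).app i = f.app i - g.app i := rfl

@[simp] theorem smul_app (c : ℂ) (f : ProdHom A X Y) (i : I) : (c • f).app i = c • f.app i := rfl

/-- Entrywise composition. -/
def comp (g : ProdHom A Y Z) (f : ProdHom A X Y) : ProdHom A X Z :=
  mk (fun i => (A i).comp (g.app i) (f.app i))
    (squeeze_zero (fun _ => norm_nonneg _) (fun i => (A i).norm_comp_le _ _)
      (by simpa using g.tendsto.mul f.tendsto))

/-- Entrywise adjoint. -/
def adj (f : ProdHom A X Y) : ProdHom A Y X :=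
  mk (fun i => (A i).adj (f.app i))
    (squeeze_zero (fun _ => norm_nonneg _) (fun i => ((A i).norm_adj _).le) f.tendsto)

@[simp] theorem comp_app (g : ProdHom A Y Z) (f : ProdHom A X Y) (i : I) :
    (g.comp f).app i = (A i).comp (g.app i) (f.app i) := rfl

@[simp] theorem adj_app (f : ProdHom A X Y) (i : I) : f.adj.app i = (A i).adj (f.app i) := rfl

theorem norm_comp_le (g : ProdHom A Y Z) (f : ProdHom A X Y) : ‖g.comp f‖ ≤ ‖g‖ * ‖f‖ :=
  norm_le_of (by positivity) fun i =>
    ((A i).norm_comp_le _ _).trans (by gcongr <;> exact norm_app_le _ _)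

theorem norm_adj_comp_self (f : ProdHom A X Y) : ‖f.adj.comp f‖ = ‖f‖ ^ 2 := by
  refine le_antisymm (norm_le_of (by positivity) fun i => ?_) ?_
  · rw [comp_app, adj_app, (A i).norm_adj_comp_self]
    gcongr
    exact norm_app_le _ _
  · rw [← Real.sqrt_le_sqrt_iff (norm_nonneg _), Real.sqrt_sq (norm_nonneg _)]
    refine norm_le_of (Real.sqrt_nonneg _) fun i => Real.le_sqrt_of_sq_le ?_
    rw [← (A i).norm_adj_comp_self]
    exact norm_app_le (f.adj.comp f) i

theorem eq_zero_of_add (f : ProdHom A X Y) (g : ProdHom A X Z)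
    (h : f.adj.comp f + g.adj.comp g = 0) : g = 0 :=
  ext fun i => (A i).eq_zero_of_add (f.app i) (g.app i)
    (congrArg (fun k : ProdHom A X X => k.app i) h)

end ProdHom

namespace CStarCat

/-- The Banach-enriched `*`-category underlying the direct product. -/
noncomputable def prodPre {I : Type u} (A : I → CStarCat.{u}) : PreCStarCat.{u} where
  Obj := ∀ i, (A i).Obj
  Hom X Y := ProdHom A X Y
  comp := ProdHom.comp
  adj := ProdHom.adj
  comp_assoc _ _ _ := ProdHom.ext fun i => (A i).comp_assoc _ _ _
  add_comp _ _ _ := ProdHom.ext fun i => (A i).add_comp _ _ _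
  comp_add _ _ _ := ProdHom.ext fun i => (A i).comp_add _ _ _
  smul_comp _ _ _ := ProdHom.ext fun i => (A i).smul_comp _ _ _
  comp_smul _ _ _ := ProdHom.ext fun i => (A i).comp_smul _ _ _
  adj_add _ _ := ProdHom.ext fun i => (A i).adj_add _ _
  adj_smul _ _ := ProdHom.ext fun i => (A i).adj_smul _ _
  adj_adj _ := ProdHom.ext fun i => (A i).adj_adj _
  adj_comp _ _ := ProdHom.ext fun i => (A i).adj_comp _ _
  norm_comp_le := ProdHom.norm_comp_le
  norm_adj_comp_self := ProdHom.norm_adj_comp_self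

/-- The direct product `∏ A i`: objects are families of objects, morphisms are the `c₀`-families
of morphisms, that is, families whose norms vanish at infinity, with the supremum norm and
entrywise operations. -/
noncomputable def prod {I : Type u} (A : I → CStarCat.{u}) : CStarCat.{u} where
  toPreCStarCat := prodPre A
  pos {X Y} f := PreCStarCat.pos_of (prodPre A)
    (fun _ _ f g h => ProdHom.eq_zero_of_add (A := A) f g h) X Y f

end CStarCat

namespace UCStarCat

theorem norm_one_le (A : UCStarCat.{u}) (X : A.Obj) : ‖A.one X‖ ≤ 1 := by
  have h := A.norm_adj_comp_self (A.one X)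
  rw [A.comp_one, A.norm_adj] at h
  nlinarith [norm_nonneg (A.one X)]

theorem adj_one (A : UCStarCat.{u}) (X : A.Obj) : A.adj (A.one X) = A.one X := by
  have h := A.adj_comp (A.adj (A.one X)) (A.one X)
  rw [A.comp_one, A.adj_adj, A.comp_one] at h
  exact h.symm

/-- Bounded families of morphisms between families of objects in unital C*-categories. -/
noncomputable def bddProd {I : Type u} (A : I → UCStarCat.{u}) : UCStarCat.{u} where
  toCStarCat := CStarCat.bddProd fun i => (A i).toCStarCat
  one := fun (X : ∀ i, (A i).Obj) => (⟨fun i => (A i).one (X i), memℓp_infty ⟨1, by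
    rintro _ ⟨i, rfl⟩
    exact (A i).norm_one_le _⟩⟩ : lp (fun i => (A i).Hom (X i) (X i)) ∞)
  one_comp {X Y : ∀ i, (A i).Obj} _ := lp.ext (E := fun i => (A i).Hom (X i) (Y i))
    (funext fun i => (A i).one_comp _)
  comp_one {X Y : ∀ i, (A i).Obj} _ := lp.ext (E := fun i => (A i).Hom (X i) (Y i))
    (funext fun i => (A i).comp_one _)

end UCStarCat

/-! ## Linear `*`-functors -/

/-- A linear `*`-functor (preserving composition; identities play no role). -/
structure StarFun (V W : PreCStarCat.{u}) where
  obj : V.Obj → W.Obj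
  map : ∀ {X Y : V.Obj}, V.Hom X Y → W.Hom (obj X) (obj Y)
  map_add : ∀ {X Y : V.Obj} (f g : V.Hom X Y), map (f + g) = map f + map g
  map_smul : ∀ {X Y : V.Obj} (c : ℂ) (f : V.Hom X Y), map (c • f) = c • map f
  map_comp : ∀ {X Y Z : V.Obj} (g : V.Hom Y Z) (f : V.Hom X Y),
    map (V.comp g f) = W.comp (map g) (map f)
  map_adj : ∀ {X Y : V.Obj} (f : V.Hom X Y), map (V.adj f) = W.adj (map f)

namespace StarFun

variable {V W U : PreCStarCat.{u}}

theorem map_zero (F : StarFun V W) (X Y : V.Obj) : F.map (0 : V.Hom X Y) = 0 := by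
  simpa using F.map_smul 0 (0 : V.Hom X Y)

theorem map_sub (F : StarFun V W) {X Y : V.Obj} (f g : V.Hom X Y) :
    F.map (f - g) = F.map f - F.map g := by
  have h := F.map_add (f - g) g
  rw [sub_add_cancel] at h
  rw [h, add_sub_cancel_right]

/-- Linear `*`-functors between C*-categories are contractive. -/
theorem norm_map_le (F : StarFun V W) {X Y : V.Obj} (f : V.Hom X Y) : ‖F.map f‖ ≤ ‖f‖ := by
  let _ := V.endAlg X
  let _ := W.endAlg (F.obj X)
  let φ : V.Hom X X →⋆ₙₐ[ℂ] W.Hom (F.obj X) (F.obj X) :=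
    { toFun := fun f => F.map f
      map_smul' := fun c f => F.map_smul c f
      map_zero' := F.map_zero X X
      map_add' := fun f g => F.map_add f g
      map_mul' := fun g f => F.map_comp g f
      map_star' := fun f => F.map_adj f }
  have h : ‖F.map (V.comp (V.adj f) f)‖ ≤ ‖V.comp (V.adj f) f‖ :=
    NonUnitalStarAlgHom.norm_apply_le φ _
  rw [F.map_comp, F.map_adj, W.norm_adj_comp_self, V.norm_adj_comp_self] at h
  exact (sq_le_sq₀ (norm_nonneg _) (norm_nonneg _)).1 h

/-- The action on morphisms as a continuous linear map. -/
noncomputable def mapL (F : StarFun V W) (X Y : V.Obj) :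
    V.Hom X Y →L[ℂ] W.Hom (F.obj X) (F.obj Y) :=
  LinearMap.mkContinuous
    { toFun := fun f => F.map f
      map_add' := fun _ _ => F.map_add _ _
      map_smul' := fun _ _ => F.map_smul _ _ } 1 (fun f => by simpa using F.norm_map_le f)

@[simp] theorem mapL_apply (F : StarFun V W) {X Y : V.Obj} (f : V.Hom X Y) :
    F.mapL X Y f = F.map f := rfl

/-- The composition `G ∘ F`. -/
def comp (G : StarFun W U) (F : StarFun V W) : StarFun V U where
  obj X := G.obj (F.obj X)
  map f := G.map (F.map f)
  map_add _ _ := by rw [F.map_add, G.map_add]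
  map_smul _ _ := by rw [F.map_smul, G.map_smul]
  map_comp _ _ := by rw [F.map_comp, G.map_comp]
  map_adj _ := by rw [F.map_adj, G.map_adj]

end StarFun

/-! ## Multipliers -/

section Mult

variable (V : CStarCat.{u})

/-- Multiplier morphisms `X → Y`: pairs of uniformly bounded families of linear maps
`L Z : V(Z, X) → V(Z, Y)` and `R Z : V(Y, Z) → V(X, Z)` that are a left and a right multiplier
and are compatible with each other. The norm is `max (sup ‖L Z‖) (sup ‖R Z‖)`. -/
def multSub (X Y : V.Obj) : Submodule ℂ
    (lp (fun Z => V.Hom Z X →L[ℂ] V.Hom Z Y) ∞ × lp (fun Z => V.Hom Y Z →L[ℂ] V.Hom X Z) ∞) where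
  carrier := {p |
    (∀ (W Z : V.Obj) (h : V.Hom Z X) (g : V.Hom W Z),
      p.1 W (V.comp h g) = V.comp (p.1 Z h) g) ∧
    (∀ (W Z : V.Obj) (f : V.Hom W Z) (h : V.Hom Y W),
      p.2 Z (V.comp f h) = V.comp f (p.2 W h)) ∧
    (∀ (W Z : V.Obj) (f : V.Hom W X) (g : V.Hom Y Z),
      V.comp g (p.1 W f) = V.comp (p.2 Z g) f)}
  add_mem' {p q} hp hq := by
    refine ⟨fun W Z h g => ?_, fun W Z f h => ?_, fun W Z f g => ?_⟩
    · change p.1 W _ + q.1 W _ = V.comp (p.1 Z h + q.1 Z h) g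
      rw [V.add_comp, hp.1, hq.1]
    · change p.2 Z _ + q.2 Z _ = V.comp f (p.2 W h + q.2 W h)
      rw [V.comp_add, hp.2.1, hq.2.1]
    · change V.comp g (p.1 W f + q.1 W f) = V.comp (p.2 Z g + q.2 Z g) f
      rw [V.comp_add, V.add_comp, hp.2.2, hq.2.2]
  zero_mem' := by
    refine ⟨fun W Z h g => ?_, fun W Z f h => ?_, fun W Z f g => ?_⟩
    · exact (V.zero_comp _).symm
    · exact (V.comp_zero _).symm
    · exact (V.comp_zero _).trans (V.zero_comp _).symm
  smul_mem' c p hp := by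
    refine ⟨fun W Z h g => ?_, fun W Z f h => ?_, fun W Z f g => ?_⟩
    · change c • p.1 W _ = V.comp (c • p.1 Z h) g
      rw [V.smul_comp, hp.1]
    · change c • p.2 Z _ = V.comp f (c • p.2 W h)
      rw [V.comp_smul, hp.2.1]
    · change V.comp g (c • p.1 W f) = V.comp (c • p.2 Z g) f
      rw [V.comp_smul, V.smul_comp, hp.2.2]

theorem isClosed_multSub (X Y : V.Obj) : IsClosed (multSub V X Y : Set
    (lp (fun Z => V.Hom Z X →L[ℂ] V.Hom Z Y) ∞ ×
      lp (fun Z => V.Hom Y Z →L[ℂ] V.Hom X Z) ∞)) := by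
  have c1 : ∀ (Z : V.Obj) (f : V.Hom Z X), Continuous fun p :
      lp (fun Z => V.Hom Z X →L[ℂ] V.Hom Z Y) ∞ × lp (fun Z => V.Hom Y Z →L[ℂ] V.Hom X Z) ∞ =>
      p.1 Z f := fun Z f => by
    have h := (lp.lipschitzWith_one_eval (E := fun Z => V.Hom Z X →L[ℂ] V.Hom Z Y) ∞ Z).continuous
    exact (ContinuousLinearMap.apply ℂ _ f).continuous.comp (h.comp continuous_fst)
  have c2 : ∀ (Z : V.Obj) (g : V.Hom Y Z), Continuous fun p :
      lp (fun Z => V.Hom Z X →L[ℂ] V.Hom Z Y) ∞ × lp (fun Z => V.Hom Y Z →L[ℂ] V.Hom X Z) ∞ =>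
      p.2 Z g := fun Z g => by
    have h := (lp.lipschitzWith_one_eval (E := fun Z => V.Hom Y Z →L[ℂ] V.Hom X Z) ∞ Z).continuous
    exact (ContinuousLinearMap.apply ℂ _ g).continuous.comp (h.comp continuous_snd)
  refine IsClosed.inter ?_ (IsClosed.inter ?_ ?_)
  · change IsClosed {p : lp (fun Z => V.Hom Z X →L[ℂ] V.Hom Z Y) ∞ ×
      lp (fun Z => V.Hom Y Z →L[ℂ] V.Hom X Z) ∞ | ∀ (W Z : V.Obj) (h : V.Hom Z X) (g : V.Hom W Z),
        p.1 W (V.comp h g) = V.comp (p.1 Z h) g}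
    simp only [Set.ofPred_forall]
    exact isClosed_iInter fun W => isClosed_iInter fun Z => isClosed_iInter fun h =>
      isClosed_iInter fun g => isClosed_eq (c1 _ _) ((V.compR _ g).continuous.comp (c1 _ _))
  · change IsClosed {p : lp (fun Z => V.Hom Z X →L[ℂ] V.Hom Z Y) ∞ ×
      lp (fun Z => V.Hom Y Z →L[ℂ] V.Hom X Z) ∞ | ∀ (W Z : V.Obj) (f : V.Hom W Z) (h : V.Hom Y W),
        p.2 Z (V.comp f h) = V.comp f (p.2 W h)}
    simp only [Set.ofPred_forall]
    exact isClosed_iInter fun W => isClosed_iInter fun Z => isClosed_iInter fun f =>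
      isClosed_iInter fun h => isClosed_eq (c2 _ _) ((V.compL _ f).continuous.comp (c2 _ _))
  · change IsClosed {p : lp (fun Z => V.Hom Z X →L[ℂ] V.Hom Z Y) ∞ ×
      lp (fun Z => V.Hom Y Z →L[ℂ] V.Hom X Z) ∞ | ∀ (W Z : V.Obj) (f : V.Hom W X) (g : V.Hom Y Z),
        V.comp g (p.1 W f) = V.comp (p.2 Z g) f}
    simp only [Set.ofPred_forall]
    exact isClosed_iInter fun W => isClosed_iInter fun Z => isClosed_iInter fun f =>
      isClosed_iInter fun g => isClosed_eq ((V.compL _ g).continuous.comp (c1 _ _))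
        ((V.compR _ f).continuous.comp (c2 _ _))

/-- Multiplier morphisms `X → Y`, a Banach space. -/
def MultHom (X Y : V.Obj) : Type u := multSub V X Y

noncomputable instance (X Y : V.Obj) : NormedAddCommGroup (MultHom V X Y) :=
  Submodule.normedAddCommGroup (multSub V X Y)

noncomputable instance (X Y : V.Obj) : NormedSpace ℂ (MultHom V X Y) :=
  Submodule.normedSpace (multSub V X Y)

instance (X Y : V.Obj) : CompleteSpace (MultHom V X Y) :=
  (isClosed_multSub V X Y).completeSpace_coe

variable {V}

namespace MultHom

/-- The left multiplier of a multiplier morphism. -/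
def L {X Y : V.Obj} (F : MultHom V X Y) (Z : V.Obj) : V.Hom Z X →L[ℂ] V.Hom Z Y := F.1.1 Z

/-- The right multiplier of a multiplier morphism. -/
def R {X Y : V.Obj} (F : MultHom V X Y) (Z : V.Obj) : V.Hom Y Z →L[ℂ] V.Hom X Z := F.1.2 Z

variable {X Y Z W : V.Obj}

theorem L_comp (F : MultHom V X Y) (h : V.Hom Z X) (g : V.Hom W Z) :
    L F W (V.comp h g) = V.comp (L F Z h) g := F.2.1 W Z h g

theorem R_comp (F : MultHom V X Y) (f : V.Hom W Z) (h : V.Hom Y W) :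
    R F Z (V.comp f h) = V.comp f (R F W h) := F.2.2.1 W Z f h

theorem compat (F : MultHom V X Y) (f : V.Hom W X) (g : V.Hom Y Z) :
    V.comp g (L F W f) = V.comp (R F Z g) f := F.2.2.2 W Z f g

/-- In a C*-category the multiplier identities follow from the compatibility condition. -/
noncomputable def mk (L : ∀ Z, V.Hom Z X →L[ℂ] V.Hom Z Y) (R : ∀ Z, V.Hom Y Z →L[ℂ] V.Hom X Z)
    (C : ℝ) (hL : ∀ Z, ‖L Z‖ ≤ C) (hR : ∀ Z, ‖R Z‖ ≤ C)
    (h : ∀ (W Z : V.Obj) (f : V.Hom W X) (g : V.Hom Y Z),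
      V.comp g (L W f) = V.comp (R Z g) f) : MultHom V X Y :=
  ⟨(⟨L, memℓp_infty ⟨C, by rintro _ ⟨Z, rfl⟩; exact hL Z⟩⟩,
    ⟨R, memℓp_infty ⟨C, by rintro _ ⟨Z, rfl⟩; exact hR Z⟩⟩),
    fun W Z k g => V.eq_of_forall_comp_left fun m => by
      change V.comp m (L W _) = V.comp m (V.comp (L Z k) g)
      rw [h, ← V.comp_assoc, ← V.comp_assoc, h],
    fun W Z f k => V.eq_of_forall_comp_right fun m => by
      change V.comp (R Z _) m = V.comp (V.comp f (R W k)) m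
      rw [← h, V.comp_assoc, V.comp_assoc, h], h⟩

theorem ext_L {F G : MultHom V X Y} (h : ∀ (Z : V.Obj) (f : V.Hom Z X), L F Z f = L G Z f) :
    F = G := by
  refine Subtype.ext (Prod.ext (lp.ext (funext fun Z => ContinuousLinearMap.ext (h Z)))
    (lp.ext (funext fun Z => ContinuousLinearMap.ext fun g => ?_)))
  refine V.eq_of_forall_comp_right fun k => ?_
  change V.comp (R F Z g) k = V.comp (R G Z g) k
  rw [← compat, ← compat, h]

theorem norm_L_le (F : MultHom V X Y) (Z : V.Obj) : ‖L F Z‖ ≤ ‖F‖ :=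
  (lp.norm_apply_le_norm ENNReal.top_ne_zero F.1.1 Z).trans (norm_fst_le F.1)

theorem norm_R_le (F : MultHom V X Y) (Z : V.Obj) : ‖R F Z‖ ≤ ‖F‖ :=
  (lp.norm_apply_le_norm ENNReal.top_ne_zero F.1.2 Z).trans (norm_snd_le F.1)

theorem norm_le_of {F : MultHom V X Y} {C : ℝ} (hC : 0 ≤ C)
    (h : ∀ (Z : V.Obj) (f : V.Hom Z X), ‖L F Z f‖ ≤ C * ‖f‖) : ‖F‖ ≤ C := by
  refine max_le ?_ ?_
  · exact lp.norm_le_of_forall_le hC fun Z => ContinuousLinearMap.opNorm_le_bound _ hC (h Z)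
  · refine lp.norm_le_of_forall_le hC fun Z => ContinuousLinearMap.opNorm_le_bound _ hC ?_
    intro g
    change ‖R F Z g‖ ≤ C * ‖g‖
    rcases eq_or_ne (R F Z g) 0 with h0 | h0
    · rw [h0, norm_zero]
      positivity
    refine le_of_mul_le_mul_right ?_ (norm_pos_iff.2 h0)
    rw [← sq, ← V.norm_comp_adj_self, ← compat]
    calc _ ≤ ‖g‖ * (C * ‖V.adj (R F Z g)‖) :=
          (V.norm_comp_le _ _).trans (by gcongr; exact h _ _)
      _ = _ := by rw [V.norm_adj]; ring

/-- Composition of multiplier morphisms. -/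
noncomputable def comp (G : MultHom V Y Z) (F : MultHom V X Y) : MultHom V X Z :=
  mk (fun W => (L G W).comp (L F W)) (fun W => (R F W).comp (R G W)) (‖G‖ * ‖F‖)
    (fun W => (ContinuousLinearMap.opNorm_comp_le _ _).trans
      (by gcongr <;> exact norm_L_le _ _))
    (fun W => (ContinuousLinearMap.opNorm_comp_le _ _).trans
      (by rw [mul_comm]; gcongr <;> exact norm_R_le _ _))
    (fun U T f g => by
      change V.comp g (L G U (L F U f)) = V.comp (R F T (R G T g)) f
      rw [compat, compat])

/-- The adjoint of a multiplier morphism, with `L f = (R f*)*` and `R g = (L g*)*`. -/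
noncomputable def adj (F : MultHom V X Y) : MultHom V Y X :=
  mk (fun W => (V.adjL _ _).comp ((R F W).comp (V.adjL _ _)))
    (fun W => (V.adjL _ _).comp ((L F W).comp (V.adjL _ _))) ‖F‖
    (fun W => ContinuousLinearMap.opNorm_le_bound _ (norm_nonneg _) fun f => by
      change ‖V.adj (R F W (V.adj f))‖ ≤ _
      rw [V.norm_adj]
      refine (ContinuousLinearMap.le_opNorm _ _).trans ?_
      rw [V.norm_adj]
      gcongr
      exact norm_R_le _ _)
    (fun W => ContinuousLinearMap.opNorm_le_bound _ (norm_nonneg _) fun f => by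
      change ‖V.adj (L F W (V.adj f))‖ ≤ _
      rw [V.norm_adj]
      refine (ContinuousLinearMap.le_opNorm _ _).trans ?_
      rw [V.norm_adj]
      gcongr
      exact norm_L_le _ _)
    (fun U T f g => by
      change V.comp g (V.adj (R F U (V.adj f))) = V.comp (V.adj (L F T (V.adj g))) f
      have h := congrArg V.adj (compat F (V.adj g) (V.adj f))
      rw [V.adj_comp, V.adj_comp, V.adj_adj, V.adj_adj] at h
      exact h.symm)

@[simp] theorem L_comp' (G : MultHom V Y Z) (F : MultHom V X Y) (f : V.Hom W X) :
    L (comp G F) W f = L G W (L F W f) := rfl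

@[simp] theorem R_comp' (G : MultHom V Y Z) (F : MultHom V X Y) (g : V.Hom Z W) :
    R (comp G F) W g = R F W (R G W g) := rfl

@[simp] theorem L_adj (F : MultHom V X Y) (f : V.Hom W Y) :
    L (adj F) W f = V.adj (R F W (V.adj f)) := rfl

@[simp] theorem R_adj (F : MultHom V X Y) (g : V.Hom X W) :
    R (adj F) W g = V.adj (L F W (V.adj g)) := rfl

@[simp] theorem L_add (F G : MultHom V X Y) (f : V.Hom W X) :
    L (F + G) W f = L F W f + L G W f := rfl

@[simp] theorem L_smul (c : ℂ) (F : MultHom V X Y) (f : V.Hom W X) :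
    L (c • F) W f = c • L F W f := rfl

@[simp] theorem R_add (F G : MultHom V X Y) (f : V.Hom Y W) :
    R (F + G) W f = R F W f + R G W f := rfl

@[simp] theorem R_smul (c : ℂ) (F : MultHom V X Y) (f : V.Hom Y W) :
    R (c • F) W f = c • R F W f := rfl

theorem norm_comp_le (G : MultHom V Y Z) (F : MultHom V X Y) : ‖comp G F‖ ≤ ‖G‖ * ‖F‖ := by
  refine norm_le_of (by positivity) fun W f => ?_
  rw [L_comp', mul_assoc]
  refine ((L G W).le_of_opNorm_le (norm_L_le _ _) _).trans ?_
  gcongr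
  exact (L F W).le_of_opNorm_le (norm_L_le _ _) _

theorem adj_L_comp (F : MultHom V X Y) (f : V.Hom W X) :
    V.comp (V.adj (L F W f)) (L F W f) = V.comp (V.adj f) (L (comp (adj F) F) W f) := by
  rw [L_comp', L_adj, ← V.adj_comp, ← compat, V.adj_comp, V.adj_adj]

theorem norm_adj_le (F : MultHom V X Y) : ‖adj F‖ ≤ ‖F‖ := by
  refine norm_le_of (norm_nonneg _) fun W f => ?_
  rw [L_adj, V.norm_adj, ← V.norm_adj f]
  exact (R F W).le_of_opNorm_le (norm_R_le _ _) _

theorem norm_adj_comp_self (F : MultHom V X Y) : ‖comp (adj F) F‖ = ‖F‖ ^ 2 := by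
  refine le_antisymm ?_ ?_
  · refine (norm_comp_le _ _).trans ?_
    rw [sq]
    gcongr
    exact norm_adj_le F
  · rw [← Real.sqrt_le_sqrt_iff (norm_nonneg _), Real.sqrt_sq (norm_nonneg _)]
    refine norm_le_of (Real.sqrt_nonneg _) fun W f => ?_
    refine le_of_sq_le_sq ?_ (by positivity)
    rw [mul_pow, Real.sq_sqrt (norm_nonneg _), ← V.norm_adj_comp_self, adj_L_comp]
    calc _ ≤ ‖f‖ * (‖comp (adj F) F‖ * ‖f‖) := by
          refine (V.norm_comp_le _ _).trans ?_
          rw [V.norm_adj]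
          gcongr
          exact (L _ W).le_of_opNorm_le (norm_L_le _ _) _
      _ = _ := by ring

variable {X' : V.Obj}

theorem comp_assoc (H : MultHom V Z X') (G : MultHom V Y Z) (F : MultHom V X Y) :
    comp (comp H G) F = comp H (comp G F) := ext_L fun _ _ => by simp only [L_comp']

theorem add_comp (G G' : MultHom V Y Z) (F : MultHom V X Y) :
    comp (G + G') F = comp G F + comp G' F := ext_L fun _ _ => by simp only [L_comp', L_add]

theorem comp_add (G : MultHom V Y Z) (F F' : MultHom V X Y) :
    comp G (F + F') = comp G F + comp G F' := ext_L fun _ _ => by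
  simp only [L_comp', L_add, map_add]

theorem smul_comp (c : ℂ) (G : MultHom V Y Z) (F : MultHom V X Y) :
    comp (c • G) F = c • comp G F := ext_L fun _ _ => by simp only [L_comp', L_smul]

theorem comp_smul (c : ℂ) (G : MultHom V Y Z) (F : MultHom V X Y) :
    comp G (c • F) = c • comp G F := ext_L fun _ _ => by simp only [L_comp', L_smul, map_smul]

theorem adj_add (F F' : MultHom V X Y) : adj (F + F') = adj F + adj F' :=
  ext_L fun _ _ => by simp only [L_adj, L_add, R_add, V.adj_add]

theorem adj_smul (c : ℂ) (F : MultHom V X Y) : adj (c • F) = (starRingEnd ℂ c) • adj F :=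
  ext_L fun _ _ => by simp only [L_adj, L_smul, R_smul, V.adj_smul]

theorem adj_adj (F : MultHom V X Y) : adj (adj F) = F :=
  ext_L fun _ _ => by simp only [L_adj, R_adj, V.adj_adj]

theorem adj_comp (G : MultHom V Y Z) (F : MultHom V X Y) :
    adj (comp G F) = comp (adj F) (adj G) :=
  ext_L fun _ _ => by simp only [L_adj, L_comp', R_comp', V.adj_adj]

theorem eq_zero_of_add (F : MultHom V X Y) (G : MultHom V X Z)
    (h : comp (adj F) F + comp (adj G) G = 0) : G = 0 := by
  refine ext_L fun W f => ?_
  refine V.eq_zero_of_add (L F W f) _ ?_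
  rw [adj_L_comp, adj_L_comp, ← V.comp_add, ← L_add, h]
  exact V.comp_zero _

/-- The identity multiplier. -/
noncomputable def one (X : V.Obj) : MultHom V X X :=
  mk (fun _ => ContinuousLinearMap.id ℂ _)
    (fun _ => ContinuousLinearMap.id ℂ _) 1 (fun _ => ContinuousLinearMap.norm_id_le)
    (fun _ => ContinuousLinearMap.norm_id_le) (fun _ _ _ _ => rfl)

/-- The multiplier morphism defined by a morphism. -/
noncomputable def ofHom (f : V.Hom X Y) : MultHom V X Y :=
  mk (fun Z => V.compL Z f) (fun Z => V.compR Z f) ‖f‖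
    (fun Z => V.norm_compL_le Z f) (fun Z => V.norm_compR_le Z f)
    (fun _ _ _ _ => (V.comp_assoc _ _ _).symm)

@[simp] theorem L_one (f : V.Hom Z X) : L (one X) Z f = f := rfl

@[simp] theorem L_ofHom (f : V.Hom X Y) (g : V.Hom Z X) : L (ofHom f) Z g = V.comp f g := rfl

@[simp] theorem R_ofHom (f : V.Hom X Y) (g : V.Hom Y Z) : R (ofHom f) Z g = V.comp g f := rfl

theorem one_comp (F : MultHom V X Y) : comp (one Y) F = F :=
  ext_L fun _ _ => by simp only [L_comp', L_one]

theorem comp_one (F : MultHom V X Y) : comp F (one X) = F :=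
  ext_L fun _ _ => by simp only [L_comp', L_one]

theorem ofHom_add (f g : V.Hom X Y) : ofHom (f + g) = ofHom f + ofHom g :=
  ext_L fun _ _ => by simp only [L_add, L_ofHom, V.add_comp]

theorem ofHom_smul (c : ℂ) (f : V.Hom X Y) : ofHom (c • f) = c • ofHom f :=
  ext_L fun _ _ => by simp only [L_smul, L_ofHom, V.smul_comp]

theorem ofHom_comp (g : V.Hom Y Z) (f : V.Hom X Y) :
    ofHom (V.comp g f) = comp (ofHom g) (ofHom f) :=
  ext_L fun _ _ => by simp only [L_comp', L_ofHom, V.comp_assoc]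

theorem ofHom_adj (f : V.Hom X Y) : ofHom (V.adj f) = adj (ofHom f) :=
  ext_L fun _ _ => by simp only [L_adj, L_ofHom, R_ofHom, V.adj_comp, V.adj_adj]

end MultHom

/-- The Banach-enriched `*`-category underlying the multiplier category. -/
noncomputable def multPre (V : CStarCat.{u}) : PreCStarCat.{u} where
  Obj := V.Obj
  Hom X Y := MultHom V X Y
  comp := MultHom.comp
  adj := MultHom.adj
  comp_assoc := MultHom.comp_assoc
  add_comp := MultHom.add_comp
  comp_add := MultHom.comp_add
  smul_comp := MultHom.smul_comp
  comp_smul := MultHom.comp_smul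
  adj_add := MultHom.adj_add
  adj_smul := MultHom.adj_smul
  adj_adj := MultHom.adj_adj
  adj_comp := MultHom.adj_comp
  norm_comp_le := MultHom.norm_comp_le
  norm_adj_comp_self := MultHom.norm_adj_comp_self

/-- The multiplier category `M V`, a unital C*-category with the same objects as `V`. -/
noncomputable def mult (V : CStarCat.{u}) : UCStarCat.{u} where
  toPreCStarCat := multPre V
  pos {X Y} f := PreCStarCat.pos_of (multPre V)
    (fun _ _ F G h => MultHom.eq_zero_of_add (V := V) F G h) X Y f
  one := fun (X : V.Obj) => MultHom.one X
  one_comp := MultHom.one_comp (V := V)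
  comp_one := MultHom.comp_one (V := V)

/-- Every morphism of `V` defines a multiplier morphism: the canonical functor `V → M V`. -/
noncomputable def toMult (V : CStarCat.{u}) :
    StarFun V.toPreCStarCat (mult V).toPreCStarCat where
  obj X := X
  map f := MultHom.ofHom f
  map_add := MultHom.ofHom_add
  map_smul := MultHom.ofHom_smul
  map_comp := MultHom.ofHom_comp
  map_adj := MultHom.ofHom_adj

end Mult

/-! ## Nondegenerate functors and their extension to multipliers -/

section Nondegenerate

variable {V W U : CStarCat.{u}}

/-- Linear `*`-functors `V → M W`. -/
structure MFun (V W : CStarCat.{u}) where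
  obj : V.Obj → W.Obj
  map : ∀ {X Y : V.Obj}, V.Hom X Y → MultHom W (obj X) (obj Y)
  map_add : ∀ {X Y : V.Obj} (f g : V.Hom X Y), map (f + g) = map f + map g
  map_smul : ∀ {X Y : V.Obj} (c : ℂ) (f : V.Hom X Y), map (c • f) = c • map f
  map_comp : ∀ {X Y Z : V.Obj} (g : V.Hom Y Z) (f : V.Hom X Y),
    map (V.comp g f) = (map g).comp (map f)
  map_adj : ∀ {X Y : V.Obj} (f : V.Hom X Y), map (V.adj f) = (map f).adj

/-- A functor `V → M W` as a functor between the C*-categories `V` and `M W`. -/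
def MFun.toStarFun (F : MFun V W) : StarFun V.toPreCStarCat (mult W).toPreCStarCat where
  obj := F.obj
  map := F.map
  map_add := F.map_add
  map_smul := F.map_smul
  map_comp := F.map_comp
  map_adj := F.map_adj

/-- A functor into `M W` as a functor `V → M W`. -/
def StarFun.toMFun (F : StarFun V.toPreCStarCat (mult W).toPreCStarCat) : MFun V W where
  obj := F.obj
  map := F.map
  map_add := F.map_add
  map_smul := F.map_smul
  map_comp := F.map_comp
  map_adj := F.map_adj

/-- Nondegeneracy of a linear `*`-functor `F : V → M W`:
`[F(V(Y,Y)) ∘ W(F X, F Y)] = W(F X, F Y) = [W(F X, F Y) ∘ F(V(X,X))]` for all `X`, `Y`, where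
`[ ]` is the closed linear span. -/
def MFun.Nondegenerate (F : MFun V W) : Prop :=
  ∀ X Y : V.Obj,
    (Submodule.span ℂ {u : W.Hom (F.obj X) (F.obj Y) |
      ∃ (a : V.Hom Y Y) (w : W.Hom (F.obj X) (F.obj Y)),
        (F.map a).L (F.obj X) w = u}).topologicalClosure = ⊤ ∧
    (Submodule.span ℂ {u : W.Hom (F.obj X) (F.obj Y) |
      ∃ (a : V.Hom X X) (w : W.Hom (F.obj X) (F.obj Y)),
        (F.map a).R (F.obj Y) w = u}).topologicalClosure = ⊤

/-- Two continuous (semi)linear maps agreeing on a set with dense span are equal. -/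
theorem clm_ext_of_dense {E F : Type u} [NormedAddCommGroup E] [NormedSpace ℂ E]
    [NormedAddCommGroup F] [NormedSpace ℂ F] {D : Set E}
    (hD : (Submodule.span ℂ D).topologicalClosure = ⊤) {S T : E →L[ℂ] F}
    (h : ∀ x ∈ D, S x = T x) : S = T :=
  ContinuousLinearMap.ext_on (Submodule.dense_iff_topologicalClosure_eq_top.2 hD) h

theorem mem_of_dense {E : Type u} [NormedAddCommGroup E] [NormedSpace ℂ E] {D : Set E}
    (hD : (Submodule.span ℂ D).topologicalClosure = ⊤) {F : Type u} [NormedAddCommGroup F]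
    [NormedSpace ℂ F] (T : E →L[ℂ] F) {S : Submodule ℂ F} (hS : IsClosed (S : Set F))
    (h : ∀ x ∈ D, T x ∈ S) (x : E) : T x ∈ S := by
  have h1 : Submodule.span ℂ D ≤ S.comap (T : E →ₗ[ℂ] F) := Submodule.span_le.2 h
  have h2 : (Submodule.span ℂ D).topologicalClosure ≤ S.comap (T : E →ₗ[ℂ] F) :=
    Submodule.topologicalClosure_minimal _ h1 (hS.preimage T.continuous)
  rw [hD] at h2
  exact h2 (Submodule.mem_top (x := x))

/-- A bounded net of operators converging pointwise on a set with dense span converges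
pointwise. -/
theorem exists_pointwise_lim {E F : Type u} [NormedAddCommGroup E] [NormedSpace ℂ E]
    [NormedAddCommGroup F] [NormedSpace ℂ F] [CompleteSpace F] {ι : Type u} {l : Filter ι}
    [l.NeBot] (T : ι → E →L[ℂ] F) {C : ℝ} (hT : ∀ᶠ i in l, ‖T i‖ ≤ C) {D : Set E}
    (hD : (Submodule.span ℂ D).topologicalClosure = ⊤)
    (h : ∀ x ∈ D, ∃ y, Tendsto (fun i => T i x) l (𝓝 y)) :
    ∃ T' : E →L[ℂ] F, ‖T'‖ ≤ C ∧ ∀ x, Tendsto (fun i => T i x) l (𝓝 (T' x)) := by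
  obtain ⟨i₀, hi₀⟩ := hT.exists
  have hC : 0 ≤ C := (norm_nonneg _).trans hi₀
  let S : Submodule ℂ E :=
    { carrier := {x | ∃ y, Tendsto (fun i => T i x) l (𝓝 y)}
      add_mem' := by
        rintro x x' ⟨y, hy⟩ ⟨y', hy'⟩
        exact ⟨y + y', by simpa using hy.add hy'⟩
      zero_mem' := ⟨0, by simp⟩
      smul_mem' := by
        rintro c x ⟨y, hy⟩
        exact ⟨c • y, by simpa using hy.const_smul c⟩ }
  have hS : IsClosed (S : Set E) := by
    refine isClosed_of_closure_subset fun x hx => ?_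
    refine cauchy_map_iff_exists_tendsto.1 (Metric.cauchy_iff.2 ⟨inferInstance, fun ε hε => ?_⟩)
    obtain ⟨x', hx', hd⟩ := Metric.mem_closure_iff.1 hx (ε / (4 * (C + 1))) (by positivity)
    obtain ⟨y, hy⟩ := hx'
    have hev := hT.and (Metric.tendsto_nhds.1 hy (ε / 4) (by positivity))
    refine ⟨_, image_mem_map hev, ?_⟩
    have key : ∀ i, ‖T i‖ ≤ C → ‖T i x - T i x'‖ ≤ ε / 4 := fun i hi => by
      rw [← map_sub]
      calc _ ≤ C * ‖x - x'‖ := (T i).le_of_opNorm_le hi _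
        _ ≤ (C + 1) * (ε / (4 * (C + 1))) := by
          rw [dist_eq_norm] at hd
          gcongr
          linarith
        _ = ε / 4 := by field_simp
    rintro _ ⟨i, ⟨hi, hi'⟩, rfl⟩ _ ⟨j, ⟨hj, hj'⟩, rfl⟩
    have h1 := key i hi
    have h2 := key j hj
    rw [← dist_eq_norm] at h1 h2
    calc dist (T i x) (T j x) ≤ dist (T i x) (T i x') + dist (T i x') y + dist y (T j x)
          := dist_triangle4 _ _ _ _
      _ ≤ dist (T i x) (T i x') + dist (T i x') y + (dist (T j x) (T j x') + dist (T j x') y) := by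
          rw [dist_comm y]
          gcongr
          exact dist_triangle _ _ _
      _ < ε := by linarith
  have hall : ∀ x, ∃ y, Tendsto (fun i => T i x) l (𝓝 y) := fun x =>
    mem_of_dense hD (ContinuousLinearMap.id ℂ E) hS h x
  choose g hg using hall
  refine ⟨LinearMap.mkContinuous
    { toFun := g
      map_add' := fun x y => tendsto_nhds_unique (hg _) (by simpa using (hg x).add (hg y))
      map_smul' := fun c x => tendsto_nhds_unique (hg _) (by simpa using (hg x).const_smul c) }
    C fun x => ?_, LinearMap.mkContinuous_norm_le _ hC _, hg⟩
  refine le_of_tendsto (hg x).norm ?_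
  filter_upwards [hT] with i hi
  exact (T i).le_of_opNorm_le hi x

/-- Nondegenerate linear `*`-functors `V → M W`. These are the 1-morphisms from `V` to `W`. -/
structure NDFun (V W : CStarCat.{u}) extends MFun V W where
  nondeg : toMFun.Nondegenerate

/-- The left half of nondegeneracy implies the right half. -/
theorem MFun.nondegenerate_of_left {F : MFun V W}
    (h : ∀ X Y : V.Obj, (Submodule.span ℂ {u : W.Hom (F.obj X) (F.obj Y) |
      ∃ (a : V.Hom Y Y) (w : W.Hom (F.obj X) (F.obj Y)),
        (F.map a).L (F.obj X) w = u}).topologicalClosure = ⊤) :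
    F.Nondegenerate := by
  refine fun X Y => ⟨h X Y, ?_⟩
  rw [eq_top_iff]
  intro w _
  let S : Submodule ℂ (W.Hom (F.obj X) (F.obj Y)) :=
    (Submodule.span ℂ {u : W.Hom (F.obj X) (F.obj Y) |
      ∃ (a : V.Hom X X) (w : W.Hom (F.obj X) (F.obj Y)),
        (F.map a).R (F.obj Y) w = u}).topologicalClosure
  let S' : Submodule ℂ (W.Hom (F.obj Y) (F.obj X)) :=
    { carrier := {w | W.adj w ∈ S}
      add_mem' := fun {a b} ha hb => by
        change W.adj (a + b) ∈ S
        rw [W.adj_add]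
        exact S.add_mem ha hb
      zero_mem' := by
        change W.adj 0 ∈ S
        rw [W.adj_zero]
        exact S.zero_mem
      smul_mem' := fun c a ha => by
        change W.adj (c • a) ∈ S
        rw [W.adj_smul]
        exact S.smul_mem _ ha }
  have hS' : IsClosed (S' : Set (W.Hom (F.obj Y) (F.obj X))) :=
    (Submodule.isClosed_topologicalClosure _).preimage W.continuous_adj
  have := mem_of_dense (h Y X) (ContinuousLinearMap.id ℂ _) hS' (by
    rintro _ ⟨a, w, rfl⟩
    refine Submodule.le_topologicalClosure _ (Submodule.subset_span ⟨V.adj a, W.adj w, ?_⟩)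
    rw [F.map_adj, MultHom.R_adj, W.adj_adj, ContinuousLinearMap.id_apply]) (W.adj w)
  change W.adj (W.adj w) ∈ S at this
  rwa [W.adj_adj] at this

namespace NDFun

variable (f : NDFun V W)

theorem map_comp_L {X Y Z : V.Obj} (b : V.Hom Y Z) (a : V.Hom X Y) {T : W.Obj}
    (w : W.Hom T (f.obj X)) :
    (f.map (V.comp b a)).L T w = (f.map b).L T ((f.map a).L T w) :=
  congrArg (fun F : MultHom W _ _ => F.L T w) (f.map_comp b a)

theorem norm_map_le {X Y : V.Obj} (a : V.Hom X Y) : ‖f.map a‖ ≤ ‖a‖ :=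
  f.toStarFun.norm_map_le a

/-- `a ↦ f(a) ∘ w` as a continuous linear map. -/
noncomputable def actL {X Y : V.Obj} {T : W.Obj} (w : W.Hom T (f.obj X)) :
    V.Hom X Y →L[ℂ] W.Hom T (f.obj Y) :=
  LinearMap.mkContinuous
    { toFun := fun a => (f.map a).L T w
      map_add' := fun a b => congrArg (fun F : MultHom W _ _ => F.L T w) (f.map_add a b)
      map_smul' := fun c a => congrArg (fun F : MultHom W _ _ => F.L T w) (f.map_smul c a) } ‖w‖
    (fun a => by
      rw [mul_comm]
      exact ((f.map a).L T).le_of_opNorm_le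
        ((MultHom.norm_L_le _ _).trans (f.norm_map_le a)) w)

theorem actL_apply {X Y : V.Obj} {T : W.Obj} (w : W.Hom T (f.obj X)) (a : V.Hom X Y) :
    f.actL w a = (f.map a).L T w := rfl

/-- Elements `f(a) ∘ w` with `a` an endomorphism. -/
def gens (X : V.Obj) (T : W.Obj) : Set (W.Hom T (f.obj X)) :=
  {u | ∃ (a : V.Hom X X) (w : W.Hom T (f.obj X)), (f.map a).L T w = u}

theorem dense_gens (X : V.Obj) (T : W.Obj) :
    (Submodule.span ℂ (f.gens X T)).topologicalClosure = ⊤ := by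
  rw [eq_top_iff]
  intro w _
  obtain ⟨l, hl, -, hlim⟩ := W.exists_approxUnit (f.obj X)
  have hcl := Submodule.isClosed_topologicalClosure (Submodule.span ℂ (f.gens X T))
  refine hcl.mem_of_tendsto (hlim T w) (Eventually.of_forall fun k => ?_)
  refine mem_of_dense (f.nondeg X X).1 (W.compR _ w) hcl ?_ k
  rintro _ ⟨a, k', rfl⟩
  refine Submodule.le_topologicalClosure _ (Submodule.subset_span ⟨a, W.comp k' w, ?_⟩)
  exact MultHom.L_comp (f.map a) k' w

/-- Multipliers are determined by their values on the elements `f(a) ∘ w`. -/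
theorem mult_ext {X : V.Obj} {Y : W.Obj} {n n' : MultHom W (f.obj X) Y}
    (h : ∀ (a : V.Hom X X) (T : W.Obj) (w : W.Hom T (f.obj X)),
      n.L T ((f.map a).L T w) = n'.L T ((f.map a).L T w)) : n = n' := by
  refine MultHom.ext_L fun T w => ?_
  refine DFunLike.congr_fun (clm_ext_of_dense (f.dense_gens X T) ?_) w
  rintro _ ⟨a, w, rfl⟩
  exact h a T w

theorem exists_extend_L {X Y : V.Obj} (m : MultHom V X Y) (T : W.Obj) :
    ∃ S : W.Hom T (f.obj X) →L[ℂ] W.Hom T (f.obj Y), ‖S‖ ≤ ‖m‖ ∧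
      ∀ (Z : V.Obj) (a : V.Hom Z X) (w : W.Hom T (f.obj Z)),
        S ((f.map a).L T w) = (f.map (m.L Z a)).L T w := by
  obtain ⟨l, hl, hbd, hlim⟩ := V.exists_approxUnit X
  have key : ∀ (Z : V.Obj) (a : V.Hom Z X) (w : W.Hom T (f.obj Z)),
      Tendsto (fun e => (f.map (m.L X e)).L T ((f.map a).L T w)) l
        (𝓝 ((f.map (m.L Z a)).L T w)) := fun Z a w => by
    have h := (((f.actL w).continuous.comp (m.L Z).continuous).tendsto a).comp (hlim Z a)
    refine h.congr fun e => ?_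
    change (f.map (m.L Z (V.comp e a))).L T w = _
    rw [m.L_comp, f.map_comp_L]
  obtain ⟨S, hS, hSlim⟩ := exists_pointwise_lim (l := l) (fun e => (f.map (m.L X e)).L T)
    (C := ‖m‖) (by
      filter_upwards [hbd] with e he
      refine (MultHom.norm_L_le _ _).trans ((f.norm_map_le _).trans ?_)
      exact ((m.L X).le_of_opNorm_le (m.norm_L_le _) e).trans
        (mul_le_of_le_one_right (norm_nonneg _) he)) (f.dense_gens X T) (by
      rintro _ ⟨a, w, rfl⟩
      exact ⟨_, key X a w⟩)
  exact ⟨S, hS, fun Z a w => tendsto_nhds_unique (hSlim _) (key Z a w)⟩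

theorem comp_adj_L {X Y Z S T : W.Obj} (F : MultHom W X Z) (G : MultHom W Y Z)
    (x : W.Hom S X) (y : W.Hom T Y) :
    W.comp (W.adj (F.L S x)) (G.L T y) =
      W.comp (W.adj x) ((F.adj.comp G).L T y) := by
  rw [MultHom.L_comp', MultHom.compat, MultHom.compat, MultHom.compat, MultHom.R_adj, W.adj_adj]

theorem adj_comp_swap {X Y Z : W.Obj} (x : W.Hom X Z) (y : W.Hom Y Z) :
    W.comp (W.adj x) y = W.adj (W.comp (W.adj y) x) := by
  rw [W.adj_comp, W.adj_adj]

theorem exists_extend {X Y : V.Obj} (m : MultHom V X Y) :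
    ∃ n : MultHom W (f.obj X) (f.obj Y),
      (∀ (Z : V.Obj) (a : V.Hom Z X) (T : W.Obj) (w : W.Hom T (f.obj Z)),
        n.L T ((f.map a).L T w) = (f.map (m.L Z a)).L T w) ∧
      (∀ (Z : V.Obj) (a : V.Hom Z Y) (T : W.Obj) (w : W.Hom T (f.obj Z)),
        n.adj.L T ((f.map a).L T w) = (f.map (m.adj.L Z a)).L T w) := by
  choose L hL hLf using f.exists_extend_L m
  choose L' hL' hLf' using f.exists_extend_L (MultHom.adj m)
  have hadj : ∀ (S T : W.Obj) (x : W.Hom S (f.obj X)) (y : W.Hom T (f.obj Y)),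
      W.comp (W.adj (L S x)) y = W.comp (W.adj x) (L' T y) := by
    intro S T x y
    refine DFunLike.congr_fun (clm_ext_of_dense (f.dense_gens Y T)
      (S := W.compL T (W.adj (L S x))) (T := (W.compL T (W.adj x)).comp (L' T)) ?_) y
    rintro _ ⟨b, y, rfl⟩
    change W.comp (W.adj (L S x)) ((f.map b).L T y) = W.comp (W.adj x) (L' T ((f.map b).L T y))
    rw [adj_comp_swap (L S x), adj_comp_swap x]
    refine congrArg W.adj ?_
    refine DFunLike.congr_fun (clm_ext_of_dense (f.dense_gens X S)
      (S := (W.compL S (W.adj ((f.map b).L T y))).comp (L S))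
      (T := W.compL S (W.adj (L' T ((f.map b).L T y)))) ?_) x
    rintro _ ⟨a, x, rfl⟩
    change W.comp (W.adj ((f.map b).L T y)) (L S ((f.map a).L S x)) =
      W.comp (W.adj (L' T ((f.map b).L T y))) ((f.map a).L S x)
    rw [hLf, hLf', comp_adj_L, comp_adj_L]
    have h1 : ∀ {P Q R : V.Obj} (c : V.Hom P R) (d : V.Hom Q R),
        MultHom.comp (MultHom.adj (f.map c)) (f.map d) = f.map (V.comp (V.adj c) d) :=
      fun c d => by
        rw [f.map_comp, f.map_adj]
    rw [h1, h1, MultHom.L_adj, V.adj_adj, MultHom.compat m a (V.adj b)]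
  refine ⟨MultHom.mk L (fun T => (W.adjL _ _).comp ((L' T).comp (W.adjL _ _))) ‖m‖ hL
    (fun T => ContinuousLinearMap.opNorm_le_bound _ (norm_nonneg _) fun g => ?_)
    (fun S T x g => ?_), fun Z a T w => hLf T Z a w,
    fun Z a T w => ?_⟩
  · change ‖W.adj (L' T (W.adj g))‖ ≤ _
    rw [W.norm_adj, ← W.norm_adj g]
    exact (L' T).le_of_opNorm_le ((hL' T).trans (MultHom.norm_adj_le m)) _
  · change W.comp g (L S x) = W.comp (W.adj (L' T (W.adj g))) x
    have h := congrArg W.adj (hadj S T x (W.adj g))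
    rwa [W.adj_comp, W.adj_comp, W.adj_adj, W.adj_adj, W.adj_adj] at h
  · change W.adj (W.adj (L' T (W.adj (W.adj ((f.map a).L T w))))) = _
    rw [W.adj_adj, W.adj_adj, hLf']

/-- The extension of `f` to multiplier morphisms. -/
noncomputable def extM {X Y : V.Obj} (m : MultHom V X Y) : MultHom W (f.obj X) (f.obj Y) :=
  Classical.choose (f.exists_extend m)

theorem extM_L {X Y Z : V.Obj} (m : MultHom V X Y) (a : V.Hom Z X) (T : W.Obj)
    (w : W.Hom T (f.obj Z)) :
    (f.extM m).L T ((f.map a).L T w) = (f.map (m.L Z a)).L T w :=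
  (Classical.choose_spec (f.exists_extend m)).1 Z a T w

theorem extM_unique {X Y : V.Obj} {m : MultHom V X Y} {n : MultHom W (f.obj X) (f.obj Y)}
    (h : ∀ (a : V.Hom X X) (T : W.Obj) (w : W.Hom T (f.obj X)),
      n.L T ((f.map a).L T w) = (f.map (m.L X a)).L T w) : f.extM m = n :=
  f.mult_ext fun a T w => by rw [extM_L, h]

theorem extM_add {X Y : V.Obj} (m n : MultHom V X Y) : f.extM (m + n) = f.extM m + f.extM n :=
  f.extM_unique fun a T w => by
    rw [MultHom.L_add, extM_L, extM_L, MultHom.L_add, f.map_add, MultHom.L_add]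

theorem extM_smul {X Y : V.Obj} (c : ℂ) (m : MultHom V X Y) : f.extM (c • m) = c • f.extM m :=
  f.extM_unique fun a T w => by
    rw [MultHom.L_smul, extM_L, MultHom.L_smul, f.map_smul, MultHom.L_smul]

theorem extM_comp {X Y Z : V.Obj} (n : MultHom V Y Z) (m : MultHom V X Y) :
    f.extM (n.comp m) = (f.extM n).comp (f.extM m) :=
  f.extM_unique fun a T w => by
    rw [MultHom.L_comp', MultHom.L_comp', extM_L, extM_L]

theorem extM_one (X : V.Obj) : f.extM (MultHom.one X) = MultHom.one (f.obj X) :=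
  f.extM_unique fun a T w => by rw [MultHom.L_one, MultHom.L_one]

theorem extM_ofHom {X Y : V.Obj} (a : V.Hom X Y) : f.extM (MultHom.ofHom a) = f.map a :=
  f.extM_unique fun b T w => by rw [MultHom.L_ofHom, map_comp_L]

theorem extM_adj {X Y : V.Obj} (m : MultHom V X Y) :
    f.extM (MultHom.adj m) = MultHom.adj (f.extM m) :=
  f.extM_unique fun b T w => (Classical.choose_spec (f.exists_extend m)).2 _ b T w

/-- The unital extension `M V → M W` of a nondegenerate functor `V → M W`. -/
noncomputable def ext : StarFun (mult V).toPreCStarCat (mult W).toPreCStarCat where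
  obj := f.obj
  map := f.extM
  map_add := f.extM_add
  map_smul := f.extM_smul
  map_comp := f.extM_comp
  map_adj := f.extM_adj

theorem norm_extM_le {X Y : V.Obj} (m : MultHom V X Y) : ‖f.extM m‖ ≤ ‖m‖ :=
  f.ext.norm_map_le m

/-- The composition `g ∘ f : V → M U` of `f : V → M W` and `g : W → M U`, obtained by first
extending `g` to a functor `M W → M U`. -/
noncomputable def comp (g : NDFun W U) (f : NDFun V W) : NDFun V U where
  obj X := g.obj (f.obj X)
  map a := g.extM (f.map a)
  map_add _ _ := by rw [f.map_add, extM_add]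
  map_smul _ _ := by rw [f.map_smul, extM_smul]
  map_comp _ _ := by rw [f.map_comp, extM_comp]
  map_adj _ := by rw [f.map_adj, extM_adj]
  nondeg := MFun.nondegenerate_of_left fun X Y => by
    rw [eq_top_iff]
    intro u _
    have hcl := Submodule.isClosed_topologicalClosure (Submodule.span ℂ
      {u : U.Hom (g.obj (f.obj X)) (g.obj (f.obj Y)) |
        ∃ (a : V.Hom Y Y) (w : U.Hom (g.obj (f.obj X)) (g.obj (f.obj Y))),
          (g.extM (f.map a)).L (g.obj (f.obj X)) w = u})
    refine mem_of_dense (g.dense_gens (f.obj Y) (g.obj (f.obj X)))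
      (ContinuousLinearMap.id ℂ _) hcl ?_ u
    rintro _ ⟨b, v, rfl⟩
    refine mem_of_dense (f.dense_gens Y (f.obj Y)) (g.actL v) hcl ?_ b
    rintro _ ⟨a, c, rfl⟩
    refine Submodule.le_topologicalClosure _ (Submodule.subset_span ⟨a, (g.map c).L _ v, ?_⟩)
    rw [extM_L]
    rfl

end NDFun

end Nondegenerate

/-! ## Functor categories -/

section FunctorCategory

variable {V W W' : CStarCat.{u}}

/-- Multiplier natural transformations `f ⇒ g`: uniformly bounded families of multiplier morphisms
`τ X : f X → g X` with `τ Y ∘ f(a) = g(a) ∘ τ X`, with the supremum norm. -/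
def natSub (f g : NDFun V W) :
    Submodule ℂ (lp (fun X => MultHom W (f.obj X) (g.obj X)) ∞) where
  carrier := {τ | ∀ (X Y : V.Obj) (a : V.Hom X Y),
    (τ Y).comp (f.map a) = (g.map a).comp (τ X)}
  add_mem' {σ τ} hσ hτ X Y a := by
    rw [lp.coeFn_add, Pi.add_apply, Pi.add_apply, MultHom.add_comp, MultHom.comp_add, hσ, hτ]
  zero_mem' X Y a := by
    rw [lp.coeFn_zero, Pi.zero_apply, Pi.zero_apply]
    exact ((mult W).zero_comp _).trans ((mult W).comp_zero _).symm
  smul_mem' c τ hτ X Y a := by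
    rw [lp.coeFn_smul, Pi.smul_apply, Pi.smul_apply, MultHom.smul_comp, MultHom.comp_smul, hτ]

theorem continuous_comp_left {X Y Z : W.Obj} (G : MultHom W Y Z) :
    Continuous fun F : MultHom W X Y => G.comp F :=
  (LinearMap.mkContinuous (σ := RingHom.id ℂ)
    { toFun := fun F : MultHom W X Y => G.comp F
      map_add' := fun _ _ => MultHom.comp_add _ _ _
      map_smul' := fun _ _ => MultHom.comp_smul _ _ _ } ‖G‖ (fun _ => G.norm_comp_le _)).continuous

theorem continuous_comp_right {X Y Z : W.Obj} (F : MultHom W X Y) :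
    Continuous fun G : MultHom W Y Z => G.comp F :=
  (LinearMap.mkContinuous (σ := RingHom.id ℂ)
    { toFun := fun G : MultHom W Y Z => G.comp F
      map_add' := fun _ _ => MultHom.add_comp _ _ _
      map_smul' := fun _ _ => MultHom.smul_comp _ _ _ } ‖F‖
    (fun G => (G.norm_comp_le F).trans_eq (mul_comm _ _))).continuous

theorem isClosed_natSub (f g : NDFun V W) :
    IsClosed (natSub f g : Set (lp (fun X => MultHom W (f.obj X) (g.obj X)) ∞)) := by
  have c : ∀ X : V.Obj, Continuous fun τ : lp (fun X => MultHom W (f.obj X) (g.obj X)) ∞ => τ X :=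
    fun X =>
      (lp.lipschitzWith_one_eval (E := fun X => MultHom W (f.obj X) (g.obj X)) ∞ X).continuous
  change IsClosed {τ : lp (fun X => MultHom W (f.obj X) (g.obj X)) ∞ |
    ∀ (X Y : V.Obj) (a : V.Hom X Y), (τ Y).comp (f.map a) = (g.map a).comp (τ X)}
  simp only [Set.ofPred_forall]
  exact isClosed_iInter fun X => isClosed_iInter fun Y => isClosed_iInter fun a =>
    isClosed_eq ((continuous_comp_right (f.map a)).comp (c Y))
      ((continuous_comp_left (g.map a)).comp (c X))

/-- Multiplier natural transformations `f ⇒ g`, a Banach space. -/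
def NatTr (f g : NDFun V W) : Type u := natSub f g

namespace NatTr

noncomputable instance (f g : NDFun V W) : NormedAddCommGroup (NatTr f g) :=
  Submodule.normedAddCommGroup (natSub f g)

noncomputable instance (f g : NDFun V W) : NormedSpace ℂ (NatTr f g) :=
  Submodule.normedSpace (natSub f g)

instance (f g : NDFun V W) : CompleteSpace (NatTr f g) :=
  (isClosed_natSub f g).completeSpace_coe

variable {f g h : NDFun V W}

/-- The component at `X` of a multiplier natural transformation. -/
def app (τ : NatTr f g) (X : V.Obj) : MultHom W (f.obj X) (g.obj X) := τ.1 X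

theorem naturality (τ : NatTr f g) {X Y : V.Obj} (a : V.Hom X Y) :
    (τ.app Y).comp (f.map a) = (g.map a).comp (τ.app X) := τ.2 X Y a

@[ext] theorem ext {σ τ : NatTr f g} (h : ∀ X, σ.app X = τ.app X) : σ = τ :=
  Subtype.ext (Subtype.ext (funext h))

theorem norm_app_le (τ : NatTr f g) (X : V.Obj) : ‖τ.app X‖ ≤ ‖τ‖ :=
  lp.norm_apply_le_norm ENNReal.top_ne_zero τ.1 X

/-- A bounded natural family of multiplier morphisms as a multiplier natural transformation. -/
def mk (t : ∀ X, MultHom W (f.obj X) (g.obj X)) (C : ℝ)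
    (hC : ∀ X, ‖t X‖ ≤ C) (h : ∀ (X Y : V.Obj) (a : V.Hom X Y),
      (t Y).comp (f.map a) = (g.map a).comp (t X)) : NatTr f g :=
  ⟨⟨t, memℓp_infty ⟨C, by rintro _ ⟨X, rfl⟩; exact hC X⟩⟩, h⟩

@[simp] theorem mk_app (t : ∀ X, MultHom W (f.obj X) (g.obj X)) (C : ℝ)
    (hC : ∀ X, ‖t X‖ ≤ C) (h : ∀ (X Y : V.Obj) (a : V.Hom X Y),
      (t Y).comp (f.map a) = (g.map a).comp (t X)) (X : V.Obj) :
    (mk t C hC h).app X = t X := rfl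

theorem norm_le_of {τ : NatTr f g} {C : ℝ} (hC0 : 0 ≤ C) (hC : ∀ X, ‖τ.app X‖ ≤ C) : ‖τ‖ ≤ C :=
  lp.norm_le_of_forall_le hC0 hC

@[simp] theorem add_app (σ τ : NatTr f g) (X : V.Obj) : (σ + τ).app X = σ.app X + τ.app X := rfl

@[simp] theorem smul_app (c : ℂ) (τ : NatTr f g) (X : V.Obj) : (c • τ).app X = c • τ.app X := rfl

/-- The identity transformation. -/
noncomputable def one (f : NDFun V W) : NatTr f f :=
  mk (fun X => MultHom.one (f.obj X)) 1 (fun X => (mult W).norm_one_le (f.obj X))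
    (fun X Y a => by rw [MultHom.one_comp, MultHom.comp_one])

/-- Componentwise composition. -/
noncomputable def comp (τ : NatTr g h) (σ : NatTr f g) : NatTr f h :=
  mk (fun X => (τ.app X).comp (σ.app X)) (‖τ‖ * ‖σ‖)
    (fun X => (MultHom.norm_comp_le _ _).trans (by gcongr <;> exact norm_app_le _ _))
    (fun X Y a => by
      rw [MultHom.comp_assoc, σ.naturality, ← MultHom.comp_assoc, τ.naturality,
        MultHom.comp_assoc])

/-- Componentwise adjoint. -/
noncomputable def adj (τ : NatTr f g) : NatTr g f :=
  mk (fun X => (τ.app X).adj) ‖τ‖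
    (fun X => (MultHom.norm_adj_le _).trans (norm_app_le _ _))
    (fun X Y a => by
      have h := congrArg MultHom.adj (τ.naturality (V.adj a))
      rw [MultHom.adj_comp, MultHom.adj_comp, f.map_adj, g.map_adj, MultHom.adj_adj,
        MultHom.adj_adj] at h
      exact h.symm)

@[simp] theorem comp_app (τ : NatTr g h) (σ : NatTr f g) (X : V.Obj) :
    (τ.comp σ).app X = (τ.app X).comp (σ.app X) := rfl

@[simp] theorem adj_app (τ : NatTr f g) (X : V.Obj) : τ.adj.app X = (τ.app X).adj := rfl

@[simp] theorem one_app (f : NDFun V W) (X : V.Obj) :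
    (one f).app X = MultHom.one (f.obj X) := rfl

theorem norm_comp_le (τ : NatTr g h) (σ : NatTr f g) : ‖τ.comp σ‖ ≤ ‖τ‖ * ‖σ‖ :=
  norm_le_of (by positivity) fun _ =>
    (MultHom.norm_comp_le _ _).trans (by gcongr <;> exact norm_app_le _ _)

theorem norm_adj_comp_self (τ : NatTr f g) : ‖τ.adj.comp τ‖ = ‖τ‖ ^ 2 := by
  refine le_antisymm (norm_le_of (by positivity) fun X => ?_) ?_
  · rw [comp_app, adj_app, MultHom.norm_adj_comp_self]
    gcongr
    exact norm_app_le _ _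
  · rw [← Real.sqrt_le_sqrt_iff (norm_nonneg _), Real.sqrt_sq (norm_nonneg _)]
    refine norm_le_of (Real.sqrt_nonneg _) fun X => Real.le_sqrt_of_sq_le ?_
    rw [← MultHom.norm_adj_comp_self]
    exact norm_app_le (τ.adj.comp τ) X

/-- Multiplier natural transformations are natural for multiplier morphisms as well. -/
theorem naturality_ext (τ : NatTr f g) {X Y : V.Obj} (m : MultHom V X Y) :
    (τ.app Y).comp (f.extM m) = (g.extM m).comp (τ.app X) := by
  refine f.mult_ext fun a T w => ?_
  have h1 : ∀ {Z : V.Obj} (b : V.Hom X Z), (τ.app Z).L T ((f.map b).L T w) =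
      (g.map b).L T ((τ.app X).L T w) := fun b =>
    congrArg (fun F : MultHom W _ _ => F.L T w) (τ.naturality b)
  rw [MultHom.L_comp', MultHom.L_comp', f.extM_L, h1, h1, g.extM_L]

end NatTr

/-- The Banach-enriched `*`-category underlying `funCat V W`. -/
noncomputable def funPre (V W : CStarCat.{u}) : PreCStarCat.{u} where
  Obj := NDFun V W
  Hom f g := NatTr f g
  comp := NatTr.comp
  adj := NatTr.adj
  comp_assoc _ _ _ := NatTr.ext fun _ => MultHom.comp_assoc _ _ _
  add_comp _ _ _ := NatTr.ext fun _ => MultHom.add_comp _ _ _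
  comp_add _ _ _ := NatTr.ext fun _ => MultHom.comp_add _ _ _
  smul_comp _ _ _ := NatTr.ext fun _ => MultHom.smul_comp _ _ _
  comp_smul _ _ _ := NatTr.ext fun _ => MultHom.comp_smul _ _ _
  adj_add _ _ := NatTr.ext fun _ => MultHom.adj_add _ _
  adj_smul _ _ := NatTr.ext fun _ => MultHom.adj_smul _ _
  adj_adj _ := NatTr.ext fun _ => MultHom.adj_adj _
  adj_comp _ _ := NatTr.ext fun _ => MultHom.adj_comp _ _
  norm_comp_le := NatTr.norm_comp_le
  norm_adj_comp_self := NatTr.norm_adj_comp_self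

theorem NatTr.eq_zero_of_add {f g h : NDFun V W} (σ : NatTr f g) (τ : NatTr f h)
    (H : σ.adj.comp σ + τ.adj.comp τ = 0) : τ = 0 :=
  NatTr.ext fun X => MultHom.eq_zero_of_add (σ.app X) (τ.app X)
    (congrArg (fun ρ : NatTr f f => ρ.app X) H)

/-- The unital C*-category `C*Lin(V, W)` of nondegenerate linear `*`-functors `V → M W` and their
multiplier natural transformations. -/
noncomputable def funCat (V W : CStarCat.{u}) : UCStarCat.{u} where
  toPreCStarCat := funPre V W
  pos {X Y} f := PreCStarCat.pos_of (funPre V W)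
    (fun _ _ σ τ H => NatTr.eq_zero_of_add (V := V) σ τ H) X Y f
  one := NatTr.one
  one_comp _ := NatTr.ext fun _ => MultHom.one_comp _
  comp_one _ := NatTr.ext fun _ => MultHom.comp_one _

/-- Unital linear `*`-functors between unital C*-categories. -/
structure UFun (A B : UCStarCat.{u}) extends StarFun A.toPreCStarCat B.toPreCStarCat where
  map_one : ∀ X : A.Obj, map (A.one X) = B.one (obj X)

/-- The composition `G ∘ F` of unital functors. -/
def UFun.comp {A B C : UCStarCat.{u}} (G : UFun B C) (F : UFun A B) : UFun A C where
  toStarFun := G.toStarFun.comp F.toStarFun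
  map_one X := (congrArg G.map (F.map_one X)).trans (G.map_one _)

/-- The unital extension of a nondegenerate functor to multiplier categories. -/
noncomputable def NDFun.extU (f : NDFun V W) : UFun (mult V) (mult W) where
  toStarFun := f.ext
  map_one := f.extM_one

/-- For `k : W → M W'` and `τ : f ⇒ g`, the transformation `k * τ : k ∘ f ⇒ k ∘ g` with
components `k(τ X)`. -/
noncomputable def NDFun.whiskL (k : NDFun W W') {f g : NDFun V W} (τ : NatTr f g) :
    NatTr (k.comp f) (k.comp g) :=
  NatTr.mk (f := k.comp f) (g := k.comp g) (fun X => k.extM (τ.app X)) ‖τ‖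
    (fun X => (k.norm_extM_le _).trans (τ.norm_app_le X)) (fun X Y a => by
      change (k.extM (τ.app Y)).comp (k.extM (f.map a)) = (k.extM (g.map a)).comp (k.extM (τ.app X))
      rw [← k.extM_comp, ← k.extM_comp, τ.naturality])

/-- For `τ : k ⇒ k'` and `f : V → M W`, the transformation `τ * f : k ∘ f ⇒ k' ∘ f` with
components `τ (f X)`. -/
noncomputable def NatTr.whiskR {k k' : NDFun W W'} (τ : NatTr k k') (f : NDFun V W) :
    NatTr (k.comp f) (k'.comp f) :=
  NatTr.mk (f := k.comp f) (g := k'.comp f) (fun X => τ.app (f.obj X)) ‖τ‖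
    (fun _ => τ.norm_app_le _) (fun _ _ a => τ.naturality_ext (f.map a))

/-- Postcomposition with `k : W → M W'`, a functor `C*Lin(V, W) → C*Lin(V, W')`. -/
noncomputable def postcomp (V : CStarCat.{u}) (k : NDFun W W') :
    UFun (funCat V W) (funCat V W') where
  obj f := k.comp f
  map τ := k.whiskL τ
  map_add := fun {f g : NDFun V W} (σ τ : NatTr f g) => NatTr.ext fun X =>
    k.extM_add (σ.app X) (τ.app X)
  map_smul := fun {f g : NDFun V W} c (τ : NatTr f g) => NatTr.ext fun X =>
    k.extM_smul c (τ.app X)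
  map_comp := fun {f g h : NDFun V W} (σ : NatTr g h) (τ : NatTr f g) => NatTr.ext fun X =>
    k.extM_comp (σ.app X) (τ.app X)
  map_adj := fun {f g : NDFun V W} (τ : NatTr f g) => NatTr.ext fun X =>
    k.extM_adj (τ.app X)
  map_one := fun (f : NDFun V W) => NatTr.ext fun X => k.extM_one (f.obj X)

end FunctorCategory

/-! ## Functors between products -/

section Products

variable {I : Type u} {A B : I → UCStarCat.{u}}

/-- Entrywise application of unital functors, as a functor between direct products. -/
noncomputable def prodStarFun (G : ∀ i, UFun (A i) (B i)) :
    StarFun (CStarCat.prod fun i => (A i).toCStarCat).toPreCStarCat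
      (CStarCat.prod fun i => (B i).toCStarCat).toPreCStarCat where
  obj := fun (X : ∀ i, (A i).Obj) i => (G i).obj (X i)
  map := fun {X Y : ∀ i, (A i).Obj} (f : ProdHom (fun i => (A i).toCStarCat) X Y) =>
    ProdHom.mk (A := fun i => (B i).toCStarCat) (fun i => (G i).map (f.app i))
      (squeeze_zero (fun _ => norm_nonneg _) (fun i => (G i).norm_map_le _) f.tendsto)
  map_add _ _ := ProdHom.ext fun i => (G i).map_add _ _
  map_smul _ _ := ProdHom.ext fun i => (G i).map_smul _ _
  map_comp _ _ := ProdHom.ext fun i => (G i).map_comp _ _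
  map_adj _ := ProdHom.ext fun i => (G i).map_adj _

open Classical in
/-- The family with identities as entries at the indices in a finite set, and `0` elsewhere. -/
noncomputable def truncOne (A : I → UCStarCat.{u}) (X : ∀ i, (A i).Obj) (S : Set I)
    (hS : S.Finite) : ProdHom (fun i => (A i).toCStarCat) X X :=
  ProdHom.mk (A := fun i => (A i).toCStarCat)
    (fun i => if i ∈ S then (A i).one (X i) else 0)
    (tendsto_const_nhds.congr' (by
      filter_upwards [hS.compl_mem_cofinite] with i hi
      rw [if_neg hi, norm_zero]))

theorem norm_truncOne_comp_le (G : ∀ i, UFun (A i) (B i)) (X : ∀ i, (B i).Obj)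
    (Y : ∀ i, (A i).Obj) (S : Set I) (hS : S.Finite)
    (w : ProdHom (fun i => (B i).toCStarCat) X fun i => (G i).obj (Y i)) {ε : ℝ} (hε : 0 ≤ ε)
    (h : ∀ i, i ∉ S → ‖w.app i‖ ≤ ε) :
    ‖w - ProdHom.comp (A := fun i => (B i).toCStarCat) (Y := fun i => (G i).obj (Y i))
      (Z := fun i => (G i).obj (Y i)) ((prodStarFun G).map (truncOne A Y S hS)) w‖ ≤ ε := by
  classical
  refine ProdHom.norm_le_of hε fun i => ?_
  change ‖w.app i - (B i).comp ((G i).map (if i ∈ S then (A i).one (Y i) else 0)) (w.app i)‖ ≤ ε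
  by_cases hi : i ∈ S
  · rw [if_pos hi, (G i).map_one, (B i).one_comp, sub_self, norm_zero]
    exact hε
  · rw [if_neg hi, (G i).map_zero, (B i).zero_comp, sub_zero]
    exact h i hi

/-- Entrywise application of unital functors, as a nondegenerate functor between direct
products. -/
noncomputable def prodMap (G : ∀ i, UFun (A i) (B i)) :
    NDFun (CStarCat.prod fun i => (A i).toCStarCat) (CStarCat.prod fun i => (B i).toCStarCat) where
  toMFun := StarFun.toMFun ((toMult _).comp (prodStarFun G))
  nondeg := MFun.nondegenerate_of_left fun X Y => by
    rw [eq_top_iff]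
    intro w _
    refine Metric.mem_closure_iff.2 fun ε hε => ?_
    have hw := Metric.tendsto_nhds.1 (ProdHom.tendsto
      (A := fun i => (B i).toCStarCat) w) (ε / 2) (half_pos hε)
    have hS : {i : I | ¬ ‖ProdHom.app (A := fun i => (B i).toCStarCat) w i‖ ≤ ε / 2}.Finite := by
      refine (show ∀ᶠ i in cofinite, ‖ProdHom.app (A := fun i => (B i).toCStarCat) w i‖ ≤ ε / 2
        from ?_)
      filter_upwards [hw] with i hi
      rw [dist_zero_right, norm_norm] at hi
      exact hi.le
    refine ⟨_, Submodule.subset_span ⟨truncOne A Y _ hS, w, rfl⟩, ?_⟩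
    rw [dist_eq_norm]
    refine (norm_truncOne_comp_le G _ Y _ hS w (half_pos hε).le fun i hi => ?_).trans_lt
      (half_lt_self hε)
    exact not_not.1 hi

/-- The functor between multiplier categories of direct products given by unital functors between
the factors. -/
noncomputable def mprodMap (G : ∀ i, UFun (A i) (B i)) :
    UFun (mult (CStarCat.prod fun i => (A i).toCStarCat))
      (mult (CStarCat.prod fun i => (B i).toCStarCat)) :=
  (prodMap G).extU

/-- Entrywise application of unital functors to bounded families. -/
noncomputable def bddMap (G : ∀ i, UFun (A i) (B i)) :
    UFun (UCStarCat.bddProd A) (UCStarCat.bddProd B) where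
  obj := fun (X : ∀ i, (A i).Obj) i => (G i).obj (X i)
  map := fun {X Y : ∀ i, (A i).Obj} (f : lp (fun i => (A i).Hom (X i) (Y i)) ∞) =>
    (⟨fun i => (G i).map (f i), memℓp_infty ⟨‖f‖, by
      rintro _ ⟨i, rfl⟩
      exact ((G i).norm_map_le _).trans (lp.norm_apply_le_norm ENNReal.top_ne_zero f i)⟩⟩ :
      lp (fun i => (B i).Hom ((G i).obj (X i)) ((G i).obj (Y i))) ∞)
  map_add {X Y : ∀ i, (A i).Obj} _ _ := lp.ext (E := fun i => (B i).Hom ((G i).obj (X i))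
    ((G i).obj (Y i))) (funext fun i => (G i).map_add _ _)
  map_smul {X Y : ∀ i, (A i).Obj} _ _ := lp.ext (E := fun i => (B i).Hom ((G i).obj (X i))
    ((G i).obj (Y i))) (funext fun i => (G i).map_smul _ _)
  map_comp {X Y Z : ∀ i, (A i).Obj} _ _ := lp.ext (E := fun i => (B i).Hom ((G i).obj (X i))
    ((G i).obj (Z i))) (funext fun i => (G i).map_comp _ _)
  map_adj {X Y : ∀ i, (A i).Obj} _ := lp.ext (E := fun i => (B i).Hom ((G i).obj (Y i))
    ((G i).obj (X i))) (funext fun i => (G i).map_adj _)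
  map_one (X : ∀ i, (A i).Obj) := lp.ext (E := fun i => (B i).Hom ((G i).obj (X i))
    ((G i).obj (X i))) (funext fun i => (G i).map_one _)

/-- Left multiplication of `c₀`-families by a bounded family. -/
noncomputable def bddL {X Y : ∀ i, (A i).Obj} (f : lp (fun i => (A i).Hom (X i) (Y i)) ∞)
    (Z : ∀ i, (A i).Obj) : ProdHom (fun i => (A i).toCStarCat) Z X →L[ℂ]
      ProdHom (fun i => (A i).toCStarCat) Z Y :=
  LinearMap.mkContinuous
    { toFun := fun h => ProdHom.mk (A := fun i => (A i).toCStarCat)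
        (fun i => (A i).comp (f i) (h.app i))
        (squeeze_zero (fun _ => norm_nonneg _) (fun i => ((A i).norm_comp_le _ _).trans
            (mul_le_mul_of_nonneg_right (lp.norm_apply_le_norm ENNReal.top_ne_zero f i)
              (norm_nonneg _)))
          (by simpa using h.tendsto.const_mul ‖f‖))
      map_add' := fun _ _ => ProdHom.ext fun i => (A i).comp_add _ _ _
      map_smul' := fun _ _ => ProdHom.ext fun i => (A i).comp_smul _ _ _ } ‖f‖
    (fun h => ProdHom.norm_le_of (by positivity) fun i => ((A i).norm_comp_le _ _).trans
      (mul_le_mul (lp.norm_apply_le_norm ENNReal.top_ne_zero f i) (h.norm_app_le i)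
        (norm_nonneg _) (norm_nonneg _)))

/-- Right multiplication of `c₀`-families by a bounded family. -/
noncomputable def bddR {X Y : ∀ i, (A i).Obj} (f : lp (fun i => (A i).Hom (X i) (Y i)) ∞)
    (Z : ∀ i, (A i).Obj) : ProdHom (fun i => (A i).toCStarCat) Y Z →L[ℂ]
      ProdHom (fun i => (A i).toCStarCat) X Z :=
  LinearMap.mkContinuous
    { toFun := fun h => ProdHom.mk (A := fun i => (A i).toCStarCat)
        (fun i => (A i).comp (h.app i) (f i))
        (squeeze_zero (fun _ => norm_nonneg _) (fun i => ((A i).norm_comp_le _ _).trans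
            (mul_le_mul_of_nonneg_left (lp.norm_apply_le_norm ENNReal.top_ne_zero f i)
              (norm_nonneg _)))
          (by simpa using h.tendsto.mul_const ‖f‖))
      map_add' := fun _ _ => ProdHom.ext fun i => (A i).add_comp _ _ _
      map_smul' := fun _ _ => ProdHom.ext fun i => (A i).smul_comp _ _ _ } ‖f‖
    (fun h => ProdHom.norm_le_of (by positivity) fun i => ((A i).norm_comp_le _ _).trans
      ((mul_le_mul (h.norm_app_le i) (lp.norm_apply_le_norm ENNReal.top_ne_zero f i)
        (norm_nonneg _) (norm_nonneg _)).trans_eq (mul_comm _ _)))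

theorem norm_bddL_le {X Y : ∀ i, (A i).Obj} (f : lp (fun i => (A i).Hom (X i) (Y i)) ∞)
    (Z : ∀ i, (A i).Obj) : ‖bddL f Z‖ ≤ ‖f‖ :=
  LinearMap.mkContinuous_norm_le _ (norm_nonneg _) _

theorem norm_bddR_le {X Y : ∀ i, (A i).Obj} (f : lp (fun i => (A i).Hom (X i) (Y i)) ∞)
    (Z : ∀ i, (A i).Obj) : ‖bddR f Z‖ ≤ ‖f‖ :=
  LinearMap.mkContinuous_norm_le _ (norm_nonneg _) _

/-- The multiplier morphism of the direct product given by a bounded family. -/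
noncomputable def bddMult {X Y : ∀ i, (A i).Obj}
    (f : lp (fun i => (A i).Hom (X i) (Y i)) ∞) :
    MultHom (CStarCat.prod fun i => (A i).toCStarCat) X Y :=
  MultHom.mk (V := CStarCat.prod fun i => (A i).toCStarCat) (bddL f) (bddR f) ‖f‖
    (fun Z => norm_bddL_le f Z) (fun Z => norm_bddR_le f Z)
    (fun _ _ _ _ => ProdHom.ext fun i => ((A i).comp_assoc _ _ _).symm)

/-- Bounded families act as multipliers on the direct product: the functor that is the identity on
objects and sends a bounded family to the multiplier morphism it defines. -/
noncomputable def ofBdd (A : I → UCStarCat.{u}) :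
    UFun (UCStarCat.bddProd A) (mult (CStarCat.prod fun i => (A i).toCStarCat)) where
  obj := fun X => X
  map := fun {X Y : ∀ i, (A i).Obj} f => bddMult (X := X) (Y := Y) f
  map_add _ _ := MultHom.ext_L fun _ _ => ProdHom.ext fun i => (A i).add_comp _ _ _
  map_smul _ _ := MultHom.ext_L fun _ _ => ProdHom.ext fun i => (A i).smul_comp _ _ _
  map_comp _ _ := MultHom.ext_L fun _ _ => ProdHom.ext fun i => (A i).comp_assoc _ _ _
  map_adj f := MultHom.ext_L fun _ h => ProdHom.ext fun i => by
    change (A i).comp ((A i).adj _) _ = (A i).adj ((A i).comp ((A i).adj _) _)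
    rw [(A i).adj_comp, (A i).adj_adj]
  map_one _ := MultHom.ext_L fun _ _ => ProdHom.ext fun i => (A i).one_comp _

end Products

/-! ## Equivalences -/

namespace UFun

/-- The identity functor. -/
def id (A : UCStarCat.{u}) : UFun A A where
  obj X := X
  map f := f
  map_add _ _ := rfl
  map_smul _ _ := rfl
  map_comp _ _ := rfl
  map_adj _ := rfl
  map_one _ := rfl

/-- Unitary natural isomorphisms between unital functors. -/
structure UnitaryNatIso {A B : UCStarCat.{u}} (F G : UFun A B) where
  app : ∀ X : A.Obj, B.Hom (F.obj X) (G.obj X)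
  naturality : ∀ {X Y : A.Obj} (f : A.Hom X Y),
    B.comp (app Y) (F.map f) = B.comp (G.map f) (app X)
  adj_comp_self : ∀ X, B.comp (B.adj (app X)) (app X) = B.one (F.obj X)
  comp_adj_self : ∀ X, B.comp (app X) (B.adj (app X)) = B.one (G.obj X)

/-- `F` is an equivalence of unital C*-categories. -/
def IsEquivalence {A B : UCStarCat.{u}} (F : UFun A B) : Prop :=
  ∃ G : UFun B A, Nonempty (UnitaryNatIso (G.comp F) (id A)) ∧
    Nonempty (UnitaryNatIso (F.comp G) (id B))

/-- `F` is an isomorphism of unital C*-categories. -/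
def IsIsomorphism {A B : UCStarCat.{u}} (F : UFun A B) : Prop :=
  ∃ G : UFun B A, G.comp F = id A ∧ F.comp G = id B

end UFun

/-! ## Countably additive C*-categories -/

section Additive

variable (V : CStarCat.{u})

/-- `F` is the sum of the family `f` with respect to the strict topology. -/
def StrictHasSum {V : CStarCat.{u}} {X Y : V.Obj} {J : Type} (f : J → MultHom V X Y)
    (F : MultHom V X Y) : Prop :=
  (∀ (Z : V.Obj) (a : V.Hom Z X), HasSum (fun j => (f j).L Z a) (F.L Z a)) ∧
    ∀ (Z : V.Obj) (b : V.Hom Y Z), HasSum (fun j => (f j).R Z b) (F.R Z b)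

/-- The object `S` with the multiplier morphisms `ι j : X j → S` is a direct sum of the `X j`. -/
structure IsDirectSum {V : CStarCat.{u}} {J : Type} (X : J → V.Obj) (S : V.Obj)
    (ι : ∀ j, MultHom V (X j) S) : Prop where
  adj_comp_self : ∀ j, (ι j).adj.comp (ι j) = MultHom.one (X j)
  adj_comp_of_ne : ∀ j k, j ≠ k → (ι j).adj.comp (ι k) = 0
  hasSum : StrictHasSum (fun j => (ι j).comp (ι j).adj) (MultHom.one S)

/-- `V` has all countable direct sums, and all projections in `M V` are split by subobjects. -/
structure IsCountablyAdditive : Prop where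
  directSums : ∀ (J : Type) [Countable J] (X : J → V.Obj),
    ∃ (S : V.Obj) (ι : ∀ j, MultHom V (X j) S), IsDirectSum X S ι
  split : ∀ (X : V.Obj) (p : MultHom V X X), p.comp p = p → p.adj = p →
    ∃ (U : V.Obj) (ι : MultHom V U X), ι.adj.comp ι = MultHom.one U ∧ ι.comp ι.adj = p

/-- A zero object: all morphisms into it and out of it vanish. -/
def IsZero {V : CStarCat.{u}} (X : V.Obj) : Prop :=
  ∀ Y : V.Obj, (∀ f : V.Hom X Y, f = 0) ∧ ∀ f : V.Hom Y X, f = 0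

theorem IsCountablyAdditive.exists_isZero {V : CStarCat.{u}} (h : IsCountablyAdditive V) :
    ∃ X : V.Obj, IsZero X := by
  obtain ⟨S, ι, hS⟩ := h.directSums Empty fun j => j.elim
  refine ⟨S, fun Y => ⟨fun f => ?_, fun f => ?_⟩⟩
  · exact (hS.hasSum.2 Y f).unique hasSum_empty
  · exact (hS.hasSum.1 Y f).unique hasSum_empty

end Additive

/-- Countably additive small C*-categories, the objects of the 2-category `C*Lin`. -/
structure CLin extends CStarCat.{u} where
  isCountablyAdditive : IsCountablyAdditive toCStarCat

namespace CLin

/-- A zero object. -/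
noncomputable def zero (V : CLin.{u}) : V.Obj :=
  Classical.choose V.isCountablyAdditive.exists_isZero

theorem isZero_zero (V : CLin.{u}) : IsZero V.zero :=
  Classical.choose_spec V.isCountablyAdditive.exists_isZero

end CLin

/-! ## Direct sums of countably additive C*-categories -/

section DirectSum

variable {I : Type u}

/-- The direct sum `⨁ V i`: the full subcategory of `∏ V i` of all families of objects with at most
countably many nonzero entries. -/
noncomputable def directSum (V : I → CLin.{u}) : CStarCat.{u} :=
  CStarCat.full (CStarCat.prod fun i => (V i).toCStarCat)
    (O := {X : ∀ i, (V i).Obj // {i | ¬ IsZero (V := (V i).toCStarCat) (X i)}.Countable})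
    Subtype.val

/-- The entry at `i` of the family that has `X` as its entry at `j`, and zero objects elsewhere. -/
noncomputable def inclObj (V : I → CLin.{u}) {j : I} (X : (V j).Obj) (i : I) :
    Decidable (j = i) → (V i).Obj
  | .isTrue h => h ▸ X
  | .isFalse _ => (V i).zero

/-- The entry at `i` of the family that has `f` as its entry at `j`, and `0` elsewhere. -/
noncomputable def inclHom (V : I → CLin.{u}) {j : I} {X Y : (V j).Obj} (f : (V j).Hom X Y) (i : I) :
    (d : Decidable (j = i)) → (V i).Hom (inclObj V X i d) (inclObj V Y i d)
  | .isTrue h => by subst h; exact f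
  | .isFalse _ => 0

theorem inclHom_of_ne (V : I → CLin.{u}) {j : I} {X Y : (V j).Obj} (f : (V j).Hom X Y) {i : I}
    (d : Decidable (j = i)) (h : j ≠ i) : inclHom V f i d = 0 := by
  cases d with
  | isTrue h' => exact absurd h' h
  | isFalse _ => rfl

theorem isZero_inclObj (V : I → CLin.{u}) {j : I} (X : (V j).Obj) {i : I}
    (d : Decidable (j = i)) (h : j ≠ i) : IsZero (V := (V i).toCStarCat) (inclObj V X i d) := by
  cases d with
  | isTrue h' => exact absurd h' h
  | isFalse _ => exact (V i).isZero_zero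

open Classical in
/-- The family of morphisms with entry `f` at `j` and `0` elsewhere. -/
noncomputable def inclProd (V : I → CLin.{u}) {j : I} {X Y : (V j).Obj} (f : (V j).Hom X Y) :
    ProdHom (fun i => (V i).toCStarCat) (fun i => inclObj V X i (propDecidable (j = i)))
      (fun i => inclObj V Y i (propDecidable (j = i))) :=
  ProdHom.mk (A := fun i => (V i).toCStarCat) (fun i => inclHom V f i (propDecidable (j = i)))
    (tendsto_const_nhds.congr' (by
      filter_upwards [(Set.finite_singleton j).compl_mem_cofinite] with i hi
      rw [inclHom_of_ne V f _ (fun h => hi h.symm), norm_zero]))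

open Classical in
/-- The inclusion `V j → ⨁ V i`. -/
noncomputable def incl (V : I → CLin.{u}) (j : I) :
    StarFun (V j).toPreCStarCat (directSum V).toPreCStarCat where
  obj X := ⟨fun i => inclObj V X i (propDecidable (j = i)),
    (Set.countable_singleton j).mono fun i hi => by
      by_contra h
      exact hi (isZero_inclObj V X _ fun h' => h h'.symm)⟩
  map f := inclProd V f
  map_add f g := ProdHom.ext fun i => by
    change inclHom V _ i (propDecidable (j = i)) = inclHom V _ i (propDecidable (j = i)) +
      inclHom V _ i (propDecidable (j = i))
    rcases propDecidable (j = i) with h | h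
    · exact (add_zero _).symm
    · subst h; rfl
  map_smul c f := ProdHom.ext fun i => by
    change inclHom V _ i (propDecidable (j = i)) = c • inclHom V _ i (propDecidable (j = i))
    rcases propDecidable (j = i) with h | h
    · exact (smul_zero _).symm
    · subst h; rfl
  map_comp g f := ProdHom.ext fun i => by
    change inclHom V _ i (propDecidable (j = i)) = (V i).comp
      (inclHom V _ i (propDecidable (j = i))) (inclHom V _ i (propDecidable (j = i)))
    rcases propDecidable (j = i) with h | h
    · exact ((V i).zero_comp _).symm
    · subst h; rfl
  map_adj f := ProdHom.ext fun i => by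
    change inclHom V _ i (propDecidable (j = i)) = (V i).adj
      (inclHom V _ i (propDecidable (j = i)))
    rcases propDecidable (j = i) with h | h
    · exact (V i).adj_zero.symm
    · subst h; rfl

theorem incl_surjective (V : I → CLin.{u}) (j : I) (X Y : (V j).Obj) :
    Function.Surjective fun f : (V j).Hom X Y => (incl V j).map f := by
  classical
  intro g
  have key : ∀ (i : I) (d : Decidable (j = i))
      (k : (V i).Hom (inclObj V X i d) (inclObj V Y i d)) (h : j ≠ i), k = 0 :=
    fun i d k h => (isZero_inclObj V X d h _).1 k
  have key' : ∀ (d : Decidable (j = j)) (k : (V j).Hom (inclObj V X j d) (inclObj V Y j d)),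
      ∃ f : (V j).Hom X Y, inclHom V f j d = k := by
    intro d k
    rcases d with h | h
    · exact absurd rfl h
    · exact ⟨k, rfl⟩
  obtain ⟨f, hf⟩ := key' (Classical.propDecidable (j = j))
    (ProdHom.app (A := fun i => (V i).toCStarCat) g j)
  refine ⟨f, ProdHom.ext fun i => ?_⟩
  change inclHom V f i (Classical.propDecidable (j = i)) =
    ProdHom.app (A := fun i => (V i).toCStarCat) g i
  by_cases h : j = i
  · subst h
    exact hf
  · rw [inclHom_of_ne V f _ h]
    exact (key i _ _ h).symm

/-- Precomposition of `f : V → M W` with a functor `j : U → V` that is surjective on endomorphism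
spaces, which guarantees that the composition is nondegenerate. -/
noncomputable def NDFun.precomp {U V W : CStarCat.{u}} (f : NDFun V W)
    (j : StarFun U.toPreCStarCat V.toPreCStarCat)
    (hj : ∀ X : U.Obj, Function.Surjective fun a : U.Hom X X => j.map a) : NDFun U W where
  toMFun := StarFun.toMFun (f.toStarFun.comp j)
  nondeg := MFun.nondegenerate_of_left fun X Y => by
    rw [eq_top_iff]
    refine (f.nondeg (j.obj X) (j.obj Y)).1.ge.trans ?_
    refine Submodule.topologicalClosure_mono (Submodule.span_mono ?_)
    rintro _ ⟨a, w, rfl⟩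
    obtain ⟨b, rfl⟩ := hj Y a
    exact ⟨b, w, rfl⟩

section Precomposition

variable {U V W : CStarCat.{u}} (j : StarFun U.toPreCStarCat V.toPreCStarCat)
    (hj : ∀ X : U.Obj, Function.Surjective fun a : U.Hom X X => j.map a)

/-- The transformation `σ * j : f ∘ j ⇒ g ∘ j` with components `σ (j X)`. -/
noncomputable def NatTr.precomp {f g : NDFun V W} (σ : NatTr f g) :
    NatTr (f.precomp j hj) (g.precomp j hj) :=
  NatTr.mk (f := f.precomp j hj) (g := g.precomp j hj) (fun X => σ.app (j.obj X)) ‖σ‖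
    (fun _ => σ.norm_app_le _) (fun _ _ a => σ.naturality (j.map a))

theorem NatTr.norm_precomp_le {f g : NDFun V W} (σ : NatTr f g) : ‖σ.precomp j hj‖ ≤ ‖σ‖ :=
  NatTr.norm_le_of (norm_nonneg _) fun _ => σ.norm_app_le _

/-- Precomposition with `j`. -/
noncomputable def precomp (W : CStarCat.{u}) : UFun (funCat V W) (funCat U W) where
  obj f := f.precomp j hj
  map σ := σ.precomp j hj
  map_add := fun {f g : NDFun V W} (_ _ : NatTr f g) => NatTr.ext fun _ => rfl
  map_smul := fun {f g : NDFun V W} _ (_ : NatTr f g) => NatTr.ext fun _ => rfl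
  map_comp := fun {f g h : NDFun V W} (_ : NatTr g h) (_ : NatTr f g) => NatTr.ext fun _ => rfl
  map_adj := fun {f g : NDFun V W} (_ : NatTr f g) => NatTr.ext fun _ => rfl
  map_one := fun (_ : NDFun V W) => NatTr.ext fun _ => rfl

end Precomposition

/-- The functor into bounded families with entries the unital functors `F i`. -/
noncomputable def famFun {A : UCStarCat.{u}} {B : I → UCStarCat.{u}} (F : ∀ i, UFun A (B i)) :
    UFun A (UCStarCat.bddProd B) where
  obj X i := (F i).obj X
  map := fun {X Y : A.Obj} f => (⟨fun i => (F i).map f, memℓp_infty ⟨‖f‖, by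
    rintro _ ⟨i, rfl⟩
    exact (F i).norm_map_le _⟩⟩ : lp (fun i => (B i).Hom ((F i).obj X) ((F i).obj Y)) ∞)
  map_add {X Y : A.Obj} _ _ := lp.ext (E := fun i => (B i).Hom ((F i).obj X) ((F i).obj Y))
    (funext fun i => (F i).map_add _ _)
  map_smul {X Y : A.Obj} _ _ := lp.ext (E := fun i => (B i).Hom ((F i).obj X) ((F i).obj Y))
    (funext fun i => (F i).map_smul _ _)
  map_comp {X Y Z : A.Obj} _ _ := lp.ext (E := fun i => (B i).Hom ((F i).obj X) ((F i).obj Z))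
    (funext fun i => (F i).map_comp _ _)
  map_adj {X Y : A.Obj} _ := lp.ext (E := fun i => (B i).Hom ((F i).obj Y) ((F i).obj X))
    (funext fun i => (F i).map_adj _)
  map_one (X : A.Obj) := lp.ext (E := fun i => (B i).Hom ((F i).obj X) ((F i).obj X))
    (funext fun i => (F i).map_one _)

/-- Precomposition with the inclusion `ι j`, given by `f ↦ f ∘ ι j` on objects and by
`σ ↦ σ * ι j` on morphisms. -/
noncomputable def precompIncl (V : I → CLin.{u}) (W : CStarCat.{u}) (j : I) :
    UFun (funCat (directSum V) W) (funCat (V j).toCStarCat W) :=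
  precomp (incl V j) (fun X => incl_surjective V j X X) W

/-- The category `[I, C*Lin]((V i), Δ W)` of transformations from the diagram `(V i)`, indexed by
the set `I` regarded as a category with only identity morphisms, to the constant diagram at `W`,
with modifications as morphisms. As `I` has only identity morphisms and the structure 2-cells of a
transformation at these are prescribed by the unit condition, a transformation is a family of
1-morphisms `V i → W`, and a modification is a uniformly bounded family of 2-morphisms. -/
noncomputable def transCat (V : I → CLin.{u}) (W : CStarCat.{u}) : UCStarCat.{u} :=
  UCStarCat.bddProd fun i => funCat (V i).toCStarCat W

/-- Precomposition with the transformation `(V i) → Δ (⨁ V i)` given by the inclusions: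
`f ↦ (f ∘ ι i)` on objects and `σ ↦ (σ * ι i)` on morphisms. -/
noncomputable def precompTrans (V : I → CLin.{u}) (W : CStarCat.{u}) :
    UFun (funCat (directSum V) W) (transCat V W) :=
  famFun (precompIncl V W)

/-- The C*-category `M ∏ C*Lin(V i, W)`. -/
noncomputable def multProd (V : I → CLin.{u}) (W : CStarCat.{u}) : UCStarCat.{u} :=
  mult (CStarCat.prod fun i => (funCat (V i).toCStarCat W).toCStarCat)

/-- The functor `C*Lin(⨁ V i, W) → M ∏ C*Lin(V i, W)` given by `f ↦ (f ∘ ι i)` on objects and by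
`σ ↦ (σ * ι i)` on morphisms. -/
noncomputable def precompMult (V : I → CLin.{u}) (W : CStarCat.{u}) :
    UFun (funCat (directSum V) W) (multProd V W) :=
  (ofBdd fun i => funCat (V i).toCStarCat W).comp (precompTrans V W)

variable {W W' : CStarCat.{u}}

/-- Postcomposition with `k` on `[I, C*Lin]((V i), Δ W)`. -/
noncomputable def transPost (V : I → CLin.{u}) (k : NDFun W W') :
    UFun (transCat V W) (transCat V W') :=
  bddMap fun i => postcomp (V i).toCStarCat k

/-- Postcomposition with `k` on `M ∏ C*Lin(V i, W)`. -/
noncomputable def multProdPost (V : I → CLin.{u}) (k : NDFun W W') :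
    UFun (multProd V W) (multProd V W') :=
  mprodMap fun i => postcomp (V i).toCStarCat k

/-- The action of `τ : k ⇒ k'` on transformations `(V i) → Δ W`, with entries `τ * g i`. -/
noncomputable def transWhisk (V : I → CLin.{u}) {k k' : NDFun W W'} (τ : NatTr k k')
    (g : (transCat V W).Obj) : (transCat V W').Hom ((transPost V k).obj g)
      ((transPost V k').obj g) :=
  (⟨fun i => τ.whiskR (g i), memℓp_infty ⟨‖τ‖, by
    rintro _ ⟨i, rfl⟩
    exact NatTr.norm_le_of (norm_nonneg _) fun _ => τ.norm_app_le _⟩⟩ :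
    lp (fun i => NatTr (k.comp (g i)) (k'.comp (g i))) ∞)

/-- The action of `τ : k ⇒ k'` on objects of `M ∏ C*Lin(V i, W)`, with entries `τ * g i`. -/
noncomputable def multProdWhisk (V : I → CLin.{u}) {k k' : NDFun W W'} (τ : NatTr k k')
    (g : (multProd V W).Obj) : (multProd V W').Hom ((multProdPost V k).obj g)
      ((multProdPost V k').obj g) :=
  (ofBdd fun i => funCat (V i).toCStarCat W').map (transWhisk V τ g)

end DirectSum

end CStarLin

/-! The central notion is `IsOrthSum`: isometric multipliers `κ i : X i → S` with pairwise
orthogonal ranges such that the morphisms factoring through some `κ i` span a dense subspace of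
every morphism space into `S`. It makes sense for index sets of any size, whereas `IsDirectSum` asks
for strict convergence of the sum of projections over an index type in `Type`; over such a type the
two notions agree (`of_isDirectSum`, `isDirectSum`).

Two facts make the notion useful. A multiplier out of `S` is determined by its composites with the
`κ i` (`hom_ext`). Conversely, a uniformly bounded family of multipliers between the summands comes
from a diagonal multiplier between the sums (`exists_diag`): the finite diagonals depend on the
family through a `*`-functor, so they are uniformly bounded because `*`-functors are contractive; on
the dense span they and their adjoints are eventually constant, so they converge strictly.
Nondegenerate functors preserve orthogonal sums (`IsOrthSum.map`); nondegeneracy is what gives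
density.

A multiplier of `⨁ V i` is the same as a uniformly bounded family of multipliers of the `V i`. Hence
countable sums and splittings of projections in `⨁ V i` are formed entrywise, and only the
countability of the support has to be checked.

For the universal property, every object `X` of `⨁ V i` is the orthogonal sum of the objects `ι i (X
i)` (`isOrthSum_col`), also for uncountable `I`. A functor `f` carries this to a decomposition of `f
X`. Therefore a transformation is determined by its restrictions along the `ι i`, and a bounded
family of transformations between the restrictions assembles, by diagonals, to a transformation:
precomposition is fully faithful. It is essentially surjective, because for given `h i` one can send
`X` to an orthogonal sum of the `h i (X i)`. This sum exists in `W` since only countably many `X i`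
are nonzero and functors preserve zero objects. On `ι j Z` only the `j`-th summand survives, so the
restriction to `V j` is unitarily isomorphic to `h j`.

Finally, identities placed at a single index show that a multiplier of a direct product of unital
categories acts entrywise, through a bounded family. So `ofBdd` is an isomorphism. Compatibility
with postcomposition is definitional for bounded families and follows on `M ∏` from the uniqueness
of the extension of a nondegenerate functor. -/

namespace CStarLin

/-! ## Strict limits of multipliers -/

section StrictLimits

/-- A bounded net of operators that converges pointwise to `S` on a set with dense span converges
pointwise to `S`. -/
theorem tendsto_of_dense {E F : Type u} [NormedAddCommGroup E] [NormedSpace ℂ E]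
    [NormedAddCommGroup F] [NormedSpace ℂ F] [CompleteSpace F] {ι : Type*} {l : Filter ι}
    [l.NeBot] (T : ι → E →L[ℂ] F) {C : ℝ} (hT : ∀ i, ‖T i‖ ≤ C) {D : Set E}
    (hD : (Submodule.span ℂ D).topologicalClosure = ⊤) (S : E →L[ℂ] F)
    (h : ∀ x ∈ D, Tendsto (fun i => T i x) l (𝓝 (S x))) (x : E) :
    Tendsto (fun i => T i x) l (𝓝 (S x)) := by
  -- `exists_pointwise_lim` needs its index type in the universe of `E` and `F`. The filter is
  -- therefore pushed forward along `T` to the space of operators, which lies in that universe.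
  obtain ⟨S', -, hS'⟩ := exists_pointwise_lim (l := l.map T) (fun A : E →L[ℂ] F => A) (C := C)
    (Filter.mem_map.2 (Eventually.of_forall hT)) hD fun x hx => ⟨S x, tendsto_map'_iff.2 (h x hx)⟩
  have hSS : S' = S := clm_ext_of_dense hD fun y hy =>
    tendsto_nhds_unique (hS' y) (tendsto_map'_iff.2 (h y hy))
  rw [← hSS]
  exact tendsto_map'_iff.1 (hS' x)

/-- The form in which density is proved throughout: it suffices to approximate the members of a set
already known to have dense span. -/
theorem topologicalClosure_span_eq_top_of_subset {E : Type*} [NormedAddCommGroup E]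
    [NormedSpace ℂ E] {D D' : Set E} (hD : (Submodule.span ℂ D).topologicalClosure = ⊤)
    (h : ∀ x ∈ D, x ∈ (Submodule.span ℂ D').topologicalClosure) :
    (Submodule.span ℂ D').topologicalClosure = ⊤ := by
  rw [eq_top_iff, ← hD]
  exact Submodule.topologicalClosure_minimal _ (Submodule.span_le.2 h)
    (Submodule.isClosed_topologicalClosure _)

variable {V : CStarCat.{u}} {X Y Z : V.Obj}

namespace MultHom

/-- A bounded net of multiplier morphisms converges strictly if it and its adjoint converge on sets
with dense span. -/
theorem exists_strict_lim {ι : Type u} {l : Filter ι} [l.NeBot] (T : ι → MultHom V X Y) {C : ℝ}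
    (hT : ∀ i, ‖T i‖ ≤ C) {D : ∀ Z, Set (V.Hom Z X)}
    (hD : ∀ Z, (Submodule.span ℂ (D Z)).topologicalClosure = ⊤)
    (h : ∀ Z, ∀ x ∈ D Z, ∃ y, Tendsto (fun i => (T i).L Z x) l (𝓝 y))
    {D' : ∀ Z, Set (V.Hom Z Y)} (hD' : ∀ Z, (Submodule.span ℂ (D' Z)).topologicalClosure = ⊤)
    (h' : ∀ Z, ∀ x ∈ D' Z, ∃ y, Tendsto (fun i => (T i).adj.L Z x) l (𝓝 y)) :
    ∃ m : MultHom V X Y, ‖m‖ ≤ C ∧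
      ∀ Z x, Tendsto (fun i => (T i).L Z x) l (𝓝 (m.L Z x)) := by
  choose L hLC hL using fun Z => exists_pointwise_lim (l := l) (fun i => (T i).L Z) (C := C)
    (Eventually.of_forall fun i => ((T i).norm_L_le Z).trans (hT i)) (hD Z) (h Z)
  choose L' hLC' hL' using fun Z => exists_pointwise_lim (l := l) (fun i => (T i).adj.L Z) (C := C)
    (Eventually.of_forall fun i => ((T i).adj.norm_L_le Z).trans
      ((T i).norm_adj_le.trans (hT i))) (hD' Z) (h' Z)
  have hC : 0 ≤ C := (norm_nonneg _).trans (hLC X)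
  -- The right multiplier is forced to be `g ↦ (L' g*)*`, where `L'` is the pointwise limit of the
  -- adjoints.
  refine ⟨mk L (fun Z => (V.adjL _ _).comp ((L' Z).comp (V.adjL _ _))) C hLC
    (fun Z => ContinuousLinearMap.opNorm_le_bound _ hC fun g => ?_) (fun S Z x g => ?_),
    norm_le_of hC fun Z x => (L Z).le_of_opNorm_le (hLC Z) x, hL⟩
  · change ‖V.adj (L' Z (V.adj g))‖ ≤ _
    rw [V.norm_adj, ← V.norm_adj g]
    exact (L' Z).le_of_opNorm_le (hLC' Z) _
  · change V.comp g (L S x) = V.comp (V.adj (L' Z (V.adj g))) x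
    -- The compatibility of left and right multiplier holds for every `T i` and passes to the limit
    -- on both sides.
    refine tendsto_nhds_unique (((V.compL S g).continuous.tendsto _).comp (hL S x)) ?_
    have h1 := ((V.compR Z x).continuous.tendsto _).comp
      ((V.continuous_adj.tendsto _).comp (hL' Z (V.adj g)))
    refine h1.congr fun i => ?_
    change V.comp (V.adj ((T i).adj.L Z (V.adj g))) x = V.comp g ((T i).L S x)
    rw [L_adj, V.adj_adj, V.adj_adj, compat]

theorem zero_comp (F : MultHom V X Y) : comp (0 : MultHom V Y Z) F = 0 :=
  (mult V).zero_comp (Z := Z) F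

theorem comp_zero (F : MultHom V Y Z) : comp F (0 : MultHom V X Y) = 0 :=
  (mult V).comp_zero (X := X) F

theorem adj_zero : adj (0 : MultHom V X Y) = 0 := (mult V).adj_zero (X := X) (Y := Y)

theorem adj_one : adj (one X) = one X := (mult V).adj_one X

theorem norm_one_le : ‖one X‖ ≤ 1 := (mult V).norm_one_le X

theorem norm_le_one_of_adj_comp_self {F : MultHom V X Y} (h : F.adj.comp F = one X) :
    ‖F‖ ≤ 1 := by
  have h1 := norm_adj_comp_self F
  rw [h] at h1
  have h2 := norm_one_le (X := X)
  nlinarith [norm_nonneg F]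

theorem adj_injective {F G : MultHom V X Y} (h : F.adj = G.adj) : F = G := by
  rw [← adj_adj F, h, adj_adj]

theorem sum_comp {ι : Type*} (s : Finset ι) (G : ι → MultHom V Y Z) (F : MultHom V X Y) :
    comp (∑ i ∈ s, G i) F = ∑ i ∈ s, comp (G i) F :=
  map_sum (AddMonoidHom.mk' (fun G : MultHom V Y Z => comp G F) fun G G' => add_comp G G' F) G s

theorem comp_sum {ι : Type*} (s : Finset ι) (G : MultHom V Y Z) (F : ι → MultHom V X Y) :
    comp G (∑ i ∈ s, F i) = ∑ i ∈ s, comp G (F i) :=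
  map_sum (AddMonoidHom.mk' (fun F : MultHom V X Y => comp G F) (comp_add G)) F s

theorem adj_sum {ι : Type*} (s : Finset ι) (F : ι → MultHom V X Y) :
    adj (∑ i ∈ s, F i) = ∑ i ∈ s, adj (F i) :=
  map_sum (AddMonoidHom.mk' (fun F : MultHom V X Y => adj F) adj_add) F s

theorem L_zero (f : V.Hom Z X) : L (0 : MultHom V X Y) Z f = 0 := rfl

theorem L_sum {ι : Type*} (s : Finset ι) (F : ι → MultHom V X Y) (f : V.Hom Z X) :
    L (∑ i ∈ s, F i) Z f = ∑ i ∈ s, L (F i) Z f :=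
  map_sum (AddMonoidHom.mk' (fun F : MultHom V X Y => L F Z f) fun _ _ => rfl) F s

end MultHom

/-- A multiplier is determined by its left action on morphisms into its source, and here these all
vanish. -/
theorem IsZero.mult_from {V : CStarCat.{u}} {X Y : V.Obj} (hX : IsZero X) (m n : MultHom V X Y) :
    m = n := MultHom.ext_L fun Z f => by
  rw [(hX Z).2 f, map_zero, map_zero]

theorem IsZero.mult_to {V : CStarCat.{u}} {X Y : V.Obj} (hY : IsZero Y) (m n : MultHom V X Y) :
    m = n := MultHom.adj_injective (hY.mult_from _ _)

/-- The identity multiplier fixes every morphism into `X`, so these vanish; morphisms out of `X` are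
their adjoints. -/
theorem isZero_of_one_eq_zero {V : CStarCat.{u}} {X : V.Obj} (h : MultHom.one X = 0) :
    IsZero X := by
  have h' : ∀ (Y : V.Obj) (f : V.Hom Y X), f = 0 := fun Y f =>
    congrArg (fun m : MultHom V X X => m.L Y f) h
  refine fun Y => ⟨fun f => ?_, h' Y⟩
  rw [← V.adj_adj f, h' Y (V.adj f), V.adj_zero]

end StrictLimits

/-! ## Orthogonal sums over arbitrary index sets -/

/-- The `κ i : X i → S` are isometries with orthogonal ranges that span `S`. -/
structure IsOrthSum {W : CStarCat.{u}} {I : Type*} (X : I → W.Obj) (S : W.Obj)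
    (κ : ∀ i, MultHom W (X i) S) : Prop where
  adj_comp_self : ∀ i, (κ i).adj.comp (κ i) = MultHom.one (X i)
  adj_comp_of_ne : ∀ i j, i ≠ j → (κ i).adj.comp (κ j) = 0
  dense : ∀ Z, (Submodule.span ℂ {f : W.Hom Z S |
    ∃ (i : I) (g : W.Hom Z (X i)), (κ i).L Z g = f}).topologicalClosure = ⊤

/-- The diagonal multiplier with the entries `m i` for `i` in a finite set, and `0` elsewhere. -/
noncomputable def finDiag {W : CStarCat.{u}} {I : Type*} {X Y : I → W.Obj} {S T : W.Obj}
    (ι : ∀ i, MultHom W (X i) S) (κ : ∀ i, MultHom W (Y i) T) (F : Finset I)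
    (m : ∀ i, MultHom W (X i) (Y i)) : MultHom W S T :=
  ∑ i ∈ F, (κ i).comp ((m i).comp (ι i).adj)

theorem finDiag_add {W : CStarCat.{u}} {I : Type*} {X Y : I → W.Obj} {S T : W.Obj}
    (ι : ∀ i, MultHom W (X i) S) (κ : ∀ i, MultHom W (Y i) T) (F : Finset I)
    (m n : ∀ i, MultHom W (X i) (Y i)) :
    finDiag ι κ F (fun i => m i + n i) = finDiag ι κ F m + finDiag ι κ F n := by
  simp only [finDiag, MultHom.add_comp, MultHom.comp_add, Finset.sum_add_distrib]

theorem finDiag_smul {W : CStarCat.{u}} {I : Type*} {X Y : I → W.Obj} {S T : W.Obj}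
    (ι : ∀ i, MultHom W (X i) S) (κ : ∀ i, MultHom W (Y i) T) (F : Finset I) (c : ℂ)
    (m : ∀ i, MultHom W (X i) (Y i)) :
    finDiag ι κ F (fun i => c • m i) = c • finDiag ι κ F m := by
  simp only [finDiag, MultHom.smul_comp, MultHom.comp_smul, Finset.smul_sum]

namespace IsOrthSum

/-! ### Finite diagonal multipliers and extensionality on orthogonal sums -/

section

variable {W : CStarCat.{u}} {I : Type*} {X Y Z : I → W.Obj} {S T U : W.Obj}
  {ι : ∀ i, MultHom W (X i) S} {κ : ∀ i, MultHom W (Y i) T} {μ : ∀ i, MultHom W (Z i) U}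

/-- Orthogonality of the ranges kills every term except the one at `j`, and the isometry `ι j`
cancels there. -/
theorem finDiag_comp (hι : IsOrthSum X S ι) (F : Finset I) (m : ∀ i, MultHom W (X i) (Y i))
    {j : I} (hj : j ∈ F) : (finDiag ι κ F m).comp (ι j) = (κ j).comp (m j) := by
  rw [finDiag, MultHom.sum_comp, Finset.sum_eq_single j]
  · rw [MultHom.comp_assoc, MultHom.comp_assoc, hι.adj_comp_self, MultHom.comp_one]
  · intro i _ hij
    rw [MultHom.comp_assoc, MultHom.comp_assoc, hι.adj_comp_of_ne i j hij, MultHom.comp_zero,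
      MultHom.comp_zero]
  · exact fun h => absurd hj h

/-- Cross terms vanish because the ranges in the middle object are orthogonal; the outer families
are arbitrary. -/
theorem finDiag_comp_finDiag (hκ : IsOrthSum Y T κ) (F : Finset I)
    (n : ∀ i, MultHom W (Y i) (Z i)) (m : ∀ i, MultHom W (X i) (Y i)) :
    (finDiag κ μ F n).comp (finDiag ι κ F m) = finDiag ι μ F fun i => (n i).comp (m i) := by
  rw [finDiag.eq_def ι κ, MultHom.comp_sum, finDiag.eq_def ι μ]
  refine Finset.sum_congr rfl fun i hi => ?_
  rw [← MultHom.comp_assoc, hκ.finDiag_comp F n hi, MultHom.comp_assoc, MultHom.comp_assoc]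

theorem adj_finDiag (F : Finset I) (m : ∀ i, MultHom W (X i) (Y i)) :
    (finDiag ι κ F m).adj = finDiag κ ι F fun i => (m i).adj := by
  rw [finDiag, MultHom.adj_sum, finDiag]
  refine Finset.sum_congr rfl fun i hi => ?_
  rw [MultHom.adj_comp, MultHom.adj_comp, MultHom.adj_adj, MultHom.comp_assoc]

/-- Left multipliers are continuous, so they are determined on the dense span of the morphisms
factoring through the `ι i`. -/
theorem hom_ext (hι : IsOrthSum X S ι) {m n : MultHom W S T}
    (h : ∀ i, m.comp (ι i) = n.comp (ι i)) : m = n := by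
  refine MultHom.ext_L fun Z f => DFunLike.congr_fun (clm_ext_of_dense (hι.dense Z) ?_) f
  rintro _ ⟨i, g, rfl⟩
  exact congrArg (fun k : MultHom W (X i) T => k.L Z g) (h i)

theorem hom_ext_adj (hι : IsOrthSum X S ι) {m n : MultHom W T S}
    (h : ∀ i, (ι i).adj.comp m = (ι i).adj.comp n) : m = n :=
  MultHom.adj_injective (hι.hom_ext fun i => by
    have := congrArg MultHom.adj (h i)
    rwa [MultHom.adj_comp, MultHom.adj_comp, MultHom.adj_adj] at this)

end

/-! ### Diagonal multipliers of bounded families -/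

section

variable {W : CStarCat.{u}} {I : Type u} {X Y : I → W.Obj} {S T : W.Obj}
  {ι : ∀ i, MultHom W (X i) S} {κ : ∀ i, MultHom W (Y i) T}

/-- Orthogonal sums in `W` indexed by `I`. -/
structure SumObj (W : CStarCat.{u}) (I : Type u) where
  summand : I → W.Obj
  obj : W.Obj
  incl : ∀ i, MultHom W (summand i) obj
  isOrthSum : IsOrthSum summand obj incl

/-- Orthogonal sums in `W`, with bounded families of multiplier morphisms between the summands. -/
noncomputable def sumCat (W : CStarCat.{u}) (I : Type u) : CStarCat.{u} :=
  CStarCat.full (CStarCat.bddProd fun _ : I => (mult W).toCStarCat) (SumObj.summand (W := W))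

/-- `finDiag` as a functor. -/
noncomputable def sumFun (W : CStarCat.{u}) {I : Type u} (F : Finset I) :
    StarFun (sumCat W I).toPreCStarCat (mult W).toPreCStarCat where
  obj := SumObj.obj
  map := fun {o p : SumObj W I} (m : lp (fun i => MultHom W (o.summand i) (p.summand i)) ∞) =>
    finDiag o.incl p.incl F fun i => m i
  map_add := fun {o p : SumObj W I} (m n : lp (fun i => MultHom W (o.summand i) (p.summand i)) ∞) =>
    finDiag_add o.incl p.incl F (fun i => m i) fun i => n i
  map_smul := fun {o p : SumObj W I} c (m : lp (fun i => MultHom W (o.summand i) (p.summand i)) ∞) =>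
    finDiag_smul o.incl p.incl F c fun i => m i
  map_comp := fun {o p q : SumObj W I} (n : lp (fun i => MultHom W (p.summand i) (q.summand i)) ∞)
      (m : lp (fun i => MultHom W (o.summand i) (p.summand i)) ∞) =>
    (finDiag_comp_finDiag (ι := o.incl) (μ := q.incl) p.isOrthSum F (fun i => n i) fun i => m i).symm
  map_adj := fun {o p : SumObj W I} (m : lp (fun i => MultHom W (o.summand i) (p.summand i)) ∞) =>
    (adj_finDiag (ι := o.incl) (κ := p.incl) F fun i => m i).symm

/-- A bound independent of `F`. No operator estimate is needed: `sumFun` is a linear `*`-functor out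
of a C*-category of bounded families with the supremum norm, and such functors are contractive. -/
theorem norm_finDiag_le (hι : IsOrthSum X S ι) (hκ : IsOrthSum Y T κ) (F : Finset I)
    (m : ∀ i, MultHom W (X i) (Y i)) {C : ℝ} (hC : 0 ≤ C) (hm : ∀ i, ‖m i‖ ≤ C) :
    ‖finDiag ι κ F m‖ ≤ C := by
  let m' : lp (fun i => MultHom W (X i) (Y i)) ∞ :=
    ⟨m, memℓp_infty ⟨C, by rintro _ ⟨i, rfl⟩; exact hm i⟩⟩
  exact ((sumFun W F).norm_map_le (X := SumObj.mk X S ι hι) (Y := SumObj.mk Y T κ hκ) m').trans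
    (lp.norm_le_of_forall_le (f := m') hC hm)

/-- The diagonal is the strict limit of the bounded net of finite diagonals. On a morphism factoring
through the `i`-th summand the net is constant once `i ∈ F`, and the adjoints are finite diagonals
too. -/
theorem exists_diag (hι : IsOrthSum X S ι) (hκ : IsOrthSum Y T κ)
    (m : ∀ i, MultHom W (X i) (Y i)) {C : ℝ} (hC : 0 ≤ C) (hm : ∀ i, ‖m i‖ ≤ C) :
    ∃ n : MultHom W S T, ‖n‖ ≤ C ∧ ∀ i, n.comp (ι i) = (κ i).comp (m i) := by
  have key : ∀ {X Y : I → W.Obj} {S T : W.Obj} {ι : ∀ i, MultHom W (X i) S}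
      {κ : ∀ i, MultHom W (Y i) T} (_ : IsOrthSum X S ι) (m : ∀ i, MultHom W (X i) (Y i))
      (Z : W.Obj) (i : I) (g : W.Hom Z (X i)),
      Tendsto (fun F => (finDiag ι κ F m).L Z ((ι i).L Z g)) atTop
        (𝓝 ((κ i).L Z ((m i).L Z g))) := by
    intro X Y S T ι κ hι m Z i g
    refine tendsto_const_nhds.congr' ?_
    filter_upwards [eventually_ge_atTop {i}] with F hF
    exact congrArg (fun k : MultHom W (X i) T => k.L Z g)
      (hι.finDiag_comp F m (hF (Finset.mem_singleton_self i))).symm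
  obtain ⟨n, hn, hlim⟩ := MultHom.exists_strict_lim (fun F => finDiag ι κ F m)
    (l := atTop) (fun F => norm_finDiag_le hι hκ F m hC hm) hι.dense
    (by rintro Z _ ⟨i, g, rfl⟩; exact ⟨_, key hι m Z i g⟩) hκ.dense (by
      rintro Z _ ⟨i, g, rfl⟩
      simp_rw [adj_finDiag]
      exact ⟨_, key hκ _ Z i g⟩)
  exact ⟨n, hn, fun i => MultHom.ext_L fun Z g =>
    tendsto_nhds_unique (hlim Z ((ι i).L Z g)) (key hι m Z i g)⟩

/-- Compressing both sides by `(ι j).adj` reduces the claim to the adjoint of `h j`: for `j = i`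
both sides give `(m i).adj`, otherwise both give zero. -/
theorem adj_diag_comp (hι : IsOrthSum X S ι) (hκ : IsOrthSum Y T κ)
    {m : ∀ i, MultHom W (X i) (Y i)} {n : MultHom W S T}
    (h : ∀ i, n.comp (ι i) = (κ i).comp (m i)) (i : I) :
    n.adj.comp (κ i) = (ι i).comp (m i).adj := by
  refine hι.hom_ext_adj fun j => ?_
  rw [← MultHom.comp_assoc, ← MultHom.adj_comp, h, MultHom.adj_comp, MultHom.comp_assoc,
    ← MultHom.comp_assoc (ι j).adj]
  rcases eq_or_ne j i with rfl | hj
  · rw [hκ.adj_comp_self, hι.adj_comp_self, MultHom.comp_one, MultHom.one_comp]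
  · rw [hκ.adj_comp_of_ne j i hj, hι.adj_comp_of_ne j i hj, MultHom.comp_zero, MultHom.zero_comp]

end

/-! ### Orthogonal sums versus countable direct sums -/

section

variable {W : CStarCat.{u}} {S : W.Obj}

/-- Strict convergence of the sum of projections to the identity exhibits each `f` as a limit of
finite sums of morphisms factoring through the `ι j`. -/
theorem of_isDirectSum {J : Type} {X : J → W.Obj} {ι : ∀ j, MultHom W (X j) S}
    (h : IsDirectSum X S ι) : IsOrthSum X S ι where
  adj_comp_self := h.adj_comp_self
  adj_comp_of_ne := h.adj_comp_of_ne
  dense Z := by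
    rw [eq_top_iff]
    intro f _
    refine (Submodule.isClosed_topologicalClosure _).mem_of_tendsto (h.hasSum.1 Z f)
      (Eventually.of_forall fun F => Submodule.le_topologicalClosure _
        (Submodule.sum_mem _ fun j _ => Submodule.subset_span ⟨j, (ι j).adj.L Z f, rfl⟩))

/-- The partial sums of the `ι j ι j*` are projections, hence a bounded net, and they eventually act
as the identity on a set with dense span. -/
theorem isDirectSum {J : Type} {X : J → W.Obj} {ι : ∀ j, MultHom W (X j) S}
    (h : IsOrthSum X S ι) : IsDirectSum X S ι where
  adj_comp_self := h.adj_comp_self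
  adj_comp_of_ne := h.adj_comp_of_ne
  hasSum := by
    have hone : ∀ F : Finset J, finDiag ι ι F (fun j => MultHom.one (X j)) =
        ∑ j ∈ F, (ι j).comp (ι j).adj := fun F =>
      Finset.sum_congr rfl fun j _ => by rw [MultHom.one_comp]
    have hnorm : ∀ F : Finset J, ‖finDiag ι ι F (fun j => MultHom.one (X j))‖ ≤ 1 := fun F => by
      -- A partial sum `P` is a self-adjoint idempotent, so the C*-identity reads `‖P‖ = ‖P‖ ^ 2`.
      have h1 := MultHom.norm_adj_comp_self (finDiag ι ι F (fun j => MultHom.one (X j)))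
      rw [adj_finDiag, h.finDiag_comp_finDiag] at h1
      simp only [MultHom.adj_one, MultHom.comp_one] at h1
      nlinarith [norm_nonneg (finDiag ι ι F (fun j => MultHom.one (X j)))]
    have hL : ∀ (Z : W.Obj) (a : W.Hom Z S),
        HasSum (fun j => ((ι j).comp (ι j).adj).L Z a) ((MultHom.one S).L Z a) := by
      intro Z a
      have h2 := tendsto_of_dense (l := atTop)
        (fun F => (finDiag ι ι F (fun j => MultHom.one (X j))).L Z)
        (fun F => (MultHom.norm_L_le _ Z).trans (hnorm F)) (h.dense Z) ((MultHom.one S).L Z) (by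
          rintro _ ⟨j, g, rfl⟩
          refine tendsto_const_nhds.congr' ?_
          filter_upwards [eventually_ge_atTop {j}] with F hF
          exact congrArg (fun k : MultHom W (X j) S => k.L Z g) ((h.finDiag_comp F _
            (hF (Finset.mem_singleton_self j))).trans (MultHom.comp_one _)).symm) a
      refine h2.congr fun F => ?_
      rw [hone, MultHom.L_sum]
    refine ⟨hL, fun Z b => ?_⟩
    -- Convergence of the right multipliers is the adjoint of that of the left ones, since each `ι j
    -- ι j*` is self-adjoint.
    have h3 := (hL Z (W.adj b)).map (W.adjL Z S) (W.adjL Z S).continuous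
    have h4 : (MultHom.one S).R Z b = W.adjL Z S ((MultHom.one S).L Z (W.adj b)) :=
      (W.adj_adj b).symm
    have h5 : (fun j => ((ι j).comp (ι j).adj).R Z b) =
        W.adjL Z S ∘ fun j => ((ι j).comp (ι j).adj).L Z (W.adj b) := funext fun j => by
      change (ι j).adj.R Z ((ι j).R Z b) = W.adj ((ι j).L Z ((ι j).adj.L Z (W.adj b)))
      rw [MultHom.R_adj, MultHom.L_adj, W.adj_adj]
    rw [h4, h5]
    exact h3

theorem reindex {I J : Type*} {X : I → W.Obj} (e : J ≃ I) {ι : ∀ j, MultHom W (X (e j)) S}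
    (h : IsOrthSum (fun j => X (e j)) S ι) : ∃ κ : ∀ i, MultHom W (X i) S, IsOrthSum X S κ := by
  -- `piCongrLeft` hides a cast along `e (e.symm i) = i`. It disappears on indices of the form `e
  -- j`, which is why the quantifiers are first rewritten through the surjectivity of `e`.
  refine ⟨e.piCongrLeft (fun i => MultHom W (X i) S) ι, ?_, ?_, fun Z => ?_⟩
  · refine e.surjective.forall.2 fun j => ?_
    rw [Equiv.piCongrLeft_apply_apply, h.adj_comp_self]
  · refine e.surjective.forall.2 fun j => e.surjective.forall.2 fun k hjk => ?_
    rw [Equiv.piCongrLeft_apply_apply, Equiv.piCongrLeft_apply_apply,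
      h.adj_comp_of_ne j k fun hh => hjk (congrArg e hh)]
  · refine topologicalClosure_span_eq_top_of_subset (h.dense Z) ?_
    rintro _ ⟨j, g, rfl⟩
    refine Submodule.le_topologicalClosure _ (Submodule.subset_span ⟨e j, g, ?_⟩)
    rw [Equiv.piCongrLeft_apply_apply]

open Classical in
-- Summands that are zero objects can be added freely: the zero multiplier out of a zero object is
-- an isometry, orthogonal to everything.
theorem extend_zero {I : Type*} {X : I → W.Obj} {s : Set I} (hs : ∀ i, i ∉ s → IsZero (X i))
    {ι : ∀ i : s, MultHom W (X i) S} (h : IsOrthSum (fun i : s => X i) S ι) :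
    ∃ κ : ∀ i, MultHom W (X i) S, IsOrthSum X S κ := by
  refine ⟨fun i => if hi : i ∈ s then ι ⟨i, hi⟩ else 0, fun i => ?_, fun i j hij => ?_,
    fun Z => ?_⟩
  · by_cases hi : i ∈ s
    · simp only [dif_pos hi]
      exact h.adj_comp_self ⟨i, hi⟩
    · exact (hs i hi).mult_from _ _
  · by_cases hi : i ∈ s
    · by_cases hj : j ∈ s
      · simp only [dif_pos hi, dif_pos hj]
        exact h.adj_comp_of_ne ⟨i, hi⟩ ⟨j, hj⟩ fun hh => hij (congrArg Subtype.val hh)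
      · exact (hs j hj).mult_from _ _
    · exact (hs i hi).mult_to _ _
  · refine topologicalClosure_span_eq_top_of_subset (h.dense Z) ?_
    rintro _ ⟨j, g, rfl⟩
    refine Submodule.le_topologicalClosure _ (Submodule.subset_span ⟨j, g, ?_⟩)
    rw [dif_pos j.2]

/-- Countably additive C*-categories have orthogonal sums of all families with at most countably
many nonzero entries. -/
theorem exists_of_countable (W : CLin.{u}) {I : Type*} (X : I → W.Obj)
    (hX : {i | ¬ IsZero (V := W.toCStarCat) (X i)}.Countable) :
    ∃ (S : W.Obj) (κ : ∀ i, MultHom W.toCStarCat (X i) S), IsOrthSum X S κ := by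
  have := hX.to_subtype
  -- Direct sums are only supplied for index types in `Type`, so the set of nonzero entries is
  -- replaced by its image in `ℕ`.
  obtain ⟨e, he⟩ := Countable.exists_injective_nat {i | ¬ IsZero (V := W.toCStarCat) (X i)}
  let E := (Equiv.ofInjective e he).symm
  obtain ⟨S, ι, hι⟩ := W.isCountablyAdditive.directSums (Set.range e) fun j => X (E j)
  obtain ⟨κ, hκ⟩ := (of_isDirectSum hι).reindex
    (X := fun i : {i | ¬ IsZero (V := W.toCStarCat) (X i)} => X i) E
  exact ⟨S, hκ.extend_zero fun i hi => not_not.1 hi⟩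

/-- By `hom_ext` the identity of `S` and `0` agree as soon as they agree on the summands, and
multipliers out of a zero object are all equal. -/
theorem isZero {I : Type*} {X : I → W.Obj} {κ : ∀ i, MultHom W (X i) S} (h : IsOrthSum X S κ)
    (hX : ∀ i, IsZero (X i)) : IsZero S :=
  isZero_of_one_eq_zero (h.hom_ext fun i => (hX i).mult_from _ _)

end

/-- Nondegenerate functors preserve orthogonal sums. -/
theorem map {V W : CStarCat.{u}} (f : NDFun V W) {I : Type*} {X : I → V.Obj} {S : V.Obj}
    {κ : ∀ i, MultHom V (X i) S} (h : IsOrthSum X S κ) :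
    IsOrthSum (fun i => f.obj (X i)) (f.obj S) fun i => f.extM (κ i) where
  adj_comp_self i := by
    rw [← f.extM_adj, ← f.extM_comp, h.adj_comp_self, f.extM_one]
  adj_comp_of_ne i j hij := by
    rw [← f.extM_adj, ← f.extM_comp, h.adj_comp_of_ne i j hij]
    exact f.ext.map_zero (X j) (X i)
  dense T := by
    -- By nondegeneracy the elements `f(a) ∘ w` suffice. Approximating `a` by combinations of `κ i ∘
    -- b` reduces to `f(κ i ∘ b) ∘ w`, which factors through `f(κ i)`.
    refine topologicalClosure_span_eq_top_of_subset (f.dense_gens S T) ?_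
    rintro _ ⟨a, w, rfl⟩
    refine mem_of_dense (h.dense S) (f.actL w) (Submodule.isClosed_topologicalClosure _) ?_ a
    rintro _ ⟨i, b, rfl⟩
    refine Submodule.le_topologicalClosure _ (Submodule.subset_span ⟨i, (f.map b).L T w, ?_⟩)
    exact f.extM_L (κ i) b T w

end IsOrthSum

/-! ## Multipliers of direct sums -/

namespace DSum

variable {I : Type u} {V : I → CLin.{u}} {X Y Z : (directSum V).Obj}

/-- The entry of an object at `i`. -/
def ent (X : (directSum V).Obj) (i : I) : (V i).Obj := Subtype.val X i

/-- The object with given entries. -/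
def obj (X : ∀ i, (V i).Obj) (hX : {i | ¬ IsZero (V := (V i).toCStarCat) (X i)}.Countable) :
    (directSum V).Obj := (⟨X, hX⟩ : {X : ∀ i, (V i).Obj //
      {i | ¬ IsZero (V := (V i).toCStarCat) (X i)}.Countable})

theorem countable_ent (X : (directSum V).Obj) :
    {i | ¬ IsZero (V := (V i).toCStarCat) (ent X i)}.Countable := Subtype.prop X

/-- The entry of a morphism at `i`. -/
def homEnt (f : (directSum V).Hom X Y) (i : I) : (V i).Hom (ent X i) (ent Y i) :=
  ProdHom.app (A := fun i => (V i).toCStarCat) f i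

/-- The morphism with given entries. -/
def hom (f : ∀ i, (V i).Hom (ent X i) (ent Y i)) (h : Tendsto (fun i => ‖f i‖) cofinite (𝓝 0)) :
    (directSum V).Hom X Y :=
  ProdHom.mk (A := fun i => (V i).toCStarCat) (X := ent X) (Y := ent Y) f h

@[simp] theorem homEnt_hom (f : ∀ i, (V i).Hom (ent X i) (ent Y i))
    (h : Tendsto (fun i => ‖f i‖) cofinite (𝓝 0)) (i : I) : homEnt (hom f h) i = f i := rfl

theorem hom_ext {f g : (directSum V).Hom X Y} (h : ∀ i, homEnt f i = homEnt g i) : f = g :=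
  ProdHom.ext (A := fun i => (V i).toCStarCat) (X := ent X) (Y := ent Y) h

theorem homEnt_comp (g : (directSum V).Hom Y Z) (f : (directSum V).Hom X Y) (i : I) :
    homEnt ((directSum V).comp g f) i = (V i).comp (homEnt g i) (homEnt f i) := rfl

theorem homEnt_adj (f : (directSum V).Hom X Y) (i : I) :
    homEnt ((directSum V).adj f) i = (V i).adj (homEnt f i) := rfl

theorem homEnt_add (f g : (directSum V).Hom X Y) (i : I) :
    homEnt (f + g) i = homEnt f i + homEnt g i := rfl

theorem homEnt_sub (f g : (directSum V).Hom X Y) (i : I) :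
    homEnt (f - g) i = homEnt f i - homEnt g i := rfl

theorem homEnt_smul (c : ℂ) (f : (directSum V).Hom X Y) (i : I) :
    homEnt (c • f) i = c • homEnt f i := rfl

theorem norm_homEnt_le (f : (directSum V).Hom X Y) (i : I) : ‖homEnt f i‖ ≤ ‖f‖ :=
  ProdHom.norm_app_le (A := fun i => (V i).toCStarCat) (X := ent X) (Y := ent Y) f i

theorem norm_le_of {f : (directSum V).Hom X Y} {C : ℝ} (hC : 0 ≤ C)
    (h : ∀ i, ‖homEnt f i‖ ≤ C) : ‖f‖ ≤ C :=
  ProdHom.norm_le_of (A := fun i => (V i).toCStarCat) (X := ent X) (Y := ent Y) hC h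

theorem tendsto_homEnt (f : (directSum V).Hom X Y) :
    Tendsto (fun i => ‖homEnt f i‖) cofinite (𝓝 0) :=
  ProdHom.tendsto (A := fun i => (V i).toCStarCat) (X := ent X) (Y := ent Y) f

/-- Taking the entry at `i`, as an additive map. -/
noncomputable def homEntHom (X Y : (directSum V).Obj) (i : I) :
    (directSum V).Hom X Y →+ (V i).Hom (ent X i) (ent Y i) :=
  AddMonoidHom.mk' (fun f => homEnt f i) fun f g => homEnt_add f g i

theorem homEnt_sum {J : Type*} (s : Finset J) (f : J → (directSum V).Hom X Y) (i : I) :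
    homEnt (∑ j ∈ s, f j) i = ∑ j ∈ s, homEnt (f j) i :=
  map_sum (homEntHom X Y i) f s

open Classical in
/-- The morphism with a single nonzero entry. -/
noncomputable def single (i : I) (a : (V i).Hom (ent X i) (ent Y i)) : (directSum V).Hom X Y :=
  hom (Pi.single (M := fun i => (V i).Hom (ent X i) (ent Y i)) i a)
    (tendsto_const_nhds.congr' (by
      filter_upwards [(Set.finite_singleton i).compl_mem_cofinite] with j hj
      rw [Pi.single_eq_of_ne hj, norm_zero]))

theorem homEnt_single_self (i : I) (a : (V i).Hom (ent X i) (ent Y i)) :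
    homEnt (single i a) i = a := by
  classical
  exact Pi.single_eq_same (M := fun i => (V i).Hom (ent X i) (ent Y i)) i a

theorem homEnt_single_of_ne {i j : I} (h : j ≠ i) (a : (V i).Hom (ent X i) (ent Y i)) :
    homEnt (single i a) j = 0 := by
  classical
  exact Pi.single_eq_of_ne (M := fun i => (V i).Hom (ent X i) (ent Y i)) h a

/-- `single` as a continuous linear map. -/
noncomputable def singleL (X Y : (directSum V).Obj) (i : I) :
    (V i).Hom (ent X i) (ent Y i) →L[ℂ] (directSum V).Hom X Y :=
  LinearMap.mkContinuous
    { toFun := fun a => single i a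
      map_add' := fun a b => hom_ext fun k => by
        rw [homEnt_add]
        by_cases hk : k = i
        · subst hk; simp only [homEnt_single_self]
        · simp only [homEnt_single_of_ne hk, add_zero]
      map_smul' := fun c a => hom_ext fun k => by
        rw [RingHom.id_apply, homEnt_smul]
        by_cases hk : k = i
        · subst hk; simp only [homEnt_single_self]
        · simp only [homEnt_single_of_ne hk, smul_zero] } 1
    (fun a => norm_le_of (by positivity) fun k => by
      rw [one_mul, LinearMap.coe_mk, AddHom.coe_mk]
      by_cases hk : k = i
      · subst hk; rw [homEnt_single_self]
      · rw [homEnt_single_of_ne hk, norm_zero]; exact norm_nonneg a)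

/-- The entries of a morphism vanish at infinity, so truncating it to the finitely many indices with
large entries gives an approximation in the supremum norm. -/
theorem dense_single (X Y : (directSum V).Obj) :
    (Submodule.span ℂ {f : (directSum V).Hom X Y | ∃ i a, single i a = f}).topologicalClosure
      = ⊤ := by
  classical
  rw [eq_top_iff]
  intro f _
  refine Metric.mem_closure_iff.2 fun ε hε => ?_
  have hS : {i : I | ¬ ‖homEnt f i‖ ≤ ε / 2}.Finite := by
    -- Finiteness of the exceptional set is by definition an eventual statement along `cofinite`.
    refine (show ∀ᶠ i in cofinite, ‖homEnt f i‖ ≤ ε / 2 from ?_)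
    filter_upwards [Metric.tendsto_nhds.1 (tendsto_homEnt f) (ε / 2) (half_pos hε)] with i hi
    rw [dist_zero_right, norm_norm] at hi
    exact hi.le
  refine ⟨∑ i ∈ hS.toFinset, single i (homEnt f i), Submodule.sum_mem _ fun i _ =>
    Submodule.subset_span ⟨i, _, rfl⟩, ?_⟩
  rw [dist_eq_norm]
  refine (norm_le_of (half_pos hε).le fun i => ?_).trans_lt (half_lt_self hε)
  rw [homEnt_sub, homEnt_sum]
  by_cases hi : i ∈ hS.toFinset
  · rw [Finset.sum_eq_single_of_mem i hi fun j _ hj => homEnt_single_of_ne hj.symm _,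
      homEnt_single_self, sub_self, norm_zero]
    exact (half_pos hε).le
  · rw [Finset.sum_eq_zero fun j hj => homEnt_single_of_ne (ne_of_mem_of_not_mem hj hi).symm _,
      sub_zero]
    exact not_not.1 fun h => hi (hS.mem_toFinset.2 h)

/-- The projection of the direct sum onto a summand. -/
noncomputable def proj (V : I → CLin.{u}) (i : I) : NDFun (directSum V) (V i).toCStarCat where
  obj X := ent X i
  map f := MultHom.ofHom (homEnt f i)
  map_add _ _ := MultHom.ofHom_add _ _
  map_smul _ _ := MultHom.ofHom_smul _ _
  map_comp _ _ := MultHom.ofHom_comp _ _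
  map_adj _ := MultHom.ofHom_adj _
  nondeg := MFun.nondegenerate_of_left fun X Y => by
    rw [eq_top_iff]
    intro w _
    obtain ⟨l, hl, -, hlim⟩ := (V i).exists_approxUnit (ent Y i)
    -- Elements `e` of an approximate unit of the entry lift to endomorphisms `single i e` of `Y`,
    -- so each `e ∘ w` is a generator.
    refine (Submodule.isClosed_topologicalClosure _).mem_of_tendsto (hlim _ w)
      (Eventually.of_forall fun e => Submodule.le_topologicalClosure _
        (Submodule.subset_span ⟨single i e, w, ?_⟩))
    change (V i).comp (homEnt (single i e) i) w = _
    rw [homEnt_single_self]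

/-- The entry of a multiplier morphism at `i`. -/
noncomputable def multEnt (m : MultHom (directSum V) X Y) (i : I) :
    MultHom (V i).toCStarCat (ent X i) (ent Y i) := (proj V i).extM m

/-- After composition on the right with any `k` this is the defining property of the extension of
`proj V i`, and right composition separates morphisms. It shows that a multiplier of the direct sum
acts entrywise. -/
theorem homEnt_L (m : MultHom (directSum V) X Y) (f : (directSum V).Hom Z X) (i : I) :
    homEnt (m.L Z f) i = (multEnt m i).L _ (homEnt f i) := by
  refine (V i).eq_of_forall_comp_right fun k => ?_
  rw [← MultHom.L_comp]
  exact ((proj V i).extM_L m f _ k).symm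

theorem mult_ext {m n : MultHom (directSum V) X Y} (h : ∀ i, multEnt m i = multEnt n i) : m = n :=
  MultHom.ext_L fun Z f => hom_ext fun i => by rw [homEnt_L, homEnt_L, h]

theorem multEnt_comp (n : MultHom (directSum V) Y Z) (m : MultHom (directSum V) X Y) (i : I) :
    multEnt (n.comp m) i = (multEnt n i).comp (multEnt m i) := (proj V i).extM_comp n m

theorem multEnt_adj (m : MultHom (directSum V) X Y) (i : I) :
    multEnt m.adj i = (multEnt m i).adj := (proj V i).extM_adj m

theorem multEnt_one (X : (directSum V).Obj) (i : I) :
    multEnt (MultHom.one X) i = MultHom.one (ent X i) := (proj V i).extM_one X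

theorem multEnt_zero (i : I) : multEnt (0 : MultHom (directSum V) X Y) i = 0 :=
  (proj V i).ext.map_zero X Y

theorem multEnt_ofHom (f : (directSum V).Hom X Y) (i : I) :
    multEnt (MultHom.ofHom f) i = MultHom.ofHom (homEnt f i) := (proj V i).extM_ofHom f

/-- Entrywise left multiplication. -/
noncomputable def multL (m : ∀ i, MultHom (V i).toCStarCat (ent X i) (ent Y i)) {C : ℝ}
    (hC : 0 ≤ C) (hm : ∀ i, ‖m i‖ ≤ C) (Z : (directSum V).Obj) :
    (directSum V).Hom Z X →L[ℂ] (directSum V).Hom Z Y :=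
  LinearMap.mkContinuous
    { toFun := fun f => hom (fun i => (m i).L _ (homEnt f i))
        (squeeze_zero (fun _ => norm_nonneg _) (fun i => ((m i).L _).le_of_opNorm_le
          (((m i).norm_L_le _).trans (hm i)) _) (by simpa using (tendsto_homEnt f).const_mul C))
      map_add' := fun f g => hom_ext fun i => map_add ((m i).L _) (homEnt f i) (homEnt g i)
      map_smul' := fun c f => hom_ext fun i => map_smul ((m i).L _) c (homEnt f i) } C
    (fun f => norm_le_of (by positivity) fun i => (((m i).L _).le_of_opNorm_le
      (((m i).norm_L_le _).trans (hm i)) _).trans (by gcongr; exact norm_homEnt_le f i))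

/-- Entrywise right multiplication. -/
noncomputable def multR (m : ∀ i, MultHom (V i).toCStarCat (ent X i) (ent Y i)) {C : ℝ}
    (hC : 0 ≤ C) (hm : ∀ i, ‖m i‖ ≤ C) (Z : (directSum V).Obj) :
    (directSum V).Hom Y Z →L[ℂ] (directSum V).Hom X Z :=
  LinearMap.mkContinuous
    { toFun := fun f => hom (fun i => (m i).R _ (homEnt f i))
        (squeeze_zero (fun _ => norm_nonneg _) (fun i => ((m i).R _).le_of_opNorm_le
          (((m i).norm_R_le _).trans (hm i)) _) (by simpa using (tendsto_homEnt f).const_mul C))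
      map_add' := fun f g => hom_ext fun i => map_add ((m i).R _) (homEnt f i) (homEnt g i)
      map_smul' := fun c f => hom_ext fun i => map_smul ((m i).R _) c (homEnt f i) } C
    (fun f => norm_le_of (by positivity) fun i => (((m i).R _).le_of_opNorm_le
      (((m i).norm_R_le _).trans (hm i)) _).trans (by gcongr; exact norm_homEnt_le f i))

/-- The multiplier morphism with given entries. -/
noncomputable def mult (m : ∀ i, MultHom (V i).toCStarCat (ent X i) (ent Y i)) {C : ℝ}
    (hC : 0 ≤ C) (hm : ∀ i, ‖m i‖ ≤ C) : MultHom (directSum V) X Y :=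
  MultHom.mk (multL m hC hm) (multR m hC hm) C
    (fun _ => LinearMap.mkContinuous_norm_le _ hC _)
    (fun _ => LinearMap.mkContinuous_norm_le _ hC _)
    (fun _ _ f g => hom_ext fun i => (m i).compat (homEnt f i) (homEnt g i))

@[simp] theorem multEnt_mult (m : ∀ i, MultHom (V i).toCStarCat (ent X i) (ent Y i)) {C : ℝ}
    (hC : 0 ≤ C) (hm : ∀ i, ‖m i‖ ≤ C) (i : I) : multEnt (mult m hC hm) i = m i :=
  (proj V i).extM_unique fun a _ w => (m i).L_comp (homEnt a i) w

/-! ## Countable additivity of direct sums -/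

/-- The relations are checked entry by entry. For density, morphisms with a single nonzero entry
suffice, and that entry is approximated inside `V i`. -/
theorem isOrthSum_mult {J : Type*} {X : J → (directSum V).Obj}
    (ι : ∀ j i, MultHom (V i).toCStarCat (ent (X j) i) (ent Y i))
    (h : ∀ i, IsOrthSum (fun j => ent (X j) i) (ent Y i) fun j => ι j i) :
    IsOrthSum X Y fun j => mult (ι j) zero_le_one fun i =>
      MultHom.norm_le_one_of_adj_comp_self ((h i).adj_comp_self j) where
  adj_comp_self j := mult_ext fun i => by
    rw [multEnt_comp, multEnt_adj, multEnt_mult, multEnt_one]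
    exact (h i).adj_comp_self j
  adj_comp_of_ne j k hjk := mult_ext fun i => by
    rw [multEnt_comp, multEnt_adj, multEnt_mult, multEnt_mult, multEnt_zero]
    exact (h i).adj_comp_of_ne j k hjk
  dense Z := by
    refine topologicalClosure_span_eq_top_of_subset (dense_single Z Y) ?_
    rintro _ ⟨i, a, rfl⟩
    refine mem_of_dense ((h i).dense (ent Z i)) (singleL Z Y i)
      (Submodule.isClosed_topologicalClosure _) ?_ a
    rintro _ ⟨j, g, rfl⟩
    refine Submodule.le_topologicalClosure _ (Submodule.subset_span
      ⟨j, single i g, hom_ext fun k => ?_⟩)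
    rw [homEnt_L, multEnt_mult]
    change _ = homEnt (single i ((ι j i).L (ent Z i) g)) k
    by_cases hk : k = i
    · subst hk; rw [homEnt_single_self, homEnt_single_self]
    · rw [homEnt_single_of_ne hk, homEnt_single_of_ne hk, map_zero]

theorem exists_split {p : MultHom (directSum V) X X}
    (ι : ∀ i, MultHom (V i).toCStarCat (ent Y i) (ent X i))
    (h : ∀ i, (ι i).adj.comp (ι i) = MultHom.one (ent Y i))
    (hp : ∀ i, (ι i).comp (ι i).adj = multEnt p i) :
    ∃ κ : MultHom (directSum V) Y X, κ.adj.comp κ = MultHom.one Y ∧ κ.comp κ.adj = p := by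
  refine ⟨mult ι zero_le_one fun i => MultHom.norm_le_one_of_adj_comp_self (h i),
    mult_ext fun i => ?_, mult_ext fun i => ?_⟩
  · rw [multEnt_comp, multEnt_adj, multEnt_mult, multEnt_one]
    exact h i
  · rw [multEnt_comp, multEnt_adj, multEnt_mult]
    exact hp i

/-- Sums and splittings are chosen in each `V i` separately; the content is that the resulting
families still have countable support. -/
theorem isCountablyAdditive (V : I → CLin.{u}) : IsCountablyAdditive (directSum V) where
  directSums J _ X := by
    choose S ι hι using fun i => (V i).isCountablyAdditive.directSums J fun j => ent (X j) i
    have hι' := fun i => IsOrthSum.of_isDirectSum (hι i)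
    have hS : {i | ¬ IsZero (V := (V i).toCStarCat) (S i)}.Countable := by
      -- The `i`-th sum is zero if all its summands are, so the support lies in a countable union of
      -- countable supports.
      refine (Set.countable_iUnion fun j => countable_ent (X j)).mono fun i hi => ?_
      by_contra h
      refine hi ((hι' i).isZero fun j => ?_)
      by_contra hj
      exact h (Set.mem_iUnion.2 ⟨j, hj⟩)
    exact ⟨obj S hS, _, (isOrthSum_mult (Y := obj S hS) (fun j i => ι i j) hι').isDirectSum⟩
  split X p hp hp' := by
    choose U ι hι hιp using fun i => (V i).isCountablyAdditive.split (ent X i) (multEnt p i)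
      (by rw [← multEnt_comp, hp]) (by rw [← multEnt_adj, hp'])
    have hU : {i | ¬ IsZero (V := (V i).toCStarCat) (U i)}.Countable := by
      refine (countable_ent X).mono ?_
      intro i hi hX
      -- Where the entry of `X` is a zero object, the isometry `ι i` into it vanishes, hence so does
      -- the identity of `U i`.
      refine hi (isZero_of_one_eq_zero ?_)
      rw [← hι i, IsZero.mult_to hX (ι i) 0, MultHom.comp_zero]
    exact ⟨obj U hU, exists_split (Y := obj U hU) ι hι hιp⟩

end DSum

/-! ## Decomposition of objects of the direct sum -/

/-- Associativity `(G a) F = G (a F)` of the two actions, tested against morphisms `k` composed on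
the right. -/
theorem MultHom.R_L_comm {V : CStarCat.{u}} {X Y X' Y' : V.Obj} (F : MultHom V X' X)
    (G : MultHom V Y Y') (a : V.Hom X Y) :
    F.R Y' (G.L X a) = G.L X' (F.R Y a) := by
  refine V.eq_of_forall_comp_right fun k => ?_
  rw [← F.compat, ← G.L_comp, ← G.L_comp, F.compat]

/-- The canonical unitary from `Z` to the entry of its inclusion. -/
noncomputable def inclUnit {I : Type u} (V : I → CLin.{u}) {j : I} (Z : (V j).Obj) :
    (d : Decidable (j = j)) → MultHom (V j).toCStarCat Z (inclObj V Z j d)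
  | .isTrue _ => MultHom.one Z
  | .isFalse h => absurd rfl h

namespace DSum

variable {I : Type u} {V : I → CLin.{u}} {X Y Z : (directSum V).Obj}

theorem isZero_ent_incl {j k : I} (h : j ≠ k) (Z : (V j).Obj) :
    IsZero (V := (V k).toCStarCat) (ent ((incl V j).obj Z) k) :=
  isZero_inclObj V Z _ h

/-- The canonical unitary from `Z` to the entry of its inclusion. -/
noncomputable def unit {j : I} (Z : (V j).Obj) :
    MultHom (V j).toCStarCat Z (ent ((incl V j).obj Z) j) :=
  inclUnit V Z (Classical.propDecidable (j = j))

theorem adj_unit_comp_unit {j : I} (Z : (V j).Obj) :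
    (unit Z).adj.comp (unit Z) = MultHom.one Z := by
  -- The classical decision of `j = j` does not reduce, so the claim is generalized to all `d` and
  -- proved by cases.
  have key : ∀ d : Decidable (j = j),
      (inclUnit V Z d).adj.comp (inclUnit V Z d) = MultHom.one Z := by
    rintro (h | h)
    · exact absurd rfl h
    · exact (MultHom.comp_one _).trans MultHom.adj_one
  exact key _

theorem unit_comp_adj_unit {j : I} (Z : (V j).Obj) :
    (unit Z).comp (unit Z).adj = MultHom.one (ent ((incl V j).obj Z) j) := by
  have key : ∀ d : Decidable (j = j),
      (inclUnit V Z d).comp (inclUnit V Z d).adj = MultHom.one (inclObj V Z j d) := by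
    rintro (h | h)
    · exact absurd rfl h
    · exact (MultHom.one_comp _).trans MultHom.adj_one
  exact key _

/-- Conjugation by `unit` absorbs the transport in the definition of `inclObj`, so later arguments
can avoid casts. -/
theorem homEnt_incl {j : I} {Z Z' : (V j).Obj} (a : (V j).Hom Z Z') :
    homEnt ((incl V j).map a) j = (unit Z').L _ ((unit Z).adj.R _ a) := by
  have key : ∀ d : Decidable (j = j), inclHom V a j d =
      (inclUnit V Z' d).L _ ((inclUnit V Z d).adj.R _ a) := by
    rintro (h | h)
    · exact absurd rfl h
    · exact ((V j).adj_adj a).symm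
  exact key _

open Classical in
/-- The isometry from the inclusion of an entry of `X` to `X`. -/
noncomputable def col (X : (directSum V).Obj) (i : I) :
    MultHom (directSum V) ((incl V i).obj (ent X i)) X :=
  mult (Pi.single (M := fun k => MultHom (V k).toCStarCat
      (ent ((incl V i).obj (ent X i)) k) (ent X k)) i (unit (ent X i)).adj)
    zero_le_one fun k => by
      by_cases h : k = i
      · subst h
        rw [Pi.single_eq_same]
        exact (MultHom.norm_adj_le _).trans
          (MultHom.norm_le_one_of_adj_comp_self (adj_unit_comp_unit _))
      · rw [Pi.single_eq_of_ne h, norm_zero]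
        exact zero_le_one

theorem multEnt_col_self (X : (directSum V).Obj) (i : I) :
    multEnt (col X i) i = (unit (ent X i)).adj := by
  classical
  rw [col, multEnt_mult, Pi.single_eq_same]

theorem multEnt_col_of_ne (X : (directSum V).Obj) {i k : I} (h : k ≠ i) :
    multEnt (col X i) k = 0 := by
  classical
  rw [col, multEnt_mult, Pi.single_eq_of_ne h]

/-- At the index `k` only `col X k` has a possibly nonzero entry, and that entry is unitary. A
morphism with its single nonzero entry at `i` is reproduced by `col X i ∘ (col X i)*`, which gives
density. -/
theorem isOrthSum_col (X : (directSum V).Obj) :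
    IsOrthSum (fun i => (incl V i).obj (ent X i)) X (col X) where
  adj_comp_self i := mult_ext fun k => by
    rw [multEnt_comp, multEnt_adj, multEnt_one]
    by_cases h : k = i
    · subst h
      rw [multEnt_col_self, MultHom.adj_adj, unit_comp_adj_unit]
    · exact (isZero_ent_incl (Ne.symm h) _).mult_from _ _
  adj_comp_of_ne i j hij := mult_ext fun k => by
    rw [multEnt_comp, multEnt_adj, multEnt_zero]
    by_cases h : k = i
    · subst h
      rw [multEnt_col_of_ne X hij, MultHom.comp_zero]
    · rw [multEnt_col_of_ne X h, MultHom.adj_zero, MultHom.zero_comp]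
  dense Z := by
    refine topologicalClosure_span_eq_top_of_subset (dense_single Z X) ?_
    rintro _ ⟨i, a, rfl⟩
    refine Submodule.le_topologicalClosure _ (Submodule.subset_span
      ⟨i, (col X i).adj.L Z (single i a), hom_ext fun k => ?_⟩)
    rw [homEnt_L, homEnt_L, multEnt_adj]
    by_cases h : k = i
    · subst h
      rw [multEnt_col_self, MultHom.adj_adj, ← MultHom.L_comp', adj_unit_comp_unit,
        MultHom.L_one]
    · rw [multEnt_col_of_ne X h, MultHom.L_zero, homEnt_single_of_ne h]

/-- Naturality of `col`. At the index `i` the inclusion conjugates the entry of `a` by `unit`, and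
one of these factors cancels against `col`; all other entries vanish. -/
theorem ofHom_comp_col (a : (directSum V).Hom X Y) (i : I) :
    (MultHom.ofHom a).comp (col X i) =
      (col Y i).comp (MultHom.ofHom ((incl V i).map (homEnt a i))) := mult_ext fun k => by
  rw [multEnt_comp, multEnt_comp, multEnt_ofHom, multEnt_ofHom]
  by_cases h : k = i
  · subst h
    rw [multEnt_col_self, multEnt_col_self, homEnt_incl]
    refine MultHom.ext_L fun T f => ?_
    simp only [MultHom.L_comp', MultHom.L_ofHom]
    rw [← MultHom.L_comp, ← MultHom.L_comp', adj_unit_comp_unit, MultHom.L_one, MultHom.compat]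
  · rw [multEnt_col_of_ne X h, multEnt_col_of_ne Y h, MultHom.comp_zero, MultHom.zero_comp]

/-- Restriction of functors along the inclusion. -/
noncomputable abbrev restr {W : CStarCat.{u}} (f : NDFun (directSum V) W) (j : I) :
    NDFun (V j).toCStarCat W :=
  f.precomp (incl V j) fun X => incl_surjective V j X X

/-- For the object `ι j Z` the isometry `col` is the image under `ι j` of `unit*`; this expresses it
on morphisms in the image of `ι j`, ready for the uniqueness of extensions. -/
theorem col_incl_L {j : I} (Z : (V j).Obj)
    (a : (V j).Hom (ent ((incl V j).obj Z) j) (ent ((incl V j).obj Z) j)) :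
    (col ((incl V j).obj Z) j).L _ ((incl V j).map a) = (incl V j).map ((unit Z).adj.L _ a) := by
  refine hom_ext fun k => ?_
  by_cases h : k = j
  · subst h
    rw [homEnt_L, multEnt_col_self, homEnt_incl, homEnt_incl, ← MultHom.L_comp',
      adj_unit_comp_unit, MultHom.L_one, MultHom.R_L_comm, ← MultHom.L_comp',
      unit_comp_adj_unit, MultHom.L_one]
  -- At any other index both sides are morphisms into a zero object.
  · exact ((isZero_ent_incl (Ne.symm h) Z) _).2 _ |>.trans
      (((isZero_ent_incl (Ne.symm h) Z) _).2 _).symm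

/-- The image of `col X j` under a functor. -/
noncomputable def restrCol {W : CStarCat.{u}} (f : NDFun (directSum V) W) (X : (directSum V).Obj)
    (j : I) : MultHom W ((restr f j).obj (ent X j)) (f.obj X) :=
  f.extM (col X j)

theorem isOrthSum_restrCol {W : CStarCat.{u}} (f : NDFun (directSum V) W)
    (X : (directSum V).Obj) :
    IsOrthSum (fun j => (restr f j).obj (ent X j)) (f.obj X) (restrCol f X) :=
  (isOrthSum_col X).map f

theorem map_comp_restrCol {W : CStarCat.{u}} (f : NDFun (directSum V) W)
    (a : (directSum V).Hom X Y) (j : I) :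
    (f.map a).comp (restrCol f X j) =
      (restrCol f Y j).comp ((restr f j).map (homEnt a j)) := by
  have h : (f.map a).comp (f.extM (col X j)) =
      (f.extM (col Y j)).comp (f.map ((incl V j).map (homEnt a j))) := by
    rw [← f.extM_ofHom, ← f.extM_comp, ofHom_comp_col, f.extM_comp, f.extM_ofHom]
  exact h

/-- Extensions to multipliers are unique, so it is enough to compare on the elements `f(ι j a) ∘ w`,
where `col_incl_L` applies. -/
theorem restr_extM_adj_unit {W : CStarCat.{u}} (f : NDFun (directSum V) W) {j : I}
    (Z : (V j).Obj) :
    (restr f j).extM (unit Z).adj = restrCol f ((incl V j).obj Z) j :=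
  (restr f j).extM_unique fun a T w => by
    refine (f.extM_L (col ((incl V j).obj Z) j) ((incl V j).map a) T w).trans ?_
    rw [col_incl_L]
    rfl

end DSum

/-! ## Transformations out of the direct sum -/

section Transformations

open DSum

variable {I : Type u} {V : I → CLin.{u}} {W : CStarCat.{u}} {f g : NDFun (directSum V) W}

/-- Faithfulness of precomposition: `f X` is the orthogonal sum of the `f (ι i (X i))`, and
naturality along `col X i` moves the comparison to these summands. -/
theorem NatTr.ext_of_restr {σ τ : NatTr f g}
    (h : ∀ (j : I) (Z : (V j).Obj), σ.app ((incl V j).obj Z) = τ.app ((incl V j).obj Z)) :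
    σ = τ :=
  NatTr.ext fun X => ((isOrthSum_col X).map f).hom_ext fun i => by
    rw [σ.naturality_ext, τ.naturality_ext, h]

/-- Since `f(p) f(q) = 1`, one has `t = t f(p) f(q) = g(p) (s Y) f(q) = (s X) f(p) f(q) = s X`. -/
theorem NatTr.eq_app_of_comp_extM {V W : CStarCat.{u}} {f g : NDFun V W} (s : NatTr f g)
    {X Y : V.Obj} {p : MultHom V Y X} {q : MultHom V X Y} (hpq : p.comp q = MultHom.one X)
    {t : MultHom W (f.obj X) (g.obj X)} (h : t.comp (f.extM p) = (g.extM p).comp (s.app Y)) :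
    t = s.app X := by
  rw [← t.comp_one, ← f.extM_one, ← hpq, f.extM_comp, ← MultHom.comp_assoc, h,
    ← s.naturality_ext, MultHom.comp_assoc, ← f.extM_comp, hpq, f.extM_one, MultHom.comp_one]

/-- Fullness of precomposition: the component at `X` is the diagonal multiplier with entries `(s j)
(X j)`, and naturality is checked on each summand. -/
theorem NatTr.exists_of_restr (s : ∀ j, NatTr (restr f j) (restr g j)) {C : ℝ} (hC : 0 ≤ C)
    (hs : ∀ j, ‖s j‖ ≤ C) :
    ∃ σ : NatTr f g, ∀ (j : I) (Z : (V j).Obj), σ.app ((incl V j).obj Z) = (s j).app Z := by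
  choose t ht hts using fun X : (directSum V).Obj =>
    (isOrthSum_restrCol f X).exists_diag (isOrthSum_restrCol g X)
      (fun j => (s j).app (ent X j)) hC fun j => ((s j).norm_app_le _).trans (hs j)
  refine ⟨NatTr.mk t C ht fun X Y a => (isOrthSum_restrCol f X).hom_ext fun j => ?_,
    fun j Z => ?_⟩
  · rw [MultHom.comp_assoc, map_comp_restrCol, ← MultHom.comp_assoc, hts, MultHom.comp_assoc,
      (s j).naturality, ← MultHom.comp_assoc, ← map_comp_restrCol, MultHom.comp_assoc,
      MultHom.comp_assoc, hts]
  -- The diagonal at `ι j Z` involves `s j` at the entry of `ι j Z`, not at `Z` itself. Naturality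
  -- of `s j` along the unitary `unit*` relates the two.
  · refine NatTr.eq_app_of_comp_extM (s j) (adj_unit_comp_unit Z) ?_
    rw [restr_extM_adj_unit, restr_extM_adj_unit]
    exact hts ((incl V j).obj Z) j

end Transformations

/-! ## Functors out of the direct sum -/

theorem NDFun.isZero_obj {V W : CStarCat.{u}} (f : NDFun V W) {X : V.Obj} (hX : IsZero X) :
    IsZero (f.obj X) := by
  refine isZero_of_one_eq_zero ?_
  rw [← f.extM_one, hX.mult_from (MultHom.one X) 0]
  exact f.ext.map_zero X X

section Cotuple

open DSum

variable {I : Type u} {V : I → CLin.{u}} {W : CLin.{u}}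
  (h : ∀ i, NDFun (V i).toCStarCat W.toCStarCat)

/-- Functors preserve zero objects, so the support of the family `h i (X i)` lies in the countable
support of `X`. -/
theorem exists_cotupleObj (X : (directSum V).Obj) :
    ∃ (S : W.Obj) (κ : ∀ i, MultHom W.toCStarCat ((h i).obj (ent X i)) S),
      IsOrthSum (fun i => (h i).obj (ent X i)) S κ := by
  refine IsOrthSum.exists_of_countable W _ ((countable_ent X).mono ?_)
  intro i hi hX
  exact hi ((h i).isZero_obj hX)

/-- The orthogonal sum of the objects `h i (X i)`. -/
noncomputable def cotupleObj (X : (directSum V).Obj) : W.Obj :=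
  Classical.choose (exists_cotupleObj h X)

/-- The inclusions of the objects `h i (X i)` into their sum. -/
noncomputable def cotupleIncl (X : (directSum V).Obj) (i : I) :
    MultHom W.toCStarCat ((h i).obj (ent X i)) (cotupleObj h X) :=
  Classical.choose (Classical.choose_spec (exists_cotupleObj h X)) i

theorem isOrthSum_cotuple (X : (directSum V).Obj) :
    IsOrthSum (fun i => (h i).obj (ent X i)) (cotupleObj h X) (cotupleIncl h X) :=
  Classical.choose_spec (Classical.choose_spec (exists_cotupleObj h X))

theorem exists_cotupleMap {X Y : (directSum V).Obj} (a : (directSum V).Hom X Y) :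
    ∃ n : MultHom W.toCStarCat (cotupleObj h X) (cotupleObj h Y), ‖n‖ ≤ ‖a‖ ∧
      ∀ i, n.comp (cotupleIncl h X i) = (cotupleIncl h Y i).comp ((h i).map (homEnt a i)) :=
  (isOrthSum_cotuple h X).exists_diag (isOrthSum_cotuple h Y) _ (norm_nonneg a) fun i =>
    ((h i).norm_map_le _).trans (norm_homEnt_le a i)

/-- The diagonal multiplier with entries `h i (a i)`. -/
noncomputable def cotupleMap {X Y : (directSum V).Obj} (a : (directSum V).Hom X Y) :
    MultHom W.toCStarCat (cotupleObj h X) (cotupleObj h Y) :=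
  Classical.choose (exists_cotupleMap h a)

theorem cotupleMap_comp {X Y : (directSum V).Obj} (a : (directSum V).Hom X Y) (i : I) :
    (cotupleMap h a).comp (cotupleIncl h X i) =
      (cotupleIncl h Y i).comp ((h i).map (homEnt a i)) :=
  (Classical.choose_spec (exists_cotupleMap h a)).2 i

/-- The functor `⨁ V i → W` given by `h i` on `V i`. -/
noncomputable def cotuple : NDFun (directSum V) W.toCStarCat where
  obj := cotupleObj h
  map := cotupleMap h
  map_add {X Y} a b := (isOrthSum_cotuple h X).hom_ext fun i => by
    rw [MultHom.add_comp, cotupleMap_comp, cotupleMap_comp, cotupleMap_comp, homEnt_add,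
      (h i).map_add, MultHom.comp_add]
  map_smul {X Y} c a := (isOrthSum_cotuple h X).hom_ext fun i => by
    rw [MultHom.smul_comp, cotupleMap_comp, cotupleMap_comp, homEnt_smul,
      (h i).map_smul, MultHom.comp_smul]
  map_comp {X Y Z} b a := (isOrthSum_cotuple h X).hom_ext fun i => by
    rw [MultHom.comp_assoc, cotupleMap_comp, cotupleMap_comp, homEnt_comp, (h i).map_comp,
      ← MultHom.comp_assoc (cotupleMap h b), cotupleMap_comp, MultHom.comp_assoc]
  map_adj {X Y} a := (isOrthSum_cotuple h Y).hom_ext fun i => by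
    rw [cotupleMap_comp, (isOrthSum_cotuple h X).adj_diag_comp (isOrthSum_cotuple h Y)
      (cotupleMap_comp h a), homEnt_adj, (h i).map_adj]
  nondeg := MFun.nondegenerate_of_left fun X Y => by
    -- A morphism into the sum is approximated by combinations of `κ i ∘ w`, with `κ i` the
    -- inclusion of the `i`-th summand, and `w` by combinations of `h i (a) ∘ w'`. Then `κ i ∘ h i
    -- (a) ∘ w'` is the image of `κ i ∘ w'` under the diagonal multiplier of `single i a`.
    refine topologicalClosure_span_eq_top_of_subset
      ((isOrthSum_cotuple h Y).dense (cotupleObj h X)) ?_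
    rintro _ ⟨i, w, rfl⟩
    refine mem_of_dense ((h i).dense_gens (ent Y i) (cotupleObj h X))
      ((cotupleIncl h Y i).L _) (Submodule.isClosed_topologicalClosure _) ?_ w
    rintro _ ⟨a, w, rfl⟩
    refine Submodule.le_topologicalClosure _ (Submodule.subset_span
      ⟨single i a, (cotupleIncl h Y i).L _ w, ?_⟩)
    refine (congrArg (fun m => MultHom.L m _ w) (cotupleMap_comp h (single i a) i)).trans ?_
    rw [homEnt_single_self]
    rfl

/-- The comparison of `h j` with the restriction of `cotuple h`. -/
noncomputable def cotupleUnit (j : I) (Z : (V j).Obj) :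
    MultHom W.toCStarCat ((h j).obj Z) (cotupleObj h ((incl V j).obj Z)) :=
  (cotupleIncl h ((incl V j).obj Z) j).comp ((h j).extM (unit Z))

theorem adj_cotupleUnit_comp (j : I) (Z : (V j).Obj) :
    (cotupleUnit h j Z).adj.comp (cotupleUnit h j Z) = MultHom.one ((h j).obj Z) := by
  rw [cotupleUnit, MultHom.adj_comp, MultHom.comp_assoc,
    ← MultHom.comp_assoc (cotupleIncl h _ j).adj,
    (isOrthSum_cotuple h _).adj_comp_self, MultHom.one_comp, ← (h j).extM_adj,
    ← (h j).extM_comp, adj_unit_comp_unit, (h j).extM_one]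

/-- All summands of the value at `ι j Z` other than the `j`-th are zero objects, so the isometry
`cotupleUnit` is onto. -/
theorem cotupleUnit_comp_adj (j : I) (Z : (V j).Obj) :
    (cotupleUnit h j Z).comp (cotupleUnit h j Z).adj = MultHom.one _ := by
  refine (isOrthSum_cotuple h ((incl V j).obj Z)).hom_ext fun i => ?_
  by_cases hi : j = i
  · subst hi
    rw [cotupleUnit, MultHom.adj_comp, MultHom.comp_assoc, MultHom.comp_assoc, MultHom.comp_assoc,
      (isOrthSum_cotuple h _).adj_comp_self, MultHom.comp_one, ← (h j).extM_adj,
      ← (h j).extM_comp, unit_comp_adj_unit, (h j).extM_one, MultHom.comp_one, MultHom.one_comp]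
  · exact ((h i).isZero_obj (isZero_ent_incl hi Z)).mult_from _ _

theorem cotupleUnit_natural (j : I) {Z Z' : (V j).Obj} (a : (V j).Hom Z Z') :
    (cotupleUnit h j Z').comp ((h j).map a) =
      (cotupleMap h ((incl V j).map a)).comp (cotupleUnit h j Z) := by
  rw [cotupleUnit, cotupleUnit, ← MultHom.comp_assoc, cotupleMap_comp, MultHom.comp_assoc,
    MultHom.comp_assoc, ← (h j).extM_ofHom, ← (h j).extM_ofHom, ← (h j).extM_comp,
    ← (h j).extM_comp]
  -- What remains is an identity of multipliers in `V j`: `unit` intertwines `a` with the entry of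
  -- `ι j a`.
  refine congrArg (fun m => MultHom.comp (cotupleIncl h _ j) ((h j).extM m))
    (MultHom.ext_L fun T b => ?_)
  simp only [MultHom.L_comp', MultHom.L_ofHom, homEnt_incl]
  rw [← MultHom.L_comp, ← MultHom.compat, ← MultHom.L_comp', adj_unit_comp_unit, MultHom.L_one]

theorem norm_cotupleUnit_le (j : I) (Z : (V j).Obj) : ‖cotupleUnit h j Z‖ ≤ 1 :=
  MultHom.norm_le_one_of_adj_comp_self (adj_cotupleUnit_comp h j Z)

/-- The unitary transformation from the restriction of `cotuple h` to `h j`. -/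
noncomputable def cotupleIso (j : I) : NatTr (restr (cotuple h) j) (h j) :=
  -- The natural family runs out of `h j`, while essential surjectivity needs a unitary into `h j`;
  -- hence the adjoint.
  (NatTr.mk (f := h j) (g := restr (cotuple h) j) (cotupleUnit h j) 1 (norm_cotupleUnit_le h j)
    fun _ _ a => cotupleUnit_natural h j a).adj

theorem adj_cotupleIso_comp (j : I) :
    (cotupleIso h j).adj.comp (cotupleIso h j) = NatTr.one (restr (cotuple h) j) :=
  NatTr.ext fun Z => (congrArg (fun m => MultHom.comp m _)
    (MultHom.adj_adj (cotupleUnit h j Z))).trans (cotupleUnit_comp_adj h j Z)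

theorem cotupleIso_comp_adj (j : I) :
    (cotupleIso h j).comp (cotupleIso h j).adj = NatTr.one (h j) :=
  NatTr.ext fun Z => (congrArg (fun m => MultHom.comp _ m)
    (MultHom.adj_adj (cotupleUnit h j Z))).trans (adj_cotupleUnit_comp h j Z)

end Cotuple

/-! ## Equivalences and isomorphisms of unital C*-categories -/

namespace UFun

variable {A B C : UCStarCat.{u}}

/-- The types of the values on morphisms depend on the object maps, so these values can only be
compared by `HEq`. -/
theorem ext_of_heq {F G : UFun A B} (hobj : F.obj = G.obj)
    (hmap : ∀ {X Y : A.Obj} (f : A.Hom X Y), HEq (F.map f) (G.map f)) : F = G := by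
  obtain ⟨⟨o, m, _, _, _, _⟩, _⟩ := F
  obtain ⟨⟨o', m', _, _, _, _⟩, _⟩ := G
  obtain rfl : o = o' := hobj
  obtain rfl : @m = @m' := by
    funext X Y f
    exact eq_of_heq (hmap f)
  rfl

/-- A unital functor that is bijective on morphisms and surjective on objects up to unitary
isomorphism is an equivalence. -/
theorem isEquivalence_of_bijective (F : UFun A B)
    (hF : ∀ X Y : A.Obj, Function.Bijective fun f : A.Hom X Y => F.map f)
    (hess : ∀ Y : B.Obj, ∃ (X : A.Obj) (v : B.Hom (F.obj X) Y),
      B.comp (B.adj v) v = B.one (F.obj X) ∧ B.comp v (B.adj v) = B.one Y) :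
    F.IsEquivalence := by
  choose G v hv hv' using hess
  -- `P` picks preimages under `F`. The inverse functor sends `f` to the preimage of `v* f v`, and
  -- every identity in `A` is checked after applying the faithful `F`.
  choose P hP using fun X Y => (hF X Y).2
  have hP' : ∀ (X Y : A.Obj) (f : B.Hom (F.obj X) (F.obj Y)), F.map (P X Y f) = f := hP
  have hinj : ∀ {X Y : A.Obj} {f g : A.Hom X Y}, F.map f = F.map g → f = g := fun h => (hF _ _).1 h
  have hcancel : ∀ {X Y : B.Obj} (f : B.Hom X Y), B.comp (v Y) (B.comp (B.adj (v Y)) f) = f :=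
    fun f => by rw [← B.comp_assoc, hv', B.one_comp]
  let GF : UFun B A :=
    { obj := G
      map := fun {X Y} f => P _ _ (B.comp (B.adj (v Y)) (B.comp f (v X)))
      map_add := fun f g => hinj (by
        rw [F.map_add, hP', hP', hP', B.add_comp, B.comp_add])
      map_smul := fun c f => hinj (by
        rw [F.map_smul, hP', hP', B.smul_comp, B.comp_smul])
      map_comp := fun g f => hinj (by
        rw [F.map_comp, hP', hP', hP', B.comp_assoc, B.comp_assoc, B.comp_assoc, hcancel])
      map_adj := fun f => hinj (by
        rw [F.map_adj, hP', hP', B.adj_comp, B.adj_comp, B.adj_adj, B.comp_assoc])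
      map_one := fun X => hinj (by
        rw [F.map_one, hP', B.one_comp, hv]) }
  have hnat : ∀ {X Y : A.Obj} (f : A.Hom X Y),
      A.comp (P _ Y (v (F.obj Y))) (P _ _ (B.comp (B.adj (v (F.obj Y)))
        (B.comp (F.map f) (v (F.obj X))))) = A.comp f (P _ X (v (F.obj X))) := fun f => hinj (by
    rw [F.map_comp, F.map_comp, hP', hP', hP', hcancel])
  have hone : ∀ X : A.Obj, A.comp (A.adj (P _ X (v (F.obj X)))) (P _ X (v (F.obj X))) =
      A.one (G (F.obj X)) := fun X => hinj (by
    rw [F.map_comp, F.map_adj, hP', hv, F.map_one])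
  have hone' : ∀ X : A.Obj, A.comp (P _ X (v (F.obj X))) (A.adj (P _ X (v (F.obj X)))) =
      A.one X := fun X => hinj (by
    rw [F.map_comp, F.map_adj, hP', hv', F.map_one])
  have hnat' : ∀ {X Y : B.Obj} (f : B.Hom X Y),
      B.comp (v Y) (F.map (P _ _ (B.comp (B.adj (v Y)) (B.comp f (v X))))) = B.comp f (v X) :=
    fun f => by rw [hP', hcancel]
  -- One unitary isomorphism is `v` itself; the other consists of the preimages of `v` at the
  -- objects `F X`.
  exact ⟨GF, ⟨⟨fun X => P _ X (v (F.obj X)), hnat, hone, hone'⟩⟩, ⟨⟨v, hnat', hv, hv'⟩⟩⟩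

/-- The composition of an equivalence with an isomorphism is an equivalence. -/
theorem IsIsomorphism.comp_isEquivalence {H : UFun B C} (hH : H.IsIsomorphism) {F : UFun A B}
    (hF : F.IsEquivalence) : (H.comp F).IsEquivalence := by
  obtain ⟨K, hKH, hHK⟩ := hH
  obtain ⟨G, ⟨α⟩, ⟨β⟩⟩ := hF
  refine ⟨G.comp K, ⟨?_⟩, ⟨?_⟩⟩
  · have h : (G.comp K).comp (H.comp F) = G.comp F :=
      congrArg (fun T : UFun B B => G.comp (T.comp F)) hKH
    rw [h]
    exact α
  -- The isomorphism `β` is whiskered with `K` and `H`; its target `H ∘ id ∘ K` is then equal to the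
  -- identity.
  · have h : UnitaryNatIso (H.comp ((F.comp G).comp K)) (H.comp ((id B).comp K)) :=
      { app := fun X => H.map (β.app (K.obj X))
        naturality := fun {X Y} f => by
          have h := congrArg H.map (β.naturality (K.map f))
          rwa [H.map_comp, H.map_comp] at h
        adj_comp_self := fun X => by
          have h := congrArg H.map (β.adj_comp_self (K.obj X))
          rwa [H.map_comp, H.map_adj, H.map_one] at h
        comp_adj_self := fun X => by
          have h := congrArg H.map (β.comp_adj_self (K.obj X))
          rwa [H.map_comp, H.map_adj, H.map_one] at h }
    have h' : H.comp ((id B).comp K) = id C := hHK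
    rw [h'] at h
    exact h

end UFun

/-! ## Bounded families as multipliers -/

section Bounded

variable {I : Type u} {A B : I → UCStarCat.{u}}

/-- The entries of a multiplier morphism of the direct product. -/
noncomputable def multProdEnt {X Y : ∀ i, (A i).Obj}
    (m : MultHom (CStarCat.prod fun i => (A i).toCStarCat) X Y) (i : I) :
    (A i).Hom (X i) (Y i) :=
  ProdHom.app (A := fun i => (A i).toCStarCat) (X := X) (Y := Y)
    (m.L X (truncOne A X {i} (Set.finite_singleton i))) i

theorem truncOne_app_self (X : ∀ i, (A i).Obj) (i : I) :
    (truncOne A X {i} (Set.finite_singleton i)).app i = (A i).one (X i) :=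
  if_pos rfl

/-- With `e` the identity placed at `i`, compatibility gives `e (m f) = (e m) f`, and taking the
entry at `i` removes `e` on the left. -/
theorem L_app_eq_R_app {X Y Z : ∀ i, (A i).Obj}
    (m : MultHom (CStarCat.prod fun i => (A i).toCStarCat) X Y)
    (f : ProdHom (fun i => (A i).toCStarCat) Z X) (i : I) :
    ProdHom.app (A := fun i => (A i).toCStarCat) (X := Z) (Y := Y) (m.L Z f) i =
      (A i).comp (ProdHom.app (A := fun i => (A i).toCStarCat) (X := X) (Y := Y)
        (m.R Y (truncOne A Y {i} (Set.finite_singleton i))) i) (f.app i) := by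
  have h := congrArg (fun k : ProdHom (fun i => (A i).toCStarCat) Z Y => k.app i)
    (m.compat f (truncOne A Y {i} (Set.finite_singleton i)))
  refine Eq.trans ?_ h
  change _ = (A i).comp ((truncOne A Y {i} (Set.finite_singleton i)).app i) _
  rw [truncOne_app_self, (A i).one_comp]

theorem multProdEnt_eq_R_app {X Y : ∀ i, (A i).Obj}
    (m : MultHom (CStarCat.prod fun i => (A i).toCStarCat) X Y) (i : I) :
    multProdEnt m i = ProdHom.app (A := fun i => (A i).toCStarCat) (X := X) (Y := Y)
      (m.R Y (truncOne A Y {i} (Set.finite_singleton i))) i := by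
  rw [multProdEnt, L_app_eq_R_app, truncOne_app_self, (A i).comp_one]

/-- A multiplier of a direct product of unital categories acts entrywise through its entries: the
two descriptions of an entry, by left and by right action on the identity at `i`, agree. -/
theorem L_app {X Y Z : ∀ i, (A i).Obj}
    (m : MultHom (CStarCat.prod fun i => (A i).toCStarCat) X Y)
    (f : ProdHom (fun i => (A i).toCStarCat) Z X) (i : I) :
    ProdHom.app (A := fun i => (A i).toCStarCat) (X := Z) (Y := Y) (m.L Z f) i =
      (A i).comp (multProdEnt m i) (f.app i) := by
  rw [multProdEnt_eq_R_app, L_app_eq_R_app]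

theorem norm_truncOne_le (X : ∀ i, (A i).Obj) (S : Set I) (hS : S.Finite) :
    ‖truncOne A X S hS‖ ≤ 1 := by
  classical
  refine ProdHom.norm_le_of zero_le_one fun i => ?_
  change ‖if i ∈ S then (A i).one (X i) else 0‖ ≤ 1
  split_ifs
  · exact (A i).norm_one_le _
  · rw [norm_zero]
    exact zero_le_one

theorem adj_truncOne (X : ∀ i, (A i).Obj) (S : Set I) (hS : S.Finite) :
    ProdHom.adj (truncOne A X S hS) = truncOne A X S hS := by
  classical
  refine ProdHom.ext fun i => ?_
  change (A i).adj (if i ∈ S then (A i).one (X i) else 0) = if i ∈ S then (A i).one (X i) else 0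
  split_ifs
  · exact (A i).adj_one _
  · exact (A i).adj_zero

theorem MultHom.exists_bound {V : CStarCat.{u}} {X Y : V.Obj} (m : MultHom V X Y) :
    ∃ C : ℝ, 0 ≤ C ∧ ∀ (Z : V.Obj) (f : V.Hom Z X), ‖m.L Z f‖ ≤ C * ‖f‖ :=
  ⟨‖m‖, norm_nonneg m, fun Z f => (m.L Z).le_of_opNorm_le (m.norm_L_le Z) f⟩

theorem exists_norm_multProdEnt_le {X Y : ∀ i, (A i).Obj}
    (m : MultHom (CStarCat.prod fun i => (A i).toCStarCat) X Y) :
    ∃ C : ℝ, ∀ i, ‖multProdEnt m i‖ ≤ C := by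
  obtain ⟨C, hC, h⟩ := m.exists_bound
  refine ⟨C, fun i => ?_⟩
  refine (ProdHom.norm_app_le (A := fun i => (A i).toCStarCat) (X := X) (Y := Y) _ i).trans ?_
  exact (h X _).trans (mul_le_of_le_one_right hC (norm_truncOne_le X _ _))

/-- The bounded family of entries of a multiplier morphism of the direct product. -/
noncomputable def multProdFam {X Y : ∀ i, (A i).Obj}
    (m : MultHom (CStarCat.prod fun i => (A i).toCStarCat) X Y) :
    lp (fun i => (A i).Hom (X i) (Y i)) ∞ :=
  ⟨multProdEnt m, memℓp_infty (by
    obtain ⟨C, hC⟩ := exists_norm_multProdEnt_le m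
    exact ⟨C, by rintro _ ⟨i, rfl⟩; exact hC i⟩)⟩

theorem bddMult_multProdFam {X Y : ∀ i, (A i).Obj}
    (m : MultHom (CStarCat.prod fun i => (A i).toCStarCat) X Y) :
    bddMult (multProdFam m) = m :=
  MultHom.ext_L fun _ f => ProdHom.ext fun i => (L_app m f i).symm

theorem multProdFam_bddMult {X Y : ∀ i, (A i).Obj}
    (f : lp (fun i => (A i).Hom (X i) (Y i)) ∞) : multProdFam (bddMult f) = f :=
  lp.ext (funext fun i => by
    change (A i).comp (f i) ((truncOne A X {i} (Set.finite_singleton i)).app i) = f i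
    rw [truncOne_app_self, (A i).comp_one])

/-- The adjoint exchanges left and right action, and the identity placed at `i` is self-adjoint. -/
theorem multProdEnt_adj {X Y : ∀ i, (A i).Obj}
    (m : MultHom (CStarCat.prod fun i => (A i).toCStarCat) X Y) (i : I) :
    multProdEnt (X := Y) (Y := X) m.adj i = (A i).adj (multProdEnt m i) := by
  rw [multProdEnt_eq_R_app m]
  change (A i).adj (ProdHom.app (A := fun i => (A i).toCStarCat) (X := X) (Y := Y)
    (m.R Y (ProdHom.adj (truncOne A Y {i} (Set.finite_singleton i)))) i) = _
  rw [adj_truncOne]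

/-- Multiplier morphisms of the direct product as bounded families. -/
noncomputable def toBdd (A : I → UCStarCat.{u}) :
    UFun (mult (CStarCat.prod fun i => (A i).toCStarCat)) (UCStarCat.bddProd A) where
  obj := fun X => X
  map := fun {X Y : ∀ i, (A i).Obj}
    (m : MultHom (CStarCat.prod fun i => (A i).toCStarCat) X Y) => multProdFam m
  map_add := fun {X Y : ∀ i, (A i).Obj} _ _ =>
    lp.ext (E := fun i => (A i).Hom (X i) (Y i)) rfl
  map_smul := fun {X Y : ∀ i, (A i).Obj} _ _ =>
    lp.ext (E := fun i => (A i).Hom (X i) (Y i)) rfl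
  map_comp := fun {X Y Z : ∀ i, (A i).Obj}
      (n : MultHom (CStarCat.prod fun i => (A i).toCStarCat) Y Z) _ =>
    lp.ext (E := fun i => (A i).Hom (X i) (Z i)) (funext fun i => L_app n _ i)
  map_adj := fun {X Y : ∀ i, (A i).Obj}
      (m : MultHom (CStarCat.prod fun i => (A i).toCStarCat) X Y) =>
    lp.ext (E := fun i => (A i).Hom (Y i) (X i)) (funext fun i => multProdEnt_adj m i)
  map_one := fun X : ∀ i, (A i).Obj =>
    lp.ext (E := fun i => (A i).Hom (X i) (X i)) (funext fun i => truncOne_app_self X i)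

theorem isIsomorphism_ofBdd (A : I → UCStarCat.{u}) : (ofBdd A).IsIsomorphism :=
  ⟨toBdd A, UFun.ext_of_heq rfl fun {X Y : ∀ i, (A i).Obj}
      (f : lp (fun i => (A i).Hom (X i) (Y i)) ∞) => heq_of_eq (multProdFam_bddMult f),
    UFun.ext_of_heq rfl fun {X Y : ∀ i, (A i).Obj}
      (m : MultHom (CStarCat.prod fun i => (A i).toCStarCat) X Y) =>
      heq_of_eq (bddMult_multProdFam m)⟩

/-- `mprodMap G` is defined by unique extension, so it suffices that the bounded family with entries
`(G i).map (f i)` acts correctly on images of morphisms; this holds entrywise by functoriality of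
each `G i`. -/
theorem ofBdd_comp_bddMap (G : ∀ i, UFun (A i) (B i)) :
    (ofBdd B).comp (bddMap G) = (mprodMap G).comp (ofBdd A) :=
  UFun.ext_of_heq rfl fun {X Y : ∀ i, (A i).Obj}
      (f : lp (fun i => (A i).Hom (X i) (Y i)) ∞) => heq_of_eq
    (Eq.symm ((prodMap G).extM_unique (X := X) (Y := Y) (m := bddMult f) fun _ _ _ =>
      ProdHom.ext fun i => ((B i).comp_assoc ((G i).map (f i)) _ _).symm.trans
        (congrArg (fun t => (B i).comp t _) ((G i).map_comp _ _).symm)))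

/-- By the C*-identity each `v i` has norm at most one, so the family is automatically bounded. -/
theorem exists_unitary_bddProd {X Y : ∀ i, (A i).Obj} (v : ∀ i, (A i).Hom (X i) (Y i))
    (h : ∀ i, (A i).comp ((A i).adj (v i)) (v i) = (A i).one (X i))
    (h' : ∀ i, (A i).comp (v i) ((A i).adj (v i)) = (A i).one (Y i)) :
    ∃ w : (UCStarCat.bddProd A).Hom X Y,
      (UCStarCat.bddProd A).comp ((UCStarCat.bddProd A).adj w) w = (UCStarCat.bddProd A).one X ∧
      (UCStarCat.bddProd A).comp w ((UCStarCat.bddProd A).adj w) = (UCStarCat.bddProd A).one Y := by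
  have hv : ∀ i, ‖v i‖ ≤ 1 := fun i => by
    have h1 := (A i).norm_adj_comp_self (v i)
    rw [h i] at h1
    nlinarith [norm_nonneg (v i), (A i).norm_one_le (X i)]
  let w : lp (fun i => (A i).Hom (X i) (Y i)) ∞ :=
    ⟨v, memℓp_infty ⟨1, by rintro _ ⟨i, rfl⟩; exact hv i⟩⟩
  exact ⟨w, lp.ext (E := fun i => (A i).Hom (X i) (X i)) (funext h),
    lp.ext (E := fun i => (A i).Hom (Y i) (Y i)) (funext h')⟩

/-- Faithfulness only has to hold for all `F i` jointly, and fullness and essential surjectivity are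
required simultaneously in all entries, with a common bound on the morphisms. -/
theorem isEquivalence_famFun {C : UCStarCat.{u}} (F : ∀ i, UFun C (A i))
    (hinj : ∀ (X Y : C.Obj) (f g : C.Hom X Y), (∀ i, (F i).map f = (F i).map g) → f = g)
    (hsurj : ∀ (X Y : C.Obj) (s : ∀ i, (A i).Hom ((F i).obj X) ((F i).obj Y)) (K : ℝ), 0 ≤ K →
      (∀ i, ‖s i‖ ≤ K) → ∃ f : C.Hom X Y, ∀ i, (F i).map f = s i)
    (hess : ∀ Y : ∀ i, (A i).Obj, ∃ (X : C.Obj) (v : ∀ i, (A i).Hom ((F i).obj X) (Y i)),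
      (∀ i, (A i).comp ((A i).adj (v i)) (v i) = (A i).one ((F i).obj X)) ∧
      ∀ i, (A i).comp (v i) ((A i).adj (v i)) = (A i).one (Y i)) :
    (famFun F).IsEquivalence := by
  refine UFun.isEquivalence_of_bijective _ (fun X Y => ⟨fun f g hfg => ?_, fun s => ?_⟩)
    fun Y => ?_
  · exact hinj X Y f g fun i =>
      congrArg (fun s : lp (fun i => (A i).Hom ((F i).obj X) ((F i).obj Y)) ∞ => s i) hfg
  · let s' : lp (fun i => (A i).Hom ((F i).obj X) ((F i).obj Y)) ∞ := s
    obtain ⟨f, hf⟩ := hsurj X Y (fun i => s' i) ‖s'‖ (norm_nonneg s') fun i =>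
      lp.norm_apply_le_norm ENNReal.top_ne_zero s' i
    exact ⟨f, lp.ext (E := fun i => (A i).Hom ((F i).obj X) ((F i).obj Y)) (funext hf)⟩
  · obtain ⟨X, v, hv, hv'⟩ := hess Y
    exact ⟨X, exists_unitary_bddProd v hv hv'⟩

end Bounded

/-! ## The universal property -/

section Universal

open DSum

variable {I : Type u} (V : I → CLin.{u})

theorem isEquivalence_precompTrans (W : CLin.{u}) :
    (precompTrans V W.toCStarCat).IsEquivalence :=
  isEquivalence_famFun (precompIncl V W.toCStarCat)
    (fun f g σ τ h => NatTr.ext_of_restr (f := f) (g := g) fun j Z =>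
      congrArg (fun s : NatTr (restr f j) (restr g j) => s.app Z) (h j))
    (fun f g s C hC hs => by
      obtain ⟨σ, hσ⟩ := NatTr.exists_of_restr (f := f) (g := g) s hC hs
      exact ⟨σ, fun j => NatTr.ext (f := restr f j) (g := restr g j) (hσ j)⟩)
    (fun h => ⟨cotuple h, cotupleIso h, adj_cotupleIso_comp h, cotupleIso_comp_adj h⟩)

/-- Restricting along the inclusions and applying `k` act on opposite sides, so the two composites
agree definitionally. -/
theorem precompTrans_comp_postcomp {W W' : CStarCat.{u}} (k : NDFun W W') :
    (precompTrans V W').comp (postcomp (directSum V) k) =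
      (transPost V k).comp (precompTrans V W) := rfl

theorem precompTrans_map_whiskR {W W' : CStarCat.{u}} {k k' : NDFun W W'} (τ : NatTr k k')
    (f : NDFun (directSum V) W) :
    (precompTrans V W').map (τ.whiskR f) = transWhisk V τ ((precompTrans V W).obj f) := rfl

theorem precompMult_map_whiskR {W W' : CStarCat.{u}} {k k' : NDFun W W'} (τ : NatTr k k')
    (f : NDFun (directSum V) W) :
    (precompMult V W').map (τ.whiskR f) = multProdWhisk V τ ((precompMult V W).obj f) :=
  congrArg (ofBdd fun i => funCat (V i).toCStarCat W').map (precompTrans_map_whiskR V τ f)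

theorem precompMult_comp_postcomp {W W' : CStarCat.{u}} (k : NDFun W W') :
    (precompMult V W').comp (postcomp (directSum V) k) =
      (multProdPost V k).comp (precompMult V W) :=
  congrArg (fun F => UFun.comp F (precompTrans V W))
    (ofBdd_comp_bddMap fun i => postcomp (V i).toCStarCat k)

end Universal

end CStarLin

/-! ### The proposition -/

theorem mainTheorem11 {I : Type u} (V : I → CStarLin.CLin.{u}) :
    CStarLin.IsCountablyAdditive (CStarLin.directSum V) ∧
    (∀ W : CStarLin.CLin.{u},
      (CStarLin.precompMult V W.toCStarCat).IsEquivalence ∧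
      (CStarLin.ofBdd fun i => CStarLin.funCat (V i).toCStarCat W.toCStarCat).IsIsomorphism ∧
      (CStarLin.precompTrans V W.toCStarCat).IsEquivalence) ∧
    (∀ (W W' : CStarLin.CLin.{u}) (k : CStarLin.NDFun W.toCStarCat W'.toCStarCat),
      (CStarLin.precompMult V W'.toCStarCat).comp
          (CStarLin.postcomp (CStarLin.directSum V) k) =
        (CStarLin.multProdPost V k).comp (CStarLin.precompMult V W.toCStarCat) ∧
      (CStarLin.precompTrans V W'.toCStarCat).comp
          (CStarLin.postcomp (CStarLin.directSum V) k) =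
        (CStarLin.transPost V k).comp (CStarLin.precompTrans V W.toCStarCat) ∧
      (CStarLin.ofBdd fun i => CStarLin.funCat (V i).toCStarCat W'.toCStarCat).comp
          (CStarLin.transPost V k) =
        (CStarLin.multProdPost V k).comp
          (CStarLin.ofBdd fun i => CStarLin.funCat (V i).toCStarCat W.toCStarCat)) ∧
    (∀ (W W' : CStarLin.CLin.{u}) (k k' : CStarLin.NDFun W.toCStarCat W'.toCStarCat)
      (τ : CStarLin.NatTr k k') (f : CStarLin.NDFun (CStarLin.directSum V) W.toCStarCat),
      (CStarLin.precompMult V W'.toCStarCat).map (τ.whiskR f) =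
        CStarLin.multProdWhisk V τ ((CStarLin.precompMult V W.toCStarCat).obj f) ∧
      (CStarLin.precompTrans V W'.toCStarCat).map (τ.whiskR f) =
        CStarLin.transWhisk V τ ((CStarLin.precompTrans V W.toCStarCat).obj f)) := by
  refine ⟨CStarLin.DSum.isCountablyAdditive V, fun W => ?_, fun W W' k => ?_,
    fun W W' k k' τ f => ?_⟩
  · have h := CStarLin.isEquivalence_precompTrans V W
    have h' := CStarLin.isIsomorphism_ofBdd
      fun i => CStarLin.funCat (V i).toCStarCat W.toCStarCat
    -- `precompMult` is by definition `ofBdd` after `precompTrans`, an isomorphism after an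
    -- equivalence.
    exact ⟨h'.comp_isEquivalence h, h', h⟩
  · exact ⟨CStarLin.precompMult_comp_postcomp V k, CStarLin.precompTrans_comp_postcomp V k,
      CStarLin.ofBdd_comp_bddMap fun i => CStarLin.postcomp (V i).toCStarCat k⟩
  · exact ⟨CStarLin.precompMult_map_whiskR V τ f, CStarLin.precompTrans_map_whiskR V τ f⟩
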